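/- Let $n>3$ and let $M^n$ be a closed (compact, without boundary) smooth hypersurface, embedded or more generally immersed, in the unit sphere $S^{n+1}$, with a globally defined smooth unit normal field $\nu$ (which always exists when $M$ is embedded). Let $\lambda_1,\dots,\lambda_n$ be its principal curvatures with respect to $\nu$, counted with multiplicity, and let $R_M$ be the scalar curvature of the induced Riemannian metric. Suppose that 1. $R_M\ge 0$ on $M$; 2. for each $k=1,\dots,n-1$ the power sum $\sum_{i=1}^n\lambda_i^k$ is constant on $M$. Then $M$ is isoparametric, that is, its principal curvatures are constant (on each connected component of $M$, if $M$ is not assumed connected). Moreover, if at some point of $M$ the $n$ principal curvatures are pairwise distinct, then $R_M\equiv 0$ on $M$. -/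

import Mathlib

open scoped Manifold ContDiff InnerProductSpace

noncomputable section

namespace SphereHypersurface

/-! ### Scalar curvature of a Riemannian metric in coordinates

A metric on an open subset of `ℝⁿ` is given by its coefficient matrix `x ↦ (g_ij(x))`. -/

section Coordinates

variable {n : ℕ}

/-- The partial derivative `∂_i u (x)`. -/
def partialDeriv (i : Fin n) (u : EuclideanSpace ℝ (Fin n) → ℝ)
    (x : EuclideanSpace ℝ (Fin n)) : ℝ :=
  fderiv ℝ u x (EuclideanSpace.single i 1)

/-- The Christoffel symbol of the Levi-Civita connection,
`Γ^k_ij = ½ ∑_l g^{kl} (∂_i g_jl + ∂_j g_il - ∂_l g_ij)`. -/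
def christoffel (g : EuclideanSpace ℝ (Fin n) → Matrix (Fin n) (Fin n) ℝ)
    (k i j : Fin n) (x : EuclideanSpace ℝ (Fin n)) : ℝ :=
  (1 / 2 : ℝ) * ∑ l, (g x)⁻¹ k l *
    (partialDeriv i (fun y => g y j l) x + partialDeriv j (fun y => g y i l) x
      - partialDeriv l (fun y => g y i j) x)

/-- The coefficient `R_ijk^l` of the curvature tensor, where
`R(∂_i, ∂_j) ∂_k = ∇_i ∇_j ∂_k - ∇_j ∇_i ∂_k = ∑_l R_ijk^l ∂_l`. -/
def riemannCoeff (g : EuclideanSpace ℝ (Fin n) → Matrix (Fin n) (Fin n) ℝ)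
    (i j k l : Fin n) (x : EuclideanSpace ℝ (Fin n)) : ℝ :=
  partialDeriv i (christoffel g l j k) x - partialDeriv j (christoffel g l i k) x
    + ∑ m, (christoffel g m j k x * christoffel g l i m x
      - christoffel g m i k x * christoffel g l j m x)

/-- The Ricci curvature `Ric_jk = ∑_i R_ijk^i`, the trace of `X ↦ R(X, ∂_j) ∂_k`. -/
def ricciCoeff (g : EuclideanSpace ℝ (Fin n) → Matrix (Fin n) (Fin n) ℝ)
    (j k : Fin n) (x : EuclideanSpace ℝ (Fin n)) : ℝ :=
  ∑ i, riemannCoeff g i j k i x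

/-- The scalar curvature `∑_jk g^{jk} Ric_jk`; it equals `n (n - 1)` for the unit `n`-sphere. -/
def scalarCurvatureCoord (g : EuclideanSpace ℝ (Fin n) → Matrix (Fin n) (Fin n) ℝ)
    (x : EuclideanSpace ℝ (Fin n)) : ℝ :=
  ∑ j, ∑ k, (g x)⁻¹ j k * ricciCoeff g j k x

end Coordinates

/-! ### Hypersurfaces of the unit sphere -/

/-- The unit sphere `S^{n+1}` of `ℝ^{n+2}`. -/
abbrev UnitSphere (n : ℕ) : Type :=
  Metric.sphere (0 : EuclideanSpace ℝ (Fin (n + 1 + 1))) 1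

section Hypersurface

variable {n : ℕ} {M : Type*} [TopologicalSpace M] [ChartedSpace (EuclideanSpace ℝ (Fin n)) M]

/-- A smooth (immersed) hypersurface of `S^{n+1}`: a smooth map whose differential is
injective at every point. -/
structure IsHypersurface (f : M → UnitSphere n) : Prop where
  contMDiff : ContMDiff (𝓡 n) (𝓡 (n + 1)) ∞ f
  injective_mfderiv : ∀ p, Function.Injective (mfderiv (𝓡 n) (𝓡 (n + 1)) f p)

/-- The map `f : M → S^{n+1}` regarded as a map into `ℝ^{n+2}`. -/
def position (f : M → UnitSphere n) (p : M) : EuclideanSpace ℝ (Fin (n + 1 + 1)) := (f p)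

/-- The differential at `p` of a map from `M` into `ℝ^{n+2}`. -/
def differential (u : M → EuclideanSpace ℝ (Fin (n + 1 + 1))) (p : M) :
    EuclideanSpace ℝ (Fin n) →ₗ[ℝ] EuclideanSpace ℝ (Fin (n + 1 + 1)) :=
  (mfderiv (𝓡 n) 𝓘(ℝ, EuclideanSpace ℝ (Fin (n + 1 + 1))) u p).toLinearMap

/-- `ν` is a smooth unit normal field of the hypersurface `f` inside `S^{n+1}`: `ν p` is a unit
vector that is tangent to the sphere at `f p` and orthogonal to the image of the differential. -/
structure IsUnitNormal (f : M → UnitSphere n) (ν : M → EuclideanSpace ℝ (Fin (n + 1 + 1))) :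
    Prop where
  contMDiff : ContMDiff (𝓡 n) 𝓘(ℝ, EuclideanSpace ℝ (Fin (n + 1 + 1))) ∞ ν
  norm_eq_one : ∀ p, ‖ν p‖ = 1
  inner_position : ∀ p, ⟪ν p, position f p⟫_ℝ = 0
  inner_differential : ∀ p v, ⟪ν p, differential (position f) p v⟫_ℝ = 0

/-- The shape operator `A` of `f` with respect to `ν`, an endomorphism of the tangent space of `M`
at `p`. It is characterized by `df (A v) = -dν v`: the vector `dν v` is orthogonal to `f p` and to
`ν p`, so it lies in the image of the injective map `df`. -/
def shapeOperator (f : M → UnitSphere n) (ν : M → EuclideanSpace ℝ (Fin (n + 1 + 1))) (p : M) :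
    Module.End ℝ (EuclideanSpace ℝ (Fin n)) :=
  -((differential (position f) p).leftInverse ∘ₗ differential ν p)

/-- The principal curvatures `λ_1, …, λ_n` at `p`: the eigenvalues of the shape operator, listed
with multiplicity. -/
def principalCurvatures (f : M → UnitSphere n) (ν : M → EuclideanSpace ℝ (Fin (n + 1 + 1)))
    (p : M) : Multiset ℝ :=
  (shapeOperator f ν p).charpoly.roots

/-- The power sum `∑_i λ_i ^ k` of the principal curvatures at `p`. -/
def powerSum (f : M → UnitSphere n) (ν : M → EuclideanSpace ℝ (Fin (n + 1 + 1)))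
    (k : ℕ) (p : M) : ℝ :=
  ((principalCurvatures f ν p).map (fun t => t ^ k)).sum

/-- The hypersurface is isoparametric: its principal curvatures are constant, on each connected
component of `M` (thus on all of `M` when `M` is connected). -/
def IsIsoparametric (f : M → UnitSphere n) (ν : M → EuclideanSpace ℝ (Fin (n + 1 + 1))) : Prop :=
  ∀ p, ∀ q ∈ connectedComponent p, principalCurvatures f ν q = principalCurvatures f ν p

/-- The coefficients `g_ij = ⟨∂_i f, ∂_j f⟩` of the induced Riemannian metric in the preferred
chart at `p`. -/
def inducedMetricCoord (f : M → UnitSphere n) (p : M) (x : EuclideanSpace ℝ (Fin n)) :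
    Matrix (Fin n) (Fin n) ℝ :=
  Matrix.of fun i j =>
    ⟪fderiv ℝ (position f ∘ (extChartAt (𝓡 n) p).symm) x (EuclideanSpace.single i 1),
      fderiv ℝ (position f ∘ (extChartAt (𝓡 n) p).symm) x (EuclideanSpace.single j 1)⟫_ℝ

/-- The scalar curvature `R_M` at `p` of the Riemannian metric that `f` induces on `M`. -/
def scalarCurvature (f : M → UnitSphere n) (p : M) : ℝ :=
  scalarCurvatureCoord (inducedMetricCoord f p) (extChartAt (𝓡 n) p p)

end Hypersurface

end SphereHypersurface

end

noncomputable section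

open Polynomial Finset

namespace SphereHypersurface

/-! ### Real-rooted polynomials -/

/-! By Newton's identities the power sums of order below n fix every coefficient of the
characteristic polynomial of the shape operator except the constant one. So this polynomial is P -
c, with P fixed and c a smooth function on M. The first two power sums are among the constant ones,
hence by the Gauss equation the scalar curvature is a constant R ≥ 0. It remains to show dc = 0
(`IsLevelHypersurface.diffAt_eq_zero`).

Suppose dc does not vanish identically and let a < b be the extreme values of c. Where a < c < b,
Laguerre's inequality for the real-rooted polynomials P - a and P - b makes the roots of P - c
simple, so there are local smooth orthonormal frames e_i of principal directions, with curvatures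
λ_i. The Codazzi equation gives ⟨∇_{e_i} e_i, e_j⟩ = e_j(c) / (P'(λ_i)(λ_i - λ_j)), and partial
fractions sum this to X = ∑_i ∇_{e_i} e_i = ∑_j P''(λ_j) / (2 P'(λ_j)²) · e_j(c) e_j. In the traced
Gauss equation the products with three distinct indices cancel by Codazzi, leaving R = 2 div X + ∑_j
q_j e_j(c)². Each q_j is negative; this is an inequality about real-rooted polynomials
(`sq_lt_sum_inv_derivative`). Hence div X ≥ 0, with strict inequality where dc ≠ 0.

As X lives only where a < c < b, the divergence theorem is applied to ψ(c) X, with ψ a cutoff on a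
logarithmic scale K near a and b. The error ψ'(c) dc(X) is controlled from below by three facts:
Laguerre's inequality bounds P''/(2P'²) from above by 1/(2(c - a)) and from below by -1/(2(b - c));
Glaeser's inequality gives |dc|² ≤ C min(c - a, b - c); and ψ' is O(1/K) divided by the distance to
the ends. So the error is at least -B/K, and K → ∞ contradicts the positive integral of ψ(c) div X.

With dc = 0 the characteristic polynomial is locally constant. Near a point with distinct curvatures
X then vanishes, and the formula for R gives R = 0. -/

lemma exists_abs_sum_mul_prod_le {ι : Type*} [DecidableEq ι] (s : Finset ι) (hs : s.Nonempty)
    (y : ι → ℝ) : ∃ i ∈ s, |∑ k ∈ s, y k| * ∏ k ∈ s.erase i, |1 - y k / y i| ≤ |y i| := by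
  have pos : ∀ y : ι → ℝ, 0 < ∑ k ∈ s, y k →
      ∃ i ∈ s, |∑ k ∈ s, y k| * ∏ k ∈ s.erase i, |1 - y k / y i| ≤ |y i| := by
    intro y hS
    -- With `y i` maximal all ratios `y k / y i` are at most 1. If σ is their sum over k ≠ i, then 1
    -- - t ≤ exp(-t) bounds the product by exp(-σ), 1 + σ ≤ exp σ bounds the whole sum by `y i` exp
    -- σ, and the exponentials cancel.
    obtain ⟨i, hi, hmax⟩ := s.exists_max_image y hs
    have hyi : 0 < y i := by
      by_contra h
      exact absurd hS (not_lt.2 (sum_nonpos fun k hk => (hmax k hk).trans (not_lt.1 h)))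
    refine ⟨i, hi, ?_⟩
    rw [abs_of_pos hS, abs_of_pos hyi]
    have h1 : ∏ k ∈ s.erase i, |1 - y k / y i| ≤ Real.exp (-∑ k ∈ s.erase i, y k / y i) := by
      rw [← sum_neg_distrib, Real.exp_sum]
      refine prod_le_prod (fun _ _ => abs_nonneg _) fun k hk => ?_
      have : y k / y i ≤ 1 := (div_le_one hyi).2 (hmax k (mem_of_mem_erase hk))
      rw [abs_of_nonneg (by linarith)]
      have := Real.add_one_le_exp (-(y k / y i))
      linarith
    have h2 : ∑ k ∈ s, y k = y i * (1 + ∑ k ∈ s.erase i, y k / y i) := by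
      rw [← add_sum_erase s y hi, ← sum_div]; field_simp
    have h3 : ∑ k ∈ s, y k ≤ y i * Real.exp (∑ k ∈ s.erase i, y k / y i) := by
      rw [h2]
      have := Real.add_one_le_exp (∑ k ∈ s.erase i, y k / y i)
      exact mul_le_mul_of_nonneg_left (by linarith) hyi.le
    calc (∑ k ∈ s, y k) * ∏ k ∈ s.erase i, |1 - y k / y i|
        ≤ (y i * Real.exp (∑ k ∈ s.erase i, y k / y i))
          * Real.exp (-∑ k ∈ s.erase i, y k / y i) :=
          mul_le_mul h3 h1 (prod_nonneg fun _ _ => abs_nonneg _) (by positivity)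
      _ = y i := by rw [mul_assoc, ← Real.exp_add]; simp
  -- Replacing y by -y changes neither side, so a negative sum reduces to a positive one.
  rcases lt_trichotomy (∑ k ∈ s, y k) 0 with h | h | h
  · obtain ⟨i, hi, h⟩ := pos (-y) (by simpa using h)
    exact ⟨i, hi, by simpa using h⟩
  · obtain ⟨i, hi⟩ := hs
    exact ⟨i, hi, by simp [h]⟩
  · exact pos y h

/-- Differentiating the partial fraction expansion of `1 / Q` at a point which is not a root. -/
lemma sum_inv_derivative_nodal {ι : Type*} [DecidableEq ι] (s : Finset ι) (hs : s.Nonempty)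
    (v : ι → ℝ) (hv : Set.InjOn v s) (x : ℝ) (hx : ∀ i ∈ s, x ≠ v i) :
    ∑ i ∈ s, ((derivative (Lagrange.nodal s v)).eval (v i))⁻¹ * ((x - v i) ^ 2)⁻¹
      = (derivative (Lagrange.nodal s v)).eval x / (Lagrange.nodal s v).eval x ^ 2 := by
  set Q := Lagrange.nodal s v with hQ
  -- Lagrange interpolation of the constant 1 at the nodes is the partial fraction expansion of 1/Q;
  -- the nodal weights are 1/Q'(v_i).
  have hpf : ∀ z : ℝ, (∀ i ∈ s, z ≠ v i) →
      Q.eval z * ∑ i ∈ s, ((derivative Q).eval (v i))⁻¹ * (z - v i)⁻¹ = 1 := by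
    intro z hz
    have := Lagrange.eval_interpolate_not_at_node (r := (1 : ι → ℝ)) hz
    rw [Lagrange.interpolate_one hv hs] at this
    simp only [eval_one, Pi.one_apply, mul_one] at this
    rw [this]
    congr 1
    refine sum_congr rfl fun i hi => ?_
    rw [Lagrange.nodalWeight_eq_eval_derivative_nodal hi]
  have hQx : Q.eval x ≠ 0 := Lagrange.eval_nodal_not_at_node hx
  have hev : ∀ᶠ z in nhds x, ∀ i ∈ s, z ≠ v i :=
    (Filter.eventually_all_finset s).2 fun i hi => isOpen_ne.mem_nhds (hx i hi)
  have hd0 : HasDerivAt (fun z => Q.eval z * ∑ i ∈ s, ((derivative Q).eval (v i))⁻¹ * (z - v i)⁻¹)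
      0 x :=
    (hasDerivAt_const x (1 : ℝ)).congr_of_eventuallyEq (hev.mono fun z hz => hpf z hz)
  have hd1 : HasDerivAt (fun z => ∑ i ∈ s, ((derivative Q).eval (v i))⁻¹ * (z - v i)⁻¹)
      (∑ i ∈ s, ((derivative Q).eval (v i))⁻¹ * (-1 / (x - v i) ^ 2)) x := by
    refine HasDerivAt.fun_sum fun i hi => ?_
    have := ((hasDerivAt_id x).sub_const (v i)).inv (sub_ne_zero.2 (hx i hi))
    exact this.const_mul _
  have h := hd0.unique ((Q.hasDerivAt x).mul hd1)
  have hsum : ∑ i ∈ s, ((derivative Q).eval (v i))⁻¹ * (-1 / (x - v i) ^ 2)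
      = -∑ i ∈ s, ((derivative Q).eval (v i))⁻¹ * ((x - v i) ^ 2)⁻¹ := by
    rw [← sum_neg_distrib]
    exact sum_congr rfl fun i _ => by ring
  have h1 := hpf x hx
  rw [hsum] at h
  set S := ∑ i ∈ s, ((derivative Q).eval (v i))⁻¹ * (x - v i)⁻¹
  set T := ∑ i ∈ s, ((derivative Q).eval (v i))⁻¹ * ((x - v i) ^ 2)⁻¹
  have hS : S = 1 / Q.eval x := by field_simp; linarith
  rw [hS] at h
  field_simp at h ⊢
  linarith

/-! ### Values of P' and P'' at the simple roots of a real-rooted polynomial -/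

section Nodal

variable {n : ℕ} (v : Fin n → ℝ)

lemma nodal_univ_eq (j : Fin n) :
    Lagrange.nodal univ v = (X - C (v j)) * Lagrange.nodal (univ.erase j) v :=
  Lagrange.nodal_eq_mul_nodal_erase (mem_univ j)

lemma eval_derivative_nodal_self (j : Fin n) :
    (derivative (Lagrange.nodal univ v)).eval (v j) = (Lagrange.nodal (univ.erase j) v).eval (v j) := by
  rw [nodal_univ_eq v j]; simp

lemma eval_derivative_nodal_of_ne {i j : Fin n} (h : i ≠ j) :
    (derivative (Lagrange.nodal univ v)).eval (v i)
      = (v i - v j) * (derivative (Lagrange.nodal (univ.erase j) v)).eval (v i) := by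
  rw [nodal_univ_eq v j]
  simp [Lagrange.eval_nodal_at_node (s := univ.erase j) (v := v) (i := i) (by simp [h])]

lemma eval_derivative_derivative_nodal (j : Fin n) :
    (derivative (derivative (Lagrange.nodal univ v))).eval (v j)
      = 2 * (derivative (Lagrange.nodal (univ.erase j) v)).eval (v j) := by
  rw [nodal_univ_eq v j]; simp; ring

lemma eval_derivative_nodal_ne_zero {v : Fin n → ℝ} (hv : Function.Injective v) (j : Fin n) :
    (derivative (Lagrange.nodal univ v)).eval (v j) ≠ 0 := by
  rw [eval_derivative_nodal_self]
  exact Lagrange.eval_nodal_not_at_node fun i hi h => (ne_of_mem_erase hi) (hv h).symm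

/-- If Q is the product over the roots other than v_j, then P'(v_i) = (v_i - v_j) Q'(v_i), P'(v_j) =
Q(v_j) and P''(v_j) = 2Q'(v_j), so this is `sum_inv_derivative_nodal` for Q at v_j. It sums the
connection coefficients to the components of X. -/
lemma sum_inv_derivative_mul_sub {v : Fin n → ℝ} (hv : Function.Injective v) (hn : 2 ≤ n)
    (j : Fin n) :
    ∑ i ∈ univ.erase j, ((derivative (Lagrange.nodal univ v)).eval (v i) * (v i - v j))⁻¹
      = (derivative (derivative (Lagrange.nodal univ v))).eval (v j)
        / (2 * (derivative (Lagrange.nodal univ v)).eval (v j) ^ 2) := by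
  have hne : (univ.erase j).Nonempty := by
    rw [← card_pos, card_erase_of_mem (mem_univ j)]; simp; omega
  have := sum_inv_derivative_nodal (univ.erase j) hne v hv.injOn (v j)
    (fun i hi h => (ne_of_mem_erase hi) (hv h).symm)
  rw [eval_derivative_derivative_nodal, eval_derivative_nodal_self, mul_div_mul_left _ _ two_ne_zero,
    ← this]
  refine sum_congr rfl fun i hi => ?_
  rw [eval_derivative_nodal_of_ne v (ne_of_mem_erase hi), ← mul_inv]
  congr 1; ring

/-- One summand on the right already dominates: apply `exists_abs_sum_mul_prod_le` to y_i = 1/(v_i -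
v_j), whose sum is -Q'/Q at v_j. A second index different from j exists since n ≥ 3, and its
positive summand makes the inequality strict. This fixes the sign of the quadratic terms in the
scalar curvature. -/
lemma sq_lt_sum_inv_derivative {v : Fin n → ℝ} (hv : Function.Injective v) (hn : 3 ≤ n)
    (j : Fin n) :
    ((derivative (derivative (Lagrange.nodal univ v))).eval (v j)
        / (2 * (derivative (Lagrange.nodal univ v)).eval (v j) ^ 2)) ^ 2
      < ∑ i ∈ univ.erase j,
        (((derivative (Lagrange.nodal univ v)).eval (v i) * (v i - v j))⁻¹) ^ 2 := by
  set s := univ.erase j with hs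
  have hcard : s.card = n - 1 := by rw [hs, card_erase_of_mem (mem_univ j)]; simp
  have hne : s.Nonempty := by rw [← card_pos]; omega
  have hjs : ∀ i ∈ s, v j ≠ v i := fun i hi h => (ne_of_mem_erase hi) (hv h).symm
  obtain ⟨i, hi, hle⟩ := exists_abs_sum_mul_prod_le s hne fun i => (v i - v j)⁻¹
  have hQj : (Lagrange.nodal s v).eval (v j) ≠ 0 := Lagrange.eval_nodal_not_at_node hjs
  have hlog : (derivative (Lagrange.nodal s v)).eval (v j)
      = -(Lagrange.nodal s v).eval (v j) * ∑ i ∈ s, (v i - v j)⁻¹ := by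
    rw [Lagrange.derivative_nodal, eval_finsetSum, mul_sum]
    refine sum_congr rfl fun k hk => ?_
    rw [Lagrange.nodal_eq_mul_nodal_erase hk]
    have : v k - v j ≠ 0 := sub_ne_zero.2 (hjs k hk).symm
    simp
    field_simp
    ring
  -- Here 1 - y_k/y_i = (v_k - v_i)/(v_k - v_j), so the product turns the factors of Q(v_j) into
  -- those of P'(v_i).
  have hratio : |(derivative (Lagrange.nodal univ v)).eval (v i)|
      = |(Lagrange.nodal s v).eval (v j)| * ∏ k ∈ s.erase i, |1 - (v k - v j)⁻¹ / (v i - v j)⁻¹| := by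
    rw [eval_derivative_nodal_of_ne v (ne_of_mem_erase hi), ← hs,
      Lagrange.eval_nodal_derivative_eval_node_eq hi, Lagrange.eval_nodal, Lagrange.eval_nodal,
      ← mul_prod_erase s _ hi, abs_mul, abs_mul, mul_assoc, abs_prod, abs_prod, ← prod_mul_distrib,
      abs_sub_comm (v i)]
    congr 1
    refine prod_congr rfl fun k hk => ?_
    have h1 : v k - v j ≠ 0 := sub_ne_zero.2 (hjs k (mem_of_mem_erase hk)).symm
    have h2 : v i - v j ≠ 0 := sub_ne_zero.2 (hjs i hi).symm
    rw [← abs_mul]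
    congr 1
    field_simp
    ring
  have hPi := eval_derivative_nodal_ne_zero hv i
  have hij : v i - v j ≠ 0 := sub_ne_zero.2 (hjs i hi).symm
  have h1 : ((derivative (derivative (Lagrange.nodal univ v))).eval (v j)
        / (2 * (derivative (Lagrange.nodal univ v)).eval (v j) ^ 2)) ^ 2 ≤
      (((derivative (Lagrange.nodal univ v)).eval (v i) * (v i - v j))⁻¹) ^ 2 := by
    rw [sq_le_sq, eval_derivative_derivative_nodal, eval_derivative_nodal_self,
      mul_div_mul_left _ _ two_ne_zero, ← hs, hlog, abs_div, abs_mul, abs_neg, abs_pow, abs_inv,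
      abs_mul, hratio]
    have hQ' : 0 < |(Lagrange.nodal s v).eval (v j)| := abs_pos.2 hQj
    have hp : 0 < ∏ k ∈ s.erase i, |1 - (v k - v j)⁻¹ / (v i - v j)⁻¹| := by
      have := abs_pos.2 hPi
      rw [hratio] at this
      exact pos_of_mul_pos_right this hQ'.le
    have hd : 0 < |v i - v j| := abs_pos.2 hij
    rw [abs_inv] at hle
    have := mul_le_mul_of_nonneg_right hle hd.le
    rw [inv_mul_cancel₀ hd.ne'] at this
    rw [← one_div, div_le_div_iff₀ (by positivity) (by positivity)]
    nlinarith [mul_le_mul_of_nonneg_left this (sq_nonneg |(Lagrange.nodal s v).eval (v j)|)]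
  refine h1.trans_lt ?_
  obtain ⟨k, hk, hki⟩ : ∃ k ∈ s, k ≠ i := by
    have := s.exists_mem_ne (by omega) i
    simpa using this
  refine single_lt_sum (f := fun i =>
    (((derivative (Lagrange.nodal univ v)).eval (v i) * (v i - v j))⁻¹) ^ 2) hki hi hk ?_
    fun l _ _ => sq_nonneg _
  have := eval_derivative_nodal_ne_zero hv k
  have : v k - v j ≠ 0 := sub_ne_zero.2 (hjs k hk).symm
  positivity

end Nodal

/-- Induction on the roots: for f = (t - a) g one has f'² - f f'' = g² + (t - a)² (g'² - g g''). -/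
lemma laguerre_nonneg (s : Multiset ℝ) (t : ℝ) :
    0 ≤ (derivative (s.map fun a => X - C a).prod).eval t ^ 2
      - (s.map fun a => X - C a).prod.eval t
        * (derivative (derivative (s.map fun a => X - C a).prod)).eval t := by
  induction s using Multiset.induction_on with
  | empty => simp
  | cons a s ih =>
    simp only [Multiset.map_cons, Multiset.prod_cons, derivative_mul, derivative_sub, derivative_X,
      derivative_C, sub_zero, one_mul, derivative_add, eval_add, eval_mul, eval_sub, eval_X, eval_C]
    nlinarith [mul_nonneg (sq_nonneg (t - a)) ih,
      sq_nonneg ((s.map fun a => X - C a).prod.eval t)]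

/-- The Laguerre inequality for real-rooted polynomials. -/
lemma laguerre_pos (s : Multiset ℝ) (hs : s ≠ 0) (t : ℝ)
    (ht : (s.map fun a => X - C a).prod.eval t ≠ 0) :
    0 < (derivative (s.map fun a => X - C a).prod).eval t ^ 2
      - (s.map fun a => X - C a).prod.eval t
        * (derivative (derivative (s.map fun a => X - C a).prod)).eval t := by
  obtain ⟨a, ha⟩ := Multiset.exists_mem_of_ne_zero hs
  obtain ⟨s, rfl⟩ := Multiset.exists_cons_of_mem ha
  have ih := laguerre_nonneg s t
  simp only [Multiset.map_cons, Multiset.prod_cons, derivative_mul, derivative_sub, derivative_X,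
      derivative_C, sub_zero, one_mul, derivative_add, eval_add, eval_mul, eval_sub, eval_X, eval_C]
      at ht ⊢
  have h2 := right_ne_zero_of_mul ht
  -- The summand g² contributed by the split factor is positive, as t is not a root.
  have : 0 < (s.map fun a => X - C a).prod.eval t ^ 2 := by positivity
  nlinarith [mul_nonneg (sq_nonneg (t - a)) ih]

/-- Newton's identity expresses k e_k through the e_i with i < k and the power sums of orders 1 to
k. -/
lemma esymm_eq_of_power_sums_eq {n : ℕ} (x y : Fin n → ℝ) (m : ℕ)
    (h : ∀ k, 1 ≤ k → k ≤ m → ∑ i, x i ^ k = ∑ i, y i ^ k) (k : ℕ) (hk : k ≤ m) :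
    MvPolynomial.aeval x (MvPolynomial.esymm (Fin n) ℝ k)
      = MvPolynomial.aeval y (MvPolynomial.esymm (Fin n) ℝ k) := by
  induction k using Nat.strong_induction_on with
  | _ k ih =>
  rcases Nat.eq_zero_or_pos k with rfl | hk0
  · simp
  have hx := congrArg (MvPolynomial.aeval x) (MvPolynomial.mul_esymm_eq_sum (Fin n) ℝ k)
  have hy := congrArg (MvPolynomial.aeval y) (MvPolynomial.mul_esymm_eq_sum (Fin n) ℝ k)
  simp only [map_mul, map_natCast, map_sum, map_pow, map_neg, map_one] at hx hy
  have hsum : ∀ a ∈ (antidiagonal k).filter (fun a => a.1 < k),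
      (-1 : ℝ) ^ a.1 * MvPolynomial.aeval x (MvPolynomial.esymm (Fin n) ℝ a.1)
        * MvPolynomial.aeval x (MvPolynomial.psum (Fin n) ℝ a.2)
      = (-1 : ℝ) ^ a.1 * MvPolynomial.aeval y (MvPolynomial.esymm (Fin n) ℝ a.1)
        * MvPolynomial.aeval y (MvPolynomial.psum (Fin n) ℝ a.2) := by
    intro a ha
    simp only [mem_filter, HasAntidiagonal.mem_antidiagonal] at ha
    rw [ih a.1 ha.2 (by omega)]
    congr 1
    simp only [MvPolynomial.psum, map_sum, map_pow, MvPolynomial.aeval_X]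
    exact h a.2 (by omega) (by omega)
  rw [sum_congr rfl hsum, ← hy] at hx
  exact mul_left_cancel₀ (by positivity : (k : ℝ) ≠ 0) hx

/-- Newton's identities: the power sums of order less than `n` determine `∏ (X - x_i)` up to its
constant coefficient. -/
lemma exists_prod_eq_add_C {n : ℕ} (s t : Multiset ℝ) (hs : Multiset.card s = n)
    (ht : Multiset.card t = n)
    (h : ∀ k, 1 ≤ k → k ≤ n - 1 → (s.map (· ^ k)).sum = (t.map (· ^ k)).sum) :
    ∃ c : ℝ, (s.map fun a => X - C a).prod = (t.map fun a => X - C a).prod + C c := by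
  have key : ∀ s : Multiset ℝ, Multiset.card s = n → ∃ x : Fin n → ℝ, s = univ.val.map x := by
    rintro s rfl
    obtain ⟨l, rfl⟩ := Quot.exists_rep s
    refine ⟨l.get, ?_⟩
    change (l : Multiset ℝ) = Multiset.map l.get (univ : Finset (Fin l.length)).val
    rw [Fin.univ_val_map, List.ofFn_get]
  obtain ⟨x, rfl⟩ := key s hs
  obtain ⟨y, rfl⟩ := key t ht
  have he : ∀ k ≤ n - 1, (univ.val.map x).esymm k = (univ.val.map y).esymm k := by
    intro k hk
    have := esymm_eq_of_power_sums_eq x y (n - 1) (fun k h1 h2 => by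
      have := h k h1 h2
      rwa [Multiset.map_map, Multiset.map_map] at this) k hk
    rwa [MvPolynomial.aeval_esymm_eq_multiset_esymm, MvPolynomial.aeval_esymm_eq_multiset_esymm]
      at this
  rw [Multiset.prod_X_sub_X_eq_sum_esymm, Multiset.prod_X_sub_X_eq_sum_esymm, hs, ht,
    sum_range_succ, sum_range_succ]
  -- In the Vieta expansion the last term, with index n, is the constant coefficient, the only one
  -- not determined.
  refine ⟨(-1) ^ n * ((univ.val.map x).esymm n - (univ.val.map y).esymm n), ?_⟩
  rw [sum_congr rfl fun k hk => by rw [he k (by have := mem_range.1 hk; omega)]]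
  simp
  ring

end SphereHypersurface

end

noncomputable section

open Finset

namespace SphereHypersurface

/-! ### Local hypersurfaces of the unit sphere -/

/-- The coordinate space of an `n`-dimensional hypersurface. -/
abbrev Dom (n : ℕ) : Type := EuclideanSpace ℝ (Fin n)

/-- The Euclidean space containing the unit sphere `S^{n+1}`. -/
abbrev Amb (n : ℕ) : Type := EuclideanSpace ℝ (Fin (n + 1 + 1))

variable {n : ℕ}

/-- A hypersurface of the unit sphere parametrized by an open subset `U` of `ℝⁿ`, with a unit
normal field `N`. -/
structure IsLocalHypersurface (U : Set (Dom n)) (F N : Dom n → Amb n) : Prop where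
  isOpen : IsOpen U
  contDiffOn : ContDiffOn ℝ ∞ F U
  contDiffOn_normal : ContDiffOn ℝ ∞ N U
  norm_eq_one : ∀ x ∈ U, ‖F x‖ = 1
  norm_normal : ∀ x ∈ U, ‖N x‖ = 1
  inner_normal : ∀ x ∈ U, ⟪N x, F x⟫_ℝ = 0
  inner_normal_fderiv : ∀ x ∈ U, ∀ v, ⟪N x, fderiv ℝ F x v⟫_ℝ = 0
  injective_fderiv : ∀ x ∈ U, Function.Injective (fderiv ℝ F x)

lemma contDiffOn_fderiv_apply {W : Type*} [NormedAddCommGroup W] [NormedSpace ℝ W]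
    {U : Set (Dom n)} (hU : IsOpen U) {H : Dom n → W} (hH : ContDiffOn ℝ ∞ H U)
    {a : Dom n → Dom n} (ha : ContDiffOn ℝ ∞ a U) :
    ContDiffOn ℝ ∞ (fun y => fderiv ℝ H y (a y)) U :=
  (hH.fderiv_of_isOpen hU (by simp)).clm_apply ha

lemma differentiableAt_of_contDiffOn {W : Type*} [NormedAddCommGroup W] [NormedSpace ℝ W]
    {U : Set (Dom n)} (hU : IsOpen U) {H : Dom n → W} (hH : ContDiffOn ℝ ∞ H U) {x : Dom n}
    (hx : x ∈ U) : DifferentiableAt ℝ H x :=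
  (hH.contDiffAt (hU.mem_nhds hx)).differentiableAt (by simp)

/-- If `⟪a, b⟫` is constant on an open set, its derivative vanishes. -/
lemma inner_fderiv_add_eq_zero {W : Type*} [NormedAddCommGroup W] [InnerProductSpace ℝ W]
    {U : Set (Dom n)} (hU : IsOpen U) {a b : Dom n → W} (ha : ContDiffOn ℝ ∞ a U)
    (hb : ContDiffOn ℝ ∞ b U) {c : ℝ} (hc : ∀ y ∈ U, ⟪a y, b y⟫_ℝ = c) {x : Dom n} (hx : x ∈ U)
    (v : Dom n) : ⟪a x, fderiv ℝ b x v⟫_ℝ + ⟪fderiv ℝ a x v, b x⟫_ℝ = 0 := by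
  rw [← fderiv_inner_apply ℝ (differentiableAt_of_contDiffOn hU ha hx)
    (differentiableAt_of_contDiffOn hU hb hx)]
  have : (fun t => ⟪a t, b t⟫_ℝ) =ᶠ[nhds x] fun _ => c :=
    Filter.eventually_of_mem (hU.mem_nhds hx) hc
  rw [this.fderiv_eq]
  simp

/-- Parseval's identity for an orthonormal basis of `ℝ^{n+2}` written as `E_1, …, E_n, N, F`. -/
lemma inner_eq_sum_of_orthonormal {E : Fin n → Amb n} {N F : Amb n}
    (hE : ∀ i j, ⟪E i, E j⟫_ℝ = if i = j then 1 else 0) (hEN : ∀ i, ⟪E i, N⟫_ℝ = 0)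
    (hEF : ∀ i, ⟪E i, F⟫_ℝ = 0) (hN : ‖N‖ = 1) (hF : ‖F‖ = 1) (hNF : ⟪N, F⟫_ℝ = 0) (a b : Amb n) :
    ⟪a, b⟫_ℝ = ∑ k, ⟪a, E k⟫_ℝ * ⟪b, E k⟫_ℝ + ⟪a, N⟫_ℝ * ⟪b, N⟫_ℝ + ⟪a, F⟫_ℝ * ⟪b, F⟫_ℝ := by
  let w : Fin n ⊕ Fin 2 → Amb n := Sum.elim E ![N, F]
  have hw : Orthonormal ℝ w := by
    rw [orthonormal_iff_ite]
    rintro (i | i) (j | j)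
    · simp [w, hE]
    · fin_cases j <;> simp [w, hEN, hEF]
    · rw [real_inner_comm]
      fin_cases i <;> simp [w, hEN, hEF]
    · fin_cases i <;> fin_cases j <;>
        simp [w, hNF, hN, hF, real_inner_comm N F]
  let B := basisOfOrthonormalOfCardEqFinrank hw (by simp)
  have hB : Orthonormal ℝ B := by
    simpa [B, coe_basisOfOrthonormalOfCardEqFinrank] using hw
  have := (B.toOrthonormalBasis hB).sum_inner_mul_inner a b
  simp only [Module.Basis.coe_toOrthonormalBasis, B, coe_basisOfOrthonormalOfCardEqFinrank] at this
  rw [← this, Fintype.sum_sum_type, Fin.sum_univ_two]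
  simp [w, real_inner_comm]
  ring

namespace IsLocalHypersurface

variable {U : Set (Dom n)} {F N : Dom n → Amb n} (h : IsLocalHypersurface U F N)
include h

lemma inner_fderiv_pos {x : Dom n} (hx : x ∈ U) (v : Dom n) : ⟪F x, fderiv ℝ F x v⟫_ℝ = 0 := by
  have := inner_fderiv_add_eq_zero h.isOpen h.contDiffOn h.contDiffOn (c := 1)
    (fun y hy => by simp [h.norm_eq_one y hy]) hx v
  rw [real_inner_comm (F x)] at this
  linarith

lemma inner_normal_fderiv_normal {x : Dom n} (hx : x ∈ U) (v : Dom n) :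
    ⟪N x, fderiv ℝ N x v⟫_ℝ = 0 := by
  have := inner_fderiv_add_eq_zero h.isOpen h.contDiffOn_normal h.contDiffOn_normal (c := 1)
    (fun y hy => by simp [h.norm_normal y hy]) hx v
  rw [real_inner_comm (N x)] at this
  linarith

lemma inner_pos_fderiv_normal {x : Dom n} (hx : x ∈ U) (v : Dom n) :
    ⟪F x, fderiv ℝ N x v⟫_ℝ = 0 := by
  have := inner_fderiv_add_eq_zero h.isOpen h.contDiffOn_normal h.contDiffOn h.inner_normal hx v
  rw [h.inner_normal_fderiv x hx, real_inner_comm] at this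
  linarith

end IsLocalHypersurface

/-- A smooth orthonormal frame of principal directions `e_i` with principal curvatures `lam_i`. -/
structure IsPrincipalFrame (U : Set (Dom n)) (F N : Dom n → Amb n) (e : Fin n → Dom n → Dom n)
    (lam : Fin n → Dom n → ℝ) : Prop extends IsLocalHypersurface U F N where
  contDiffOn_frame : ∀ i, ContDiffOn ℝ ∞ (e i) U
  contDiffOn_curvature : ∀ i, ContDiffOn ℝ ∞ (lam i) U
  inner_frame : ∀ x ∈ U, ∀ i j,
    ⟪fderiv ℝ F x (e i x), fderiv ℝ F x (e j x)⟫_ℝ = if i = j then 1 else 0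
  fderiv_normal : ∀ x ∈ U, ∀ i, fderiv ℝ N x (e i x) = -(lam i x • fderiv ℝ F x (e i x))

/-- The frame `df(e_i)` as vectors in the ambient space. -/
def frameVec (F : Dom n → Amb n) (e : Fin n → Dom n → Dom n) (i : Fin n) (x : Dom n) : Amb n :=
  fderiv ℝ F x (e i x)

/-- The connection coefficients `⟨∇_{e_k} e_i, e_j⟩`. -/
def conn (F : Dom n → Amb n) (e : Fin n → Dom n → Dom n) (k i j : Fin n) (x : Dom n) : ℝ :=
  ⟪fderiv ℝ (frameVec F e i) x (e k x), frameVec F e j x⟫_ℝ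

/-- The components `∑_i ⟨∇_{e_i} e_i, e_k⟩`. -/
def accel (F : Dom n → Amb n) (e : Fin n → Dom n → Dom n) (k : Fin n) (x : Dom n) : ℝ :=
  ∑ i, conn F e i i k x

namespace IsPrincipalFrame

variable {U : Set (Dom n)} {F N : Dom n → Amb n} {e : Fin n → Dom n → Dom n}
  {lam : Fin n → Dom n → ℝ} (h : IsPrincipalFrame U F N e lam)
include h

lemma contDiffOn_frameVec (i : Fin n) : ContDiffOn ℝ ∞ (frameVec F e i) U :=
  contDiffOn_fderiv_apply h.isOpen h.contDiffOn (h.contDiffOn_frame i)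

lemma contDiffOn_fderiv_frameVec (k i : Fin n) :
    ContDiffOn ℝ ∞ (fun y => fderiv ℝ (frameVec F e i) y (e k y)) U :=
  contDiffOn_fderiv_apply h.isOpen (h.contDiffOn_frameVec i) (h.contDiffOn_frame k)

lemma contDiffOn_conn (k i j : Fin n) : ContDiffOn ℝ ∞ (conn F e k i j) U :=
  (h.contDiffOn_fderiv_frameVec k i).inner ℝ (h.contDiffOn_frameVec j)

lemma contDiffOn_accel (k : Fin n) : ContDiffOn ℝ ∞ (accel F e k) U :=
  ContDiffOn.sum fun i _ => h.contDiffOn_conn i i k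

variable {x : Dom n} (hx : x ∈ U)
include hx

lemma inner_frameVec (i j : Fin n) : ⟪frameVec F e i x, frameVec F e j x⟫_ℝ = if i = j then 1 else 0 :=
  h.inner_frame x hx i j

lemma parseval (a b : Amb n) :
    ⟪a, b⟫_ℝ = ∑ k, ⟪a, frameVec F e k x⟫_ℝ * ⟪b, frameVec F e k x⟫_ℝ + ⟪a, N x⟫_ℝ * ⟪b, N x⟫_ℝ
      + ⟪a, F x⟫_ℝ * ⟪b, F x⟫_ℝ :=
  inner_eq_sum_of_orthonormal (h.inner_frameVec hx)
    (fun i => by rw [real_inner_comm]; exact h.inner_normal_fderiv x hx _)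
    (fun i => by rw [real_inner_comm]; exact h.inner_fderiv_pos hx _)
    (h.norm_normal x hx) (h.norm_eq_one x hx) (h.inner_normal x hx) a b

lemma conn_antisymm (k i j : Fin n) : conn F e k i j x = -conn F e k j i x := by
  have := inner_fderiv_add_eq_zero h.isOpen (h.contDiffOn_frameVec i) (h.contDiffOn_frameVec j)
    (fun y hy => h.inner_frameVec hy i j) hx (e k x)
  rw [real_inner_comm] at this
  unfold conn
  linarith

lemma inner_fderiv_frameVec_normal (k i : Fin n) :
    ⟪fderiv ℝ (frameVec F e i) x (e k x), N x⟫_ℝ = if k = i then lam i x else 0 := by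
  have := inner_fderiv_add_eq_zero h.isOpen (h.contDiffOn_frameVec i) h.contDiffOn_normal (c := 0)
    (fun y hy => by rw [real_inner_comm]; exact h.inner_normal_fderiv y hy _) hx (e k x)
  rw [h.fderiv_normal x hx, inner_neg_right, inner_smul_right,
    show ⟪frameVec F e i x, fderiv ℝ F x (e k x)⟫_ℝ = _ from h.inner_frameVec hx i k] at this
  rcases eq_or_ne k i with rfl | hki
  · simp at this ⊢; linarith
  · simp [hki, hki.symm] at this ⊢; linarith

lemma inner_fderiv_frameVec_pos (k i : Fin n) :
    ⟪fderiv ℝ (frameVec F e i) x (e k x), F x⟫_ℝ = if k = i then -1 else 0 := by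
  have := inner_fderiv_add_eq_zero h.isOpen (h.contDiffOn_frameVec i) h.contDiffOn (c := 0)
    (fun y hy => by rw [real_inner_comm]; exact h.inner_fderiv_pos hy _) hx (e k x)
  rw [show ⟪frameVec F e i x, fderiv ℝ F x (e k x)⟫_ℝ = _ from h.inner_frameVec hx i k] at this
  rcases eq_or_ne k i with rfl | hki
  · simp at this ⊢; linarith
  · simp [hki, hki.symm] at this ⊢; linarith

/-- Parseval splits the product into tangential, normal and radial parts. The normal part gives the
product of the curvatures; the radial part is (-1)(-1) = 1, the curvature of the ambient unit
sphere. -/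
lemma inner_fderiv_frameVec (k i l j : Fin n) :
    ⟪fderiv ℝ (frameVec F e i) x (e k x), fderiv ℝ (frameVec F e j) x (e l x)⟫_ℝ
      = ∑ m, conn F e k i m x * conn F e l j m x
        + if k = i ∧ l = j then lam i x * lam j x + 1 else 0 := by
  rw [h.parseval hx, h.inner_fderiv_frameVec_normal hx, h.inner_fderiv_frameVec_normal hx,
    h.inner_fderiv_frameVec_pos hx, h.inner_fderiv_frameVec_pos hx, add_assoc]
  congr 1
  by_cases h1 : k = i <;> by_cases h2 : l = j <;> simp [h1, h2]

/-- Symmetry of second derivatives in the frame. Applied to F it computes the bracket, to N it gives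
Codazzi, and to the frame vectors it gives Gauss. -/
lemma fderiv_lieBracket {W : Type*} [NormedAddCommGroup W] [NormedSpace ℝ W] {H : Dom n → W}
    (hH : ContDiffOn ℝ ∞ H U) (i j : Fin n) :
    fderiv ℝ H x (VectorField.lieBracket ℝ (e i) (e j) x)
      = fderiv ℝ (fun y => fderiv ℝ H y (e j y)) x (e i x)
        - fderiv ℝ (fun y => fderiv ℝ H y (e i y)) x (e j x) :=
  VectorField.fderiv_apply_lieBracket (n := ∞) (hH.contDiffAt (h.isOpen.mem_nhds hx))
    (by rw [minSmoothness_of_isRCLikeNormedField]; exact ENat.LEInfty.out)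
    (differentiableAt_of_contDiffOn h.isOpen (h.contDiffOn_frame j) hx)
    (differentiableAt_of_contDiffOn h.isOpen (h.contDiffOn_frame i) hx)

lemma eq_sum_inner_frameVec (v : Dom n) :
    v = ∑ k, ⟪fderiv ℝ F x v, frameVec F e k x⟫_ℝ • e k x := by
  apply h.injective_fderiv x hx
  refine ext_inner_right ℝ fun b => ?_
  rw [h.parseval hx, real_inner_comm (N x), h.inner_normal_fderiv x hx, real_inner_comm (F x),
    h.inner_fderiv_pos hx, map_sum, sum_inner]
  simp only [map_smul, inner_smul_left, frameVec, zero_mul, add_zero]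
  exact sum_congr rfl fun k _ => by simp [real_inner_comm b]

lemma lieBracket_eq (i j : Fin n) :
    VectorField.lieBracket ℝ (e i) (e j) x
      = ∑ k, (conn F e i j k x - conn F e j i k x) • e k x := by
  rw [h.eq_sum_inner_frameVec hx (VectorField.lieBracket ℝ (e i) (e j) x),
    h.fderiv_lieBracket hx h.contDiffOn i j]
  simp only [inner_sub_left]
  rfl

/-- The Codazzi equation. -/
lemma codazzi (i j k : Fin n) :
    -(fderiv ℝ (lam j) x (e i x) * if j = k then 1 else 0) - lam j x * conn F e i j k x
      + (fderiv ℝ (lam i) x (e j x) * if i = k then 1 else 0) + lam i x * conn F e j i k x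
      = -((conn F e i j k x - conn F e j i k x) * lam k x) := by
  have hD : ∀ i j : Fin n, fderiv ℝ (fun y => fderiv ℝ N y (e j y)) x (e i x)
      = -(lam j x • fderiv ℝ (frameVec F e j) x (e i x)
        + fderiv ℝ (lam j) x (e i x) • frameVec F e j x) := by
    intro i j
    have : (fun y => fderiv ℝ N y (e j y)) =ᶠ[nhds x] fun y => -(lam j y • frameVec F e j y) :=
      Filter.eventually_of_mem (h.isOpen.mem_nhds hx) fun y hy => h.fderiv_normal y hy j
    rw [this.fderiv_eq, fderiv_fun_neg, fderiv_fun_smul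
      (differentiableAt_of_contDiffOn h.isOpen (h.contDiffOn_curvature j) hx)
      (differentiableAt_of_contDiffOn h.isOpen (h.contDiffOn_frameVec j) hx)]
    simp
  -- The commutator identity for N, paired below with the k-th frame vector.
  have hb := h.fderiv_lieBracket hx h.contDiffOn_normal i j
  rw [h.lieBracket_eq hx, hD, hD, map_sum] at hb
  have := congrArg (fun w => ⟪w, frameVec F e k x⟫_ℝ) hb
  simp only [map_smul, h.fderiv_normal x hx, inner_sub_left, inner_neg_left, inner_add_left,
    inner_smul_left, sum_inner, RCLike.conj_to_real] at this
  simp only [show ∀ m, ⟪fderiv ℝ F x (e m x), frameVec F e k x⟫_ℝ = if m = k then 1 else 0 from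
    fun m => h.inner_frameVec hx m k, h.inner_frameVec hx] at this
  simp only [mul_neg, mul_ite, mul_one, mul_zero, sum_neg_distrib, sum_ite_eq', mem_univ,
    if_true] at this
  change _ = -(lam j x * conn F e i j k x + _) - -(lam i x * conn F e j i k x + _) at this
  simp only [mul_ite, mul_one, mul_zero]
  linarith

lemma fderiv_curvature {i j : Fin n} (hij : i ≠ j) :
    fderiv ℝ (lam i) x (e j x) = (lam i x - lam j x) * conn F e i i j x := by
  have := h.codazzi hx i j i
  rw [h.conn_antisymm hx j i i, h.conn_antisymm hx i j i] at this
  simp only [hij.symm, if_false, if_true] at this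
  have h0 : conn F e j i i x = 0 := by linarith [h.conn_antisymm hx j i i]
  rw [h0] at this
  linarith

/-- Together with `conn_antisymm` this makes (lam j - lam k) · conn i j k symmetric in three
distinct indices. -/
lemma codazzi_of_ne {i j k : Fin n} (hik : i ≠ k) (hjk : j ≠ k) :
    (lam k x - lam j x) * conn F e i j k x = (lam k x - lam i x) * conn F e j i k x := by
  have := h.codazzi hx i j k
  simp only [hik, hjk, if_false] at this
  linarith

/-- The Gauss equation for the sectional curvature of the plane spanned by `e_i` and `e_j`. -/
lemma gauss (i j : Fin n) :
    fderiv ℝ (conn F e j j i) x (e i x) + fderiv ℝ (conn F e i i j) x (e j x)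
      - ∑ k, conn F e j j k x * conn F e i i k x + ∑ k, conn F e i j k x * conn F e j i k x
      - ∑ k, (conn F e i j k x - conn F e j i k x) * conn F e k j i x
      = if i = j then 0 else 1 + lam i x * lam j x := by
  -- The commutator identity for the j-th frame vector: its left side gives the bracket term, and
  -- `inner_fderiv_frameVec` produces 1 + lam i · lam j from the right side.
  have hb := h.fderiv_lieBracket hx (h.contDiffOn_frameVec j) i j
  rw [h.lieBracket_eq hx, map_sum] at hb
  have hb' := congrArg (fun w => ⟪w, frameVec F e i x⟫_ℝ) hb
  simp only [map_smul, inner_sub_left, inner_smul_left, sum_inner, RCLike.conj_to_real] at hb'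
  change ∑ k, (conn F e i j k x - conn F e j i k x) * conn F e k j i x = _ at hb'
  have hd : ∀ k l i j : Fin n, fderiv ℝ (conn F e k j i) x (e l x)
      = ⟪fderiv ℝ (frameVec F e j) x (e k x), fderiv ℝ (frameVec F e i) x (e l x)⟫_ℝ
      + ⟪fderiv ℝ (fun y => fderiv ℝ (frameVec F e j) y (e k y)) x (e l x), frameVec F e i x⟫_ℝ := by
    intro k l i j
    exact fderiv_inner_apply ℝ
      (differentiableAt_of_contDiffOn h.isOpen (h.contDiffOn_fderiv_frameVec k j) hx)
      (differentiableAt_of_contDiffOn h.isOpen (h.contDiffOn_frameVec i) hx) _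
  have h1 := hd j i i j
  have h2 := hd i j i j
  rw [h.inner_fderiv_frameVec hx] at h1 h2
  have h3 : fderiv ℝ (conn F e i i j) x (e j x) = -fderiv ℝ (conn F e i j i) x (e j x) := by
    have : conn F e i i j =ᶠ[nhds x] fun y => -conn F e i j i y :=
      Filter.eventually_of_mem (h.isOpen.mem_nhds hx) fun y hy => h.conn_antisymm hy i i j
    rw [this.fderiv_eq, fderiv_fun_neg]
    rfl
  rw [hb', h3, h1, h2]
  rcases eq_or_ne i j with rfl | hij
  · simp
    ring
  · simp [hij, hij.symm]
    ring

/-- The scalar curvature in terms of the frame. -/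
lemma two_mul_sum_fderiv_accel :
    2 * ∑ i, fderiv ℝ (accel F e i) x (e i x) - ∑ k, accel F e k x ^ 2
      - ∑ i, ∑ j, ∑ k, conn F e i j k x * conn F e k j i x
      = ∑ i, ∑ j, if i = j then 0 else 1 + lam i x * lam j x := by
  have hs := sum_congr rfl fun i (_ : i ∈ univ) => sum_congr rfl fun j (_ : j ∈ univ) =>
    h.gauss hx i j
  rw [← hs]
  simp only [sum_add_distrib, sum_sub_distrib]
  have hv : ∀ i, fderiv ℝ (accel F e i) x (e i x) = ∑ j, fderiv ℝ (conn F e j j i) x (e i x) := by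
    intro i
    have : accel F e i = fun y => ∑ j, conn F e j j i y := rfl
    rw [this, fderiv_fun_sum fun j _ =>
      differentiableAt_of_contDiffOn h.isOpen (h.contDiffOn_conn j j i) hx]
    simp
  have h2 : ∑ i, ∑ j, fderiv ℝ (conn F e i i j) x (e j x) = ∑ i, fderiv ℝ (accel F e i) x (e i x) := by
    rw [sum_comm]
    exact sum_congr rfl fun i _ => (hv i).symm
  have h1 : ∑ i, ∑ j, fderiv ℝ (conn F e j j i) x (e i x) = ∑ i, fderiv ℝ (accel F e i) x (e i x) :=
    sum_congr rfl fun i _ => (hv i).symm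
  have h3 : ∑ i, ∑ j, ∑ k, conn F e j j k x * conn F e i i k x = ∑ k, accel F e k x ^ 2 := by
    simp only [accel, sq, sum_mul_sum]
    rw [sum_comm' (t' := univ) (s' := fun _ => univ) (by simp)]
    rw [sum_congr rfl fun i _ => sum_comm, sum_comm]
  -- The remaining two sums are relabelled to the same sum Σ, using antisymmetry: this one is Σ and
  -- the bracket term is 2Σ, so -Σ remains.
  have h4 : ∑ i, ∑ j, ∑ k, conn F e i j k x * conn F e j i k x
      = ∑ i, ∑ j, ∑ k, conn F e i j k x * conn F e k j i x := by
    refine sum_congr rfl fun i _ => ?_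
    rw [sum_comm]
    refine sum_congr rfl fun j _ => sum_congr rfl fun k _ => ?_
    rw [h.conn_antisymm hx i k j, h.conn_antisymm hx k i j]
    ring
  have h5 : ∑ i, ∑ j, ∑ k, (conn F e i j k x - conn F e j i k x) * conn F e k j i x
      = 2 * ∑ i, ∑ j, ∑ k, conn F e i j k x * conn F e k j i x := by
    simp only [sub_mul, sum_sub_distrib]
    have : ∑ i, ∑ j, ∑ k, conn F e j i k x * conn F e k j i x
        = - ∑ i, ∑ j, ∑ k, conn F e i j k x * conn F e k j i x := by
      rw [sum_comm]
      simp only [← sum_neg_distrib]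
      refine sum_congr rfl fun i _ => sum_congr rfl fun j _ => sum_congr rfl fun k _ => ?_
      rw [h.conn_antisymm hx k i j]
      ring
    rw [this]
    ring
  rw [h1, h2, h3, h4, h5]
  ring

/-- For distinct i, j, k let T be the symmetric quantity (lam j - lam k) · conn i j k. The summand
is T² / ((lam j - lam k)(lam j - lam i)), whose cyclic sum is zero. Terms with j = i or j = k vanish
by antisymmetry, and those with i = k give the squares. -/
lemma sum_conn_mul_conn (hlam : Function.Injective fun i => lam i x) :
    ∑ i, ∑ j, ∑ k, conn F e i j k x * conn F e k j i x = ∑ i, ∑ j, conn F e i i j x ^ 2 := by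
  let b : Fin n → Fin n → Fin n → ℝ := fun i j k =>
    if i = k then 0 else conn F e i j k x * conn F e k j i x
  have hdiag : ∀ k i, conn F e k i i x = 0 := fun k i => by linarith [h.conn_antisymm hx k i i]
  have hcyc : ∀ i j k, b i j k + b j k i + b k i j = 0 := by
    intro i j k
    simp only [b]
    by_cases hij : i = j
    · subst hij; simp [hdiag]
    by_cases hjk : j = k
    · subst hjk; simp [hdiag]
    by_cases hik : i = k
    · subst hik; simp [hdiag]
    simp only [hik, Ne.symm hij, Ne.symm hjk, if_false]
    have e1 := h.codazzi_of_ne hx hik hjk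
    have e2 := h.codazzi_of_ne hx (Ne.symm hij) (Ne.symm hik)
    rw [h.conn_antisymm hx j i k] at e1
    have d1 : lam i x - lam j x ≠ 0 := sub_ne_zero.2 fun hh => hij (hlam hh)
    have d2 : lam j x - lam k x ≠ 0 := sub_ne_zero.2 fun hh => hjk (hlam hh)
    have d3 : lam k x - lam i x ≠ 0 := sub_ne_zero.2 fun hh => hik (hlam hh).symm
    rw [h.conn_antisymm hx k j i, h.conn_antisymm hx i k j, h.conn_antisymm hx j i k]
    set A := conn F e i j k x
    set B := conn F e j k i x
    set D := conn F e k i j x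
    have hA : A = (lam k x - lam i x) * B / (lam j x - lam k x) := by
      field_simp; linarith
    have hD : D = (lam k x - lam i x) * B / (lam i x - lam j x) := by
      rw [h.conn_antisymm hx k j i] at e2
      field_simp; linarith
    rw [hA, hD]
    field_simp
    ring
  have hzero : ∑ i, ∑ j, ∑ k, b i j k = 0 := by
    have h1 : ∑ i, ∑ j, ∑ k, b j k i = ∑ i, ∑ j, ∑ k, b i j k := by
      rw [sum_comm]
      exact sum_congr rfl fun i _ => sum_comm
    have h2 : ∑ i, ∑ j, ∑ k, b k i j = ∑ i, ∑ j, ∑ k, b i j k := by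
      rw [sum_congr rfl fun i _ => sum_comm, sum_comm]
    have h3 : ∑ i, ∑ j, ∑ k, (b i j k + b j k i + b k i j) = 0 := by simp [hcyc]
    simp only [sum_add_distrib] at h3
    linarith
  have hsplit : ∑ i, ∑ j, ∑ k, conn F e i j k x * conn F e k j i x
      = ∑ i, ∑ j, ∑ k, b i j k + ∑ i, ∑ j, conn F e i j i x ^ 2 := by
    simp only [← sum_add_distrib]
    refine sum_congr rfl fun i _ => sum_congr rfl fun j _ => ?_
    rw [← sub_eq_iff_eq_add', ← sum_sub_distrib, sum_eq_single i]
    · simp [b, sq]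
    · intro k _ hk; simp [b, hk.symm]
    · simp
  rw [hsplit, hzero, zero_add]
  refine sum_congr rfl fun i _ => sum_congr rfl fun j _ => ?_
  rw [h.conn_antisymm hx i j i, neg_sq]

end IsPrincipalFrame

end SphereHypersurface

end

noncomputable section

open Finset

namespace SphereHypersurface

variable {n : ℕ}

/-! ### The volume density and the divergence -/

/-- The matrix of a linear map with respect to the standard bases. -/
def stdMatrix {m k : ℕ} (A : EuclideanSpace ℝ (Fin m) →L[ℝ] EuclideanSpace ℝ (Fin k)) :
    Matrix (Fin k) (Fin m) ℝ :=
  LinearMap.toMatrix (EuclideanSpace.basisFun (Fin m) ℝ).toBasis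
    (EuclideanSpace.basisFun (Fin k) ℝ).toBasis A.toLinearMap

lemma stdMatrix_apply {m k : ℕ} (A : EuclideanSpace ℝ (Fin m) →L[ℝ] EuclideanSpace ℝ (Fin k))
    (i : Fin k) (j : Fin m) : stdMatrix A i j = A (EuclideanSpace.single j 1) i := by
  simp [stdMatrix, LinearMap.toMatrix_apply]

lemma stdMatrix_comp {m k l : ℕ} (A : EuclideanSpace ℝ (Fin m) →L[ℝ] EuclideanSpace ℝ (Fin k))
    (B : EuclideanSpace ℝ (Fin l) →L[ℝ] EuclideanSpace ℝ (Fin m)) :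
    stdMatrix (A.comp B) = stdMatrix A * stdMatrix B :=
  LinearMap.toMatrix_comp _ _ _ _ _

lemma transpose_stdMatrix_mul_apply {m k : ℕ}
    (A : EuclideanSpace ℝ (Fin m) →L[ℝ] EuclideanSpace ℝ (Fin k)) (i j : Fin m) :
    ((stdMatrix A).transpose * stdMatrix A) i j
      = ⟪A (EuclideanSpace.single i 1), A (EuclideanSpace.single j 1)⟫_ℝ := by
  simp [Matrix.mul_apply, stdMatrix_apply, PiLp.inner_apply, mul_comm]

lemma det_stdMatrix (B : Dom n →L[ℝ] Dom n) : (stdMatrix B).det = B.det :=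
  LinearMap.det_toMatrix _ _

/-- The Riemannian volume density of the metric pulled back by a linear map. -/
def density (A : Dom n →L[ℝ] Amb n) : ℝ :=
  √((stdMatrix A).transpose * stdMatrix A).det

lemma density_comp (A : Dom n →L[ℝ] Amb n) (B : Dom n →L[ℝ] Dom n) :
    density (A.comp B) = |B.det| * density A := by
  unfold density
  rw [stdMatrix_comp, Matrix.transpose_mul, Matrix.mul_assoc, ← Matrix.mul_assoc (stdMatrix A).transpose,
    Matrix.det_mul, Matrix.det_mul, Matrix.det_transpose, det_stdMatrix,
    show ∀ d : ℝ, B.det * (d * B.det) = B.det ^ 2 * d from fun d => by ring,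
    Real.sqrt_mul (sq_nonneg _), Real.sqrt_sq_eq_abs]

lemma continuous_density : Continuous (density : (Dom n →L[ℝ] Amb n) → ℝ) := by
  have : Continuous (stdMatrix : (Dom n →L[ℝ] Amb n) → _) := by
    refine continuous_matrix fun i j => ?_
    simp only [stdMatrix_apply]
    fun_prop
  unfold density
  fun_prop

/-- The divergence of a vector field on `ℝⁿ`. -/
def divergence (Y : Dom n → Dom n) (x : Dom n) : ℝ :=
  LinearMap.trace ℝ (Dom n) (fderiv ℝ Y x).toLinearMap

/-- A permutation other than the identity moves at least two indices, so after differentiating one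
factor of its Leibniz term an off-diagonal entry of the identity matrix is left. Only the diagonal
product contributes, giving the trace. -/
lemma hasFDerivAt_det_of_eq_one {g : Dom n → Matrix (Fin n) (Fin n) ℝ}
    {g' : Fin n → Fin n → Dom n →L[ℝ] ℝ} {x : Dom n}
    (hg : ∀ i j, HasFDerivAt (fun y => g y i j) (g' i j) x) (h1 : g x = 1) :
    HasFDerivAt (fun y => (g y).det) (∑ i, g' i i) x := by
  simp only [Matrix.det_apply]
  have h := HasFDerivAt.fun_sum fun (σ : Equiv.Perm (Fin n)) (_ : σ ∈ univ) =>
    (HasFDerivAt.finsetProd (u := univ) fun i _ => hg (σ i) i).const_smul (Equiv.Perm.sign σ)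
  refine h.congr_fderiv ?_
  rw [sum_eq_single 1]
  · simp [h1]
  · intro σ _ hσ
    suffices ∀ i, ∏ j ∈ univ.erase i, g x (σ j) j = 0 by simp [this]
    intro i
    by_contra hne
    rw [← ne_eq, prod_ne_zero_iff] at hne
    have hfix : ∀ j, j ≠ i → σ j = j := by
      intro j hj
      have := hne j (by simp [hj])
      rw [h1] at this
      by_contra hh
      exact this (Matrix.one_apply_ne hh)
    apply hσ
    ext j
    by_cases hj : j = i
    · subst hj
      by_contra hh
      have h2 : σ j ≠ j := fun h => hh (by simp [h])
      exact h2 (σ.injective (hfix _ h2))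
    · simp [hfix j hj]
  · simp

/-- The linear map sending the standard basis to the frame. -/
def frameMap (e : Fin n → Dom n → Dom n) (y : Dom n) : Dom n →L[ℝ] Dom n :=
  ∑ i, (EuclideanSpace.proj i : Dom n →L[ℝ] ℝ).smulRight (e i y)

lemma frameMap_single (e : Fin n → Dom n → Dom n) (y : Dom n) (i : Fin n) :
    frameMap e y (EuclideanSpace.single i 1) = e i y := by
  simp [frameMap]

lemma stdMatrix_frameMap (e : Fin n → Dom n → Dom n) (y : Dom n) (a i : Fin n) :
    stdMatrix (frameMap e y) a i = e i y a := by
  rw [stdMatrix_apply, frameMap_single]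

namespace IsPrincipalFrame

variable {U : Set (Dom n)} {F N : Dom n → Amb n} {e : Fin n → Dom n → Dom n}
  {lam : Fin n → Dom n → ℝ} (h : IsPrincipalFrame U F N e lam)
include h

/-- The induced volume density is 1 on an orthonormal frame. This writes the density as the
reciprocal of a frame determinant, which can be differentiated. -/
lemma density_mul_abs_det {x : Dom n} (hx : x ∈ U) :
    |(frameMap e x).det| * density (fderiv ℝ F x) = 1 := by
  rw [← density_comp, density]
  have : (stdMatrix ((fderiv ℝ F x).comp (frameMap e x))).transpose
      * stdMatrix ((fderiv ℝ F x).comp (frameMap e x)) = 1 := by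
    ext i j
    rw [transpose_stdMatrix_mul_apply]
    simp only [ContinuousLinearMap.comp_apply, frameMap_single]
    rw [h.inner_frame x hx, Matrix.one_apply]
  simp [this]

lemma det_frameMap_ne_zero {x : Dom n} (hx : x ∈ U) : (frameMap e x).det ≠ 0 := by
  intro h0
  simpa [h0] using h.density_mul_abs_det hx

lemma contDiffOn_det_frameMap : ContDiffOn ℝ ∞ (fun y => (frameMap e y).det) U := by
  simp only [← det_stdMatrix, Matrix.det_apply, stdMatrix_frameMap]
  refine ContDiffOn.sum fun σ _ => ContDiffOn.const_smul _ (contDiffOn_prod fun i _ => ?_)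
  exact (contDiff_piLp_apply (p := 2)).comp_contDiffOn (h.contDiffOn_frame i)

lemma density_eq {x : Dom n} (hx : x ∈ U) : density (fderiv ℝ F x) = |(frameMap e x).det|⁻¹ :=
  eq_inv_of_mul_eq_one_right (h.density_mul_abs_det hx)

lemma contDiffOn_density : ContDiffOn ℝ ∞ (fun y => density (fderiv ℝ F y)) U := by
  refine ContDiffOn.congr ?_ fun y hy => h.density_eq hy
  refine ContDiffOn.inv ?_ fun y hy => abs_ne_zero.2 (h.det_frameMap_ne_zero hy)
  exact h.contDiffOn_det_frameMap.abs fun y hy => h.det_frameMap_ne_zero hy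

variable {x : Dom n} (hx : x ∈ U)
include hx

lemma trace_eq_sum (T : Dom n →L[ℝ] Dom n) :
    LinearMap.trace ℝ (Dom n) T.toLinearMap
      = ∑ i, ⟪fderiv ℝ F x (T (e i x)), frameVec F e i x⟫_ℝ := by
  have hli : LinearIndependent ℝ fun i => e i x := by
    refine LinearIndependent.of_comp (fderiv ℝ F x).toLinearMap ?_
    refine Orthonormal.linearIndependent ?_
    rw [orthonormal_iff_ite]
    exact h.inner_frame x hx
  -- The basis constructor used below needs a nonempty index type; in dimension zero both sides are
  -- 0.
  rcases isEmpty_or_nonempty (Fin n) with hn | hn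
  · have : LinearMap.trace ℝ (Dom n) T.toLinearMap = 0 := by
      have : T.toLinearMap = 0 := Subsingleton.elim _ _
      simp [this]
    simp [this]
  let b := basisOfLinearIndependentOfCardEqFinrank hli (by simp)
  have hb : ∀ i, b i = e i x := fun i => by simp [b]
  rw [LinearMap.trace_eq_matrix_trace ℝ b, Matrix.trace]
  refine sum_congr rfl fun i _ => ?_
  rw [Matrix.diag_apply, LinearMap.toMatrix_apply, hb]
  have h1 := h.eq_sum_inner_frameVec hx (T (e i x))
  simp only [← hb] at h1
  conv_lhs => rw [ContinuousLinearMap.coe_coe, ← hb, h1]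
  rw [b.repr_sum_self, hb]

/-- Since the density is the reciprocal of the absolute frame determinant, its logarithmic
derivative is minus the trace of that of the frame. -/
lemma fderiv_density (v : Dom n) :
    fderiv ℝ (fun y => density (fderiv ℝ F y)) x v
      = -density (fderiv ℝ F x)
        * ∑ i, ⟪fderiv ℝ F x (fderiv ℝ (e i) x v), frameVec F e i x⟫_ℝ := by
  set M : Dom n → Matrix (Fin n) (Fin n) ℝ := fun y => stdMatrix (frameMap e y) with hM
  have hdet : ∀ y, (M y).det = (frameMap e y).det := fun y => det_stdMatrix _
  have hMx : IsUnit (M x).det := by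
    rw [hdet]; exact (h.det_frameMap_ne_zero hx).isUnit
  have he : ∀ i, HasFDerivAt (e i) (fderiv ℝ (e i) x) x := fun i =>
    (differentiableAt_of_contDiffOn h.isOpen (h.contDiffOn_frame i) hx).hasFDerivAt
  -- the coefficients of a vector in the frame
  have hcoef : ∀ (w : Dom n) (i : Fin n),
      ∑ a, (M x)⁻¹ i a * w a = ⟪fderiv ℝ F x w, frameVec F e i x⟫_ℝ := by
    intro w i
    have hw := h.eq_sum_inner_frameVec hx w
    have hw' : (fun a => w a) = (M x).mulVec fun k => ⟪fderiv ℝ F x w, frameVec F e k x⟫_ℝ := by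
      ext a
      conv_lhs => rw [hw]
      simp [hM, Matrix.mulVec, dotProduct, stdMatrix_frameMap, mul_comm]
    have := congrArg (fun u => (M x)⁻¹.mulVec u i) hw'
    simp only [Matrix.mulVec_mulVec, Matrix.nonsing_inv_mul _ hMx, Matrix.one_mulVec] at this
    exact this
  -- Multiplying by the inverse of the value at x moves the determinant to the identity matrix,
  -- where its derivative is the trace, and removes its sign near x.
  have hB : HasFDerivAt (fun y => ((M x)⁻¹ * M y).det)
      (∑ i, ∑ a, (M x)⁻¹ i a • (EuclideanSpace.proj a : Dom n →L[ℝ] ℝ).comp (fderiv ℝ (e i) x)) x := by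
    refine hasFDerivAt_det_of_eq_one (g' := fun i j => ∑ a, (M x)⁻¹ i a •
      (EuclideanSpace.proj a : Dom n →L[ℝ] ℝ).comp (fderiv ℝ (e j) x)) (fun i j => ?_)
      (Matrix.nonsing_inv_mul _ hMx)
    simp only [Matrix.mul_apply, hM, stdMatrix_frameMap]
    refine HasFDerivAt.fun_sum fun a _ => ?_
    exact ((EuclideanSpace.proj a : Dom n →L[ℝ] ℝ).hasFDerivAt.comp x (he j)).const_mul _
  have hBx : ((M x)⁻¹ * M x).det = 1 := by rw [Matrix.nonsing_inv_mul _ hMx, Matrix.det_one]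
  have hev : (fun y => density (fderiv ℝ F y)) =ᶠ[nhds x]
      fun y => density (fderiv ℝ F x) * (((M x)⁻¹ * M y).det)⁻¹ := by
    have hpos : ∀ᶠ y in nhds x, 0 < ((M x)⁻¹ * M y).det :=
      hB.continuousAt.eventually (lt_mem_nhds (by simp only [hBx]; exact one_pos))
    filter_upwards [h.isOpen.mem_nhds hx, hpos] with y hy hy0
    rw [h.density_eq hy, h.density_eq hx, ← hdet, ← hdet, ← abs_of_pos hy0, Matrix.det_mul,
      Matrix.det_nonsing_inv, Ring.inverse_eq_inv', abs_mul, abs_inv]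
    have : |(M x).det| ≠ 0 := abs_ne_zero.2 hMx.ne_zero
    field_simp
  rw [hev.fderiv_eq]
  have hinv : HasFDerivAt (fun y => (((M x)⁻¹ * M y).det)⁻¹) _ x :=
    (hasDerivAt_inv (x := ((M x)⁻¹ * M x).det)
      (by rw [hBx]; exact one_ne_zero)).comp_hasFDerivAt x hB
  rw [(hinv.const_mul (density (fderiv ℝ F x))).fderiv]
  simp only [hBx, _root_.smul_apply, _root_.sum_apply,
    ContinuousLinearMap.comp_apply, smul_eq_mul, PiLp.proj_apply]
  simp only [hcoef]
  ring

/-- The divergence of a vector field given by its components in a principal frame. -/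
lemma divergence_density_smul {v : Fin n → Dom n → ℝ} (hv : ∀ i, DifferentiableAt ℝ (v i) x) :
    divergence (fun y => density (fderiv ℝ F y) • ∑ j, v j y • e j y) x
      = density (fderiv ℝ F x)
        * (∑ i, fderiv ℝ (v i) x (e i x) - ∑ j, v j x * accel F e j x) := by
  have he : ∀ i, DifferentiableAt ℝ (e i) x := fun i =>
    differentiableAt_of_contDiffOn h.isOpen (h.contDiffOn_frame i) hx
  have hJ := differentiableAt_of_contDiffOn h.isOpen h.contDiffOn_density hx
  have hV : HasFDerivAt (fun y => ∑ j, v j y • e j y)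
      (∑ j, (v j x • fderiv ℝ (e j) x + (fderiv ℝ (v j) x).smulRight (e j x))) x :=
    HasFDerivAt.fun_sum fun j _ => (hv j).hasFDerivAt.smul (he j).hasFDerivAt
  rw [divergence, h.trace_eq_sum hx, (hJ.hasFDerivAt.fun_smul hV).fderiv]
  -- The Lie bracket trades the derivative of e_j along e_i for that of e_i along e_j. The traded
  -- terms cancel against the derivative of the density, and the connection coefficients remain.
  have hG : ∀ i j, ⟪fderiv ℝ F x (fderiv ℝ (e j) x (e i x)), frameVec F e i x⟫_ℝ
      = conn F e i j i x + ⟪fderiv ℝ F x (fderiv ℝ (e i) x (e j x)), frameVec F e i x⟫_ℝ := by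
    intro i j
    have h1 := h.lieBracket_eq hx i j
    have h2 := congrArg (fun w => ⟪fderiv ℝ F x w, frameVec F e i x⟫_ℝ) h1
    simp only [VectorField.lieBracket, map_sub, map_sum, map_smul, sum_inner, inner_sub_left,
      inner_smul_left, RCLike.conj_to_real] at h2
    simp only [show ∀ m, ⟪fderiv ℝ F x (e m x), frameVec F e i x⟫_ℝ = if m = i then 1 else 0 from
      fun m => h.inner_frameVec hx m i, mul_ite, mul_one, mul_zero, sum_ite_eq', mem_univ,
      if_true] at h2
    have : conn F e j i i x = 0 := by linarith [h.conn_antisymm hx j i i]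
    linarith
  simp only [_root_.add_apply, _root_.smul_apply,
    _root_.sum_apply, ContinuousLinearMap.smulRight_apply, map_add, map_smul, map_sum,
    inner_add_left, inner_smul_left, sum_inner, RCLike.conj_to_real, h.fderiv_density hx, hG]
  simp only [show ∀ m i, ⟪fderiv ℝ F x (e m x), frameVec F e i x⟫_ℝ = if m = i then 1 else 0 from
      fun m i => h.inner_frameVec hx m i, mul_ite, mul_one, mul_zero, sum_ite_eq', mem_univ,
      if_true, sum_add_distrib, mul_add]
  have hconn : ∑ i, ∑ j, v j x * conn F e i j i x = -∑ j, v j x * accel F e j x := by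
    rw [sum_comm, ← sum_neg_distrib]
    refine sum_congr rfl fun j _ => ?_
    rw [accel, mul_sum, ← sum_neg_distrib]
    refine sum_congr rfl fun i _ => ?_
    rw [h.conn_antisymm hx i j i]; ring
  have hcross : ∑ i, (-density (fderiv ℝ F x)
        * ∑ k, ⟪fderiv ℝ F x (fderiv ℝ (e k) x (e i x)), frameVec F e k x⟫_ℝ) * v i x
      = -(density (fderiv ℝ F x) * ∑ i, ∑ j,
        v j x * ⟪fderiv ℝ F x (fderiv ℝ (e i) x (e j x)), frameVec F e i x⟫_ℝ) := by
    rw [sum_comm, mul_sum, ← sum_neg_distrib]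
    refine sum_congr rfl fun j _ => ?_
    rw [← mul_sum]
    ring
  rw [hcross]
  simp only [← mul_sum]
  rw [hconn]
  ring

end IsPrincipalFrame

end SphereHypersurface

end

noncomputable section

open Finset

namespace SphereHypersurface

variable {n : ℕ}

/-! ### The Gauss equation for the scalar curvature -/

namespace IsLocalHypersurface

variable {U : Set (Dom n)} {F N : Dom n → Amb n} (h : IsLocalHypersurface U F N)
include h

/-- Tangent vectors, N and F are mutually orthogonal, so the map assembling them is injective; both
sides have dimension n + 2, so it is onto. -/
lemma exists_eq_add {x : Dom n} (hx : x ∈ U) (w : Amb n) :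
    ∃ (v : Dom n) (a b : ℝ), w = fderiv ℝ F x v + a • N x + b • F x := by
  let L : (Dom n × ℝ × ℝ) →ₗ[ℝ] Amb n :=
    LinearMap.coprod (fderiv ℝ F x).toLinearMap
      (LinearMap.coprod (LinearMap.toSpanSingleton ℝ _ (N x)) (LinearMap.toSpanSingleton ℝ _ (F x)))
  have hL : ∀ v a b, L (v, a, b) = fderiv ℝ F x v + a • N x + b • F x := by
    intro v a b; simp [L, add_assoc]
  have hinj : Function.Injective L := by
    rw [injective_iff_map_eq_zero]
    rintro ⟨v, a, b⟩ h0
    rw [hL] at h0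
    have hN := congrArg (fun w => ⟪N x, w⟫_ℝ) h0
    have hF := congrArg (fun w => ⟪F x, w⟫_ℝ) h0
    have h1 := h.inner_normal x hx
    have h2 : ⟪F x, N x⟫_ℝ = 0 := by rw [real_inner_comm]; exact h1
    simp only [inner_add_right, h.inner_normal_fderiv x hx, inner_smul_right, h1, h2,
      h.inner_fderiv_pos hx, real_inner_self_eq_norm_sq, h.norm_normal x hx, h.norm_eq_one x hx,
      inner_zero_right] at hN hF
    have ha : a = 0 := by linarith
    have hb : b = 0 := by linarith
    subst ha hb
    simp only [zero_smul, add_zero] at h0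
    have : v = 0 := h.injective_fderiv x hx (by rw [h0, map_zero])
    simp [this]
  have hsurj : Function.Surjective L :=
    (LinearMap.injective_iff_surjective_of_finrank_eq_finrank (by simp)).1 hinj
  obtain ⟨⟨v, a, b⟩, hv⟩ := hsurj w
  exact ⟨v, a, b, by rw [← hv, hL]⟩

lemma eq_zero_of_inner {x : Dom n} (hx : x ∈ U) {w : Amb n} (hT : ∀ v, ⟪w, fderiv ℝ F x v⟫_ℝ = 0)
    (hN : ⟪w, N x⟫_ℝ = 0) (hF : ⟪w, F x⟫_ℝ = 0) : w = 0 := by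
  obtain ⟨v, a, b, hw⟩ := h.exists_eq_add hx w
  rw [← inner_self_eq_zero (𝕜 := ℝ)]
  nth_rw 2 [hw]
  simp [inner_add_right, inner_smul_right, hT, hN, hF]

lemma exists_shape {x : Dom n} (hx : x ∈ U) (v : Dom n) :
    ∃ w, fderiv ℝ F x w = -fderiv ℝ N x v := by
  obtain ⟨w, a, b, hw⟩ := h.exists_eq_add hx (-fderiv ℝ N x v)
  have hN := congrArg (fun w => ⟪N x, w⟫_ℝ) hw
  have hF := congrArg (fun w => ⟪F x, w⟫_ℝ) hw
  have h1 := h.inner_normal x hx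
  have h2 : ⟪F x, N x⟫_ℝ = 0 := by rw [real_inner_comm]; exact h1
  simp only [inner_add_right, h.inner_normal_fderiv x hx, inner_smul_right, h1, h2,
      h.inner_fderiv_pos hx, real_inner_self_eq_norm_sq, h.norm_normal x hx, h.norm_eq_one x hx,
      inner_neg_right, h.inner_normal_fderiv_normal hx, h.inner_pos_fderiv_normal hx] at hN hF
  have ha : a = 0 := by linarith
  have hb : b = 0 := by linarith
  exact ⟨w, by rw [hw, ha, hb]; simp⟩

/-- Symmetry of the second derivative, read off from the vanishing bracket of two constant fields.
-/
lemma fderiv_comm {x : Dom n} (hx : x ∈ U) (a b : Dom n) :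
    fderiv ℝ (fun y => fderiv ℝ F y a) x b = fderiv ℝ (fun y => fderiv ℝ F y b) x a := by
  have := VectorField.fderiv_apply_lieBracket (𝕜 := ℝ) (n := ∞) (f := F) (x := x)
    (W := fun _ => a) (V := fun _ => b)
    (h.contDiffOn.contDiffAt (h.isOpen.mem_nhds hx))
    (by rw [minSmoothness_of_isRCLikeNormedField]; exact ENat.LEInfty.out)
    (differentiableAt_const _) (differentiableAt_const _)
  simp only [VectorField.lieBracket, fderiv_fun_const, Pi.zero_apply,
    _root_.zero_apply, sub_zero, map_zero] at this
  exact (sub_eq_zero.1 this.symm)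

lemma contDiffOn_fderiv_const (v : Dom n) : ContDiffOn ℝ ∞ (fun y => fderiv ℝ F y v) U :=
  contDiffOn_fderiv_apply h.isOpen h.contDiffOn contDiffOn_const

/-- The second fundamental form in terms of second derivatives. -/
lemma inner_fderiv_fderiv_normal {x : Dom n} (hx : x ∈ U) (v w : Dom n) :
    ⟪fderiv ℝ (fun y => fderiv ℝ F y w) x v, N x⟫_ℝ = -⟪fderiv ℝ F x w, fderiv ℝ N x v⟫_ℝ := by
  have := inner_fderiv_add_eq_zero h.isOpen (h.contDiffOn_fderiv_const w) h.contDiffOn_normal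
    (c := 0) (fun y hy => by rw [real_inner_comm]; exact h.inner_normal_fderiv y hy _) hx v
  linarith

lemma inner_fderiv_fderiv_pos {x : Dom n} (hx : x ∈ U) (v w : Dom n) :
    ⟪fderiv ℝ (fun y => fderiv ℝ F y w) x v, F x⟫_ℝ = -⟪fderiv ℝ F x w, fderiv ℝ F x v⟫_ℝ := by
  have := inner_fderiv_add_eq_zero h.isOpen (h.contDiffOn_fderiv_const w) h.contDiffOn
    (c := 0) (fun y hy => by rw [real_inner_comm]; exact h.inner_fderiv_pos hy _) hx v
  linarith

/-- The shape operator is symmetric. -/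
lemma shape_symm {x : Dom n} (hx : x ∈ U) (v w : Dom n) :
    ⟪fderiv ℝ F x w, fderiv ℝ N x v⟫_ℝ = ⟪fderiv ℝ F x v, fderiv ℝ N x w⟫_ℝ := by
  have h1 := h.inner_fderiv_fderiv_normal hx v w
  have h2 := h.inner_fderiv_fderiv_normal hx w v
  rw [h.fderiv_comm hx] at h1
  linarith

end IsLocalHypersurface

/-- The coordinate vector field `∂_i F`. -/
def coordVec (F : Dom n → Amb n) (i : Fin n) (y : Dom n) : Amb n :=
  fderiv ℝ F y (EuclideanSpace.single i 1)

/-- The coefficients of the metric induced by `F`. -/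
def gramCoord (F : Dom n → Amb n) (y : Dom n) : Matrix (Fin n) (Fin n) ℝ :=
  Matrix.of fun i j => ⟪coordVec F i y, coordVec F j y⟫_ℝ

lemma map_eq_sum_coordVec (F : Dom n → Amb n) (y v : Dom n) :
    fderiv ℝ F y v = ∑ i, v i • coordVec F i y := by
  have hv : v = ∑ i, v i • EuclideanSpace.single i (1 : ℝ) := by
    have := (EuclideanSpace.basisFun (Fin n) ℝ).sum_repr v
    simpa using this.symm
  conv_lhs => rw [hv]
  simp [coordVec]

namespace IsLocalHypersurface

variable {U : Set (Dom n)} {F N : Dom n → Amb n} (h : IsLocalHypersurface U F N)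
include h

lemma isUnit_det_gramCoord {y : Dom n} (hy : y ∈ U) : IsUnit (gramCoord F y).det := by
  rw [isUnit_iff_ne_zero]
  intro h0
  obtain ⟨v, hv0, hv⟩ := Matrix.exists_mulVec_eq_zero_iff.2 h0
  let v' : Dom n := WithLp.toLp 2 v
  have hFv : fderiv ℝ F y v' = 0 := by
    rw [← inner_self_eq_zero (𝕜 := ℝ)]
    have hs := map_eq_sum_coordVec F y v'
    calc ⟪fderiv ℝ F y v', fderiv ℝ F y v'⟫_ℝ
        = ∑ i, v i * (gramCoord F y).mulVec v i := by
          rw [hs]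
          simp only [sum_inner, inner_sum, inner_smul_left, inner_smul_right, Matrix.mulVec,
            dotProduct, gramCoord, Matrix.of_apply, mul_sum, RCLike.conj_to_real]
          exact sum_congr rfl fun i _ => sum_congr rfl fun j _ => by
            rw [show v'.ofLp = v from rfl, real_inner_comm (coordVec F i y) (coordVec F j y)]; ring
      _ = 0 := by simp [hv]
  have : v' = 0 := h.injective_fderiv y hy (by rw [hFv, map_zero])
  apply hv0
  ext i
  exact congrArg (fun w : Dom n => w i) this

lemma contDiffOn_coordVec (i : Fin n) : ContDiffOn ℝ ∞ (coordVec F i) U :=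
  h.contDiffOn_fderiv_const _

lemma contDiffOn_gramCoord (i j : Fin n) : ContDiffOn ℝ ∞ (fun y => gramCoord F y i j) U :=
  (h.contDiffOn_coordVec i).inner ℝ (h.contDiffOn_coordVec j)

lemma contDiffOn_inv_gramCoord (k l : Fin n) :
    ContDiffOn ℝ ∞ (fun y => (gramCoord F y)⁻¹ k l) U := by
  have hdet : ∀ (M : Dom n → Matrix (Fin n) (Fin n) ℝ),
      (∀ i j, ContDiffOn ℝ ∞ (fun y => M y i j) U) → ContDiffOn ℝ ∞ (fun y => (M y).det) U := by
    intro M hM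
    simp only [Matrix.det_apply]
    exact ContDiffOn.sum fun σ _ => ContDiffOn.const_smul _ (contDiffOn_prod fun i _ => hM _ _)
  simp only [Matrix.inv_def, Matrix.smul_apply, Ring.inverse_eq_inv', smul_eq_mul,
    Matrix.adjugate_apply]
  refine ContDiffOn.mul ((hdet _ h.contDiffOn_gramCoord).inv fun y hy =>
    (h.isUnit_det_gramCoord hy).ne_zero) (hdet _ fun i j => ?_)
  simp only [Matrix.updateRow_apply]
  split_ifs
  · exact contDiffOn_const
  · exact h.contDiffOn_gramCoord i j

lemma partialDeriv_gramCoord {y : Dom n} (hy : y ∈ U) (k i j : Fin n) :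
    partialDeriv k (fun z => gramCoord F z i j) y
      = ⟪coordVec F i y, fderiv ℝ (coordVec F j) y (EuclideanSpace.single k 1)⟫_ℝ
        + ⟪fderiv ℝ (coordVec F i) y (EuclideanSpace.single k 1), coordVec F j y⟫_ℝ :=
  fderiv_inner_apply ℝ (differentiableAt_of_contDiffOn h.isOpen (h.contDiffOn_coordVec i) hy)
    (differentiableAt_of_contDiffOn h.isOpen (h.contDiffOn_coordVec j) hy) _

lemma fderiv_coordVec_comm {y : Dom n} (hy : y ∈ U) (i j : Fin n) :
    fderiv ℝ (coordVec F i) y (EuclideanSpace.single j 1)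
      = fderiv ℝ (coordVec F j) y (EuclideanSpace.single i 1) :=
  h.fderiv_comm hy _ _

/-- The three metric derivatives contain six products of first and second derivatives of F; four
cancel and two coincide, which absorbs the factor 1/2. -/
lemma christoffel_gramCoord {y : Dom n} (hy : y ∈ U) (k i j : Fin n) :
    christoffel (gramCoord F) k i j y
      = ∑ l, (gramCoord F y)⁻¹ k l
        * ⟪fderiv ℝ (coordVec F j) y (EuclideanSpace.single i 1), coordVec F l y⟫_ℝ := by
  rw [christoffel, mul_sum]
  refine sum_congr rfl fun l _ => ?_
  rw [h.partialDeriv_gramCoord hy, h.partialDeriv_gramCoord hy, h.partialDeriv_gramCoord hy,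
    h.fderiv_coordVec_comm hy l i, h.fderiv_coordVec_comm hy l j, h.fderiv_coordVec_comm hy i j,
    real_inner_comm (coordVec F j y)]
  ring

lemma differentiableAt_christoffel {x : Dom n} (hx : x ∈ U) (k i j : Fin n) :
    DifferentiableAt ℝ (christoffel (gramCoord F) k i j) x := by
  have : ContDiffOn ℝ ∞ (fun y => ∑ l, (gramCoord F y)⁻¹ k l
        * ⟪fderiv ℝ (coordVec F j) y (EuclideanSpace.single i 1), coordVec F l y⟫_ℝ) U :=
    ContDiffOn.sum fun l _ => (h.contDiffOn_inv_gramCoord k l).mul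
      ((contDiffOn_fderiv_apply h.isOpen (h.contDiffOn_coordVec j) contDiffOn_const).inner ℝ
        (h.contDiffOn_coordVec l))
  exact differentiableAt_of_contDiffOn h.isOpen
    (this.congr fun y hy => h.christoffel_gramCoord hy k i j) hx

/-- The Gauss formula `∂_i ∂_j F = ∑_k Γ^k_ij ∂_k F + h_ij N - g_ij F`. -/
lemma fderiv_coordVec_eq {y : Dom n} (hy : y ∈ U) (i j : Fin n) :
    fderiv ℝ (coordVec F j) y (EuclideanSpace.single i 1)
      = ∑ k, christoffel (gramCoord F) k i j y • coordVec F k y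
        + ⟪fderiv ℝ (coordVec F j) y (EuclideanSpace.single i 1), N y⟫_ℝ • N y
        - gramCoord F y j i • F y := by
  have hT : ∀ l, ⟪coordVec F l y, N y⟫_ℝ = 0 := fun l => by
    rw [real_inner_comm]; exact h.inner_normal_fderiv y hy _
  have hT' : ∀ l, ⟪coordVec F l y, F y⟫_ℝ = 0 := fun l => by
    rw [real_inner_comm]; exact h.inner_fderiv_pos hy _
  have hNF := h.inner_normal y hy
  rw [← sub_eq_zero]
  refine h.eq_zero_of_inner hy (fun v => ?_) ?_ ?_
  · rw [map_eq_sum_coordVec F y v, inner_sum]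
    refine sum_eq_zero fun m _ => ?_
    have hm : ∑ k, christoffel (gramCoord F) k i j y * gramCoord F y k m
        = ⟪fderiv ℝ (coordVec F j) y (EuclideanSpace.single i 1), coordVec F m y⟫_ℝ := by
      simp only [h.christoffel_gramCoord hy, sum_mul]
      rw [sum_comm]
      have hinv : ∀ l, ∑ k, gramCoord F y m k * (gramCoord F y)⁻¹ k l
          = if m = l then 1 else 0 := by
        intro l
        rw [← Matrix.mul_apply, Matrix.mul_nonsing_inv _ (h.isUnit_det_gramCoord hy),
          Matrix.one_apply]
      have hsym : ∀ k, gramCoord F y k m = gramCoord F y m k := fun k => by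
        simp only [gramCoord, Matrix.of_apply]; exact real_inner_comm _ _
      calc _ = ∑ l, (∑ k, gramCoord F y m k * (gramCoord F y)⁻¹ k l)
            * ⟪fderiv ℝ (coordVec F j) y (EuclideanSpace.single i 1), coordVec F l y⟫_ℝ := by
            refine sum_congr rfl fun l _ => ?_
            rw [sum_mul]
            exact sum_congr rfl fun k _ => by rw [hsym]; ring
        _ = _ := by simp [hinv]
    rw [inner_smul_right, inner_sub_left, inner_sub_left, inner_add_left, sum_inner]
    simp only [inner_smul_left, RCLike.conj_to_real]
    rw [real_inner_comm (coordVec F m y) (N y), real_inner_comm (coordVec F m y) (F y), hT, hT', ← hm]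
    simp [gramCoord]
  · simp only [inner_sub_left, inner_add_left, sum_inner, inner_smul_left, RCLike.conj_to_real, hT,
      real_inner_comm (N y) (F y), hNF, real_inner_self_eq_norm_sq, h.norm_normal y hy]
    simp
  · simp only [inner_sub_left, inner_add_left, sum_inner, inner_smul_left, RCLike.conj_to_real, hT',
      hNF, real_inner_self_eq_norm_sq, h.norm_eq_one y hy]
    have := h.inner_fderiv_fderiv_pos hy (EuclideanSpace.single i 1) (EuclideanSpace.single j 1)
    change ⟪fderiv ℝ (coordVec F j) y (EuclideanSpace.single i 1), F y⟫_ℝ = -gramCoord F y j i at this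
    rw [this]
    simp

/-- The Gauss equation for the curvature tensor. -/
lemma riemannCoeff_gramCoord {x : Dom n} (hx : x ∈ U) (A : Module.End ℝ (Dom n))
    (hA : ∀ v, fderiv ℝ F x (A v) = -fderiv ℝ N x v) (i j k l : Fin n) :
    riemannCoeff (gramCoord F) i j k l x
      = ⟪fderiv ℝ (coordVec F k) x (EuclideanSpace.single j 1), N x⟫_ℝ
          * A (EuclideanSpace.single i 1) l
        - ⟪fderiv ℝ (coordVec F k) x (EuclideanSpace.single i 1), N x⟫_ℝ
          * A (EuclideanSpace.single j 1) l
        + gramCoord F x k j * (if l = i then 1 else 0)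
        - gramCoord F x k i * (if l = j then 1 else 0) := by
  have hd := fun {H : Dom n → Amb n} (hH : ContDiffOn ℝ ∞ H U) =>
    differentiableAt_of_contDiffOn h.isOpen hH hx
  have hII : ∀ j k, ContDiffOn ℝ ∞
      (fun y => ⟪fderiv ℝ (coordVec F k) y (EuclideanSpace.single j 1), N y⟫_ℝ) U := fun j k =>
    (contDiffOn_fderiv_apply h.isOpen (h.contDiffOn_coordVec k) contDiffOn_const).inner ℝ
        h.contDiffOn_normal
  -- tangential part of the second derivatives of `∂_k F`
  have hsnd : ∀ (i j : Fin n) (w : Dom n),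
      ⟪fderiv ℝ (fun y => fderiv ℝ (coordVec F k) y (EuclideanSpace.single j 1)) x
        (EuclideanSpace.single i 1), fderiv ℝ F x w⟫_ℝ
      = ⟪∑ l, (partialDeriv i (christoffel (gramCoord F) l j k) x
          + ∑ m, christoffel (gramCoord F) m j k x * christoffel (gramCoord F) l i m x)
            • coordVec F l x
          + ⟪fderiv ℝ (coordVec F k) x (EuclideanSpace.single j 1), N x⟫_ℝ
            • fderiv ℝ N x (EuclideanSpace.single i 1)
          - gramCoord F x k j • coordVec F i x, fderiv ℝ F x w⟫_ℝ := by
    intro i j w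
    have hev : (fun y => fderiv ℝ (coordVec F k) y (EuclideanSpace.single j 1)) =ᶠ[nhds x] fun y =>
        ∑ m, christoffel (gramCoord F) m j k y • coordVec F m y
        + ⟪fderiv ℝ (coordVec F k) y (EuclideanSpace.single j 1), N y⟫_ℝ • N y
        - gramCoord F y k j • F y :=
      Filter.eventually_of_mem (h.isOpen.mem_nhds hx) fun y hy => h.fderiv_coordVec_eq hy j k
    have hder := ((HasFDerivAt.fun_sum fun m (_ : m ∈ univ) =>
      (h.differentiableAt_christoffel hx m j k).hasFDerivAt.fun_smul
        (hd (h.contDiffOn_coordVec m)).hasFDerivAt).add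
      ((differentiableAt_of_contDiffOn h.isOpen (hII j k) hx).hasFDerivAt.fun_smul
        (hd h.contDiffOn_normal).hasFDerivAt)).sub
      ((differentiableAt_of_contDiffOn h.isOpen (h.contDiffOn_gramCoord k j) hx).hasFDerivAt.fun_smul
        (hd h.contDiffOn).hasFDerivAt)
    have hN0 := h.inner_normal_fderiv x hx w
    have hF0 := h.inner_fderiv_pos hx w
    have htan : ∀ m, ⟪fderiv ℝ (coordVec F m) x (EuclideanSpace.single i 1), fderiv ℝ F x w⟫_ℝ
        = ∑ l, christoffel (gramCoord F) l i m x * ⟪coordVec F l x, fderiv ℝ F x w⟫_ℝ := by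
      intro m
      rw [h.fderiv_coordVec_eq hx i m, inner_sub_left, inner_add_left, sum_inner]
      simp only [inner_smul_left, RCLike.conj_to_real, hN0, hF0]
      simp
    rw [hev.fderiv_eq]
    erw [hder.fderiv]
    simp only [_root_.sub_apply, _root_.add_apply, _root_.sum_apply, _root_.smul_apply,
      ContinuousLinearMap.smulRight_apply, inner_sub_left, inner_add_left, sum_inner,
      inner_smul_left, RCLike.conj_to_real, hN0, hF0, htan, add_mul, sum_mul, mul_sum,
      sum_add_distrib, mul_zero, add_zero]
    rw [sum_comm]
    simp only [partialDeriv, coordVec, mul_assoc]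
    ring
  have hcomm := VectorField.fderiv_apply_lieBracket (𝕜 := ℝ) (n := ∞) (f := coordVec F k) (x := x)
    (W := fun _ => EuclideanSpace.single j 1) (V := fun _ => EuclideanSpace.single i 1)
    ((h.contDiffOn_coordVec k).contDiffAt (h.isOpen.mem_nhds hx))
    (by rw [minSmoothness_of_isRCLikeNormedField]; exact ENat.LEInfty.out)
    (differentiableAt_const _) (differentiableAt_const _)
  simp only [VectorField.lieBracket, fderiv_fun_const, Pi.zero_apply,
    _root_.zero_apply, sub_zero, map_zero] at hcomm
  have hcomm' := sub_eq_zero.1 hcomm.symm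
  -- The difference of the two sides as a vector. Its image dF(u) is the difference of the
  -- tangential parts of two mixed third derivatives of F; these derivatives agree, so dF(u) is
  -- orthogonal to itself, and injectivity gives u = 0.
  let u : Dom n := ∑ l, riemannCoeff (gramCoord F) i j k l x • EuclideanSpace.single l 1
    - (⟪fderiv ℝ (coordVec F k) x (EuclideanSpace.single j 1), N x⟫_ℝ • A (EuclideanSpace.single i 1)
      - ⟪fderiv ℝ (coordVec F k) x (EuclideanSpace.single i 1), N x⟫_ℝ • A (EuclideanSpace.single j 1)
      + gramCoord F x k j • EuclideanSpace.single i 1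
      - gramCoord F x k i • EuclideanSpace.single j 1)
  have hu : u = 0 := by
    apply h.injective_fderiv x hx
    rw [map_zero]
    rw [← inner_self_eq_zero (𝕜 := ℝ)]
    have h1 := hsnd i j u
    rw [hcomm', hsnd j i u] at h1
    have h2 : fderiv ℝ F x u = (∑ l, (partialDeriv i (christoffel (gramCoord F) l j k) x
          + ∑ m, christoffel (gramCoord F) m j k x * christoffel (gramCoord F) l i m x)
            • coordVec F l x
          + ⟪fderiv ℝ (coordVec F k) x (EuclideanSpace.single j 1), N x⟫_ℝ
            • fderiv ℝ N x (EuclideanSpace.single i 1)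
          - gramCoord F x k j • coordVec F i x)
        - (∑ l, (partialDeriv j (christoffel (gramCoord F) l i k) x
          + ∑ m, christoffel (gramCoord F) m i k x * christoffel (gramCoord F) l j m x)
            • coordVec F l x
          + ⟪fderiv ℝ (coordVec F k) x (EuclideanSpace.single i 1), N x⟫_ℝ
            • fderiv ℝ N x (EuclideanSpace.single j 1)
          - gramCoord F x k i • coordVec F j x) := by
      have hsum : ∑ l, riemannCoeff (gramCoord F) i j k l x • coordVec F l x
          = ∑ l, (partialDeriv i (christoffel (gramCoord F) l j k) x
          + ∑ m, christoffel (gramCoord F) m j k x * christoffel (gramCoord F) l i m x)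
            • coordVec F l x - ∑ l, (partialDeriv j (christoffel (gramCoord F) l i k) x
          + ∑ m, christoffel (gramCoord F) m i k x * christoffel (gramCoord F) l j m x)
            • coordVec F l x := by
        rw [← sum_sub_distrib]
        refine sum_congr rfl fun l _ => ?_
        rw [← sub_smul, riemannCoeff, sum_sub_distrib]
        congr 1
        ring
      simp only [u, map_sub, map_add, map_sum, map_smul, hA]
      simp only [smul_neg]
      change ∑ l, riemannCoeff (gramCoord F) i j k l x • coordVec F l x
        - (_ - _ + _ • coordVec F i x - _ • coordVec F j x) = _
      rw [hsum]
      abel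
    nth_rw 1 [h2]
    rw [inner_sub_left, h1, sub_self]
  have := congrArg (fun w : Dom n => w l) hu
  simp only [u, PiLp.sub_apply, PiLp.add_apply, PiLp.smul_apply, smul_eq_mul, PiLp.zero_apply,
    WithLp.ofLp_sum, Finset.sum_apply, PiLp.single_apply, mul_ite, mul_one, mul_zero,
    sum_ite_eq, mem_univ, if_true] at this
  simp only [mul_ite, mul_one, mul_zero]
  linarith

/-- The scalar curvature of a hypersurface of the unit sphere. -/
theorem scalarCurvatureCoord_gramCoord {x : Dom n} (hx : x ∈ U) (A : Module.End ℝ (Dom n))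
    (hA : ∀ v, fderiv ℝ F x (A v) = -fderiv ℝ N x v) :
    scalarCurvatureCoord (gramCoord F) x
      = n * (n - 1) + LinearMap.trace ℝ _ A ^ 2 - LinearMap.trace ℝ _ (A * A) := by
  set b := (EuclideanSpace.basisFun (Fin n) ℝ).toBasis
  set S : Matrix (Fin n) (Fin n) ℝ := LinearMap.toMatrix b b A with hS
  have hSa : ∀ l i, A (EuclideanSpace.single i 1) l = S l i := by
    intro l i; simp [hS, b, LinearMap.toMatrix_apply]
  set G := gramCoord F x with hG
  have hGu := h.isUnit_det_gramCoord hx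
  -- Lowering an index of the shape operator gives the second fundamental form, so that all
  -- contractions below become matrix traces.
  have hII : ∀ j k, ⟪fderiv ℝ (coordVec F k) x (EuclideanSpace.single j 1), N x⟫_ℝ = (G * S) k j := by
    intro j k
    have := h.inner_fderiv_fderiv_normal hx (EuclideanSpace.single j 1) (EuclideanSpace.single k 1)
    change ⟪fderiv ℝ (coordVec F k) x (EuclideanSpace.single j 1), N x⟫_ℝ = _ at this
    rw [this, ← inner_neg_right, ← hA, map_eq_sum_coordVec F x (A _), inner_sum, Matrix.mul_apply]
    refine sum_congr rfl fun l _ => ?_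
    rw [inner_smul_right, hSa, mul_comm]
    rfl
  have hric : ∀ j k, ricciCoeff (gramCoord F) j k x
      = (G * S) k j * S.trace - (G * S * S) k j + (n - 1) * G k j := by
    intro j k
    simp only [ricciCoeff, h.riemannCoeff_gramCoord hx A hA, hII, hSa, ← hG, sum_add_distrib,
      sum_sub_distrib, if_true, mul_ite, mul_one, mul_zero, sum_ite_eq', mem_univ, sum_const,
      card_univ, Fintype.card_fin, nsmul_eq_mul]
    rw [← mul_sum, show (G * S * S) k j = ∑ i, (G * S) k i * S i j from Matrix.mul_apply]
    simp only [Matrix.trace, Matrix.diag_apply]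
    ring
  have htr : ∀ M : Matrix (Fin n) (Fin n) ℝ, ∑ j, ∑ k, G⁻¹ j k * (G * M) k j = M.trace := by
    intro M
    have : ∑ j, ∑ k, G⁻¹ j k * (G * M) k j = (G⁻¹ * (G * M)).trace := by
      simp [Matrix.trace, Matrix.mul_apply]
    rw [this, ← Matrix.mul_assoc, Matrix.nonsing_inv_mul _ hGu, Matrix.one_mul]
  have hA1 : LinearMap.trace ℝ _ A = S.trace := LinearMap.trace_eq_matrix_trace ℝ b A
  have hA2 : LinearMap.trace ℝ _ (A * A) = (S * S).trace := by
    rw [LinearMap.trace_eq_matrix_trace ℝ b, LinearMap.toMatrix_mul]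
  rw [hA1, hA2, scalarCurvatureCoord]
  calc ∑ j, ∑ k, G⁻¹ j k * ricciCoeff (gramCoord F) j k x
      = S.trace * ∑ j, ∑ k, G⁻¹ j k * (G * S) k j - ∑ j, ∑ k, G⁻¹ j k * (G * (S * S)) k j
        + (n - 1) * ∑ j, ∑ k, G⁻¹ j k * (G * (1 : Matrix (Fin n) (Fin n) ℝ)) k j := by
        simp only [hric, mul_sum, ← sum_sub_distrib, ← sum_add_distrib]
        refine sum_congr rfl fun j _ => sum_congr rfl fun k _ => ?_
        rw [Matrix.mul_one, Matrix.mul_assoc]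
        ring
    _ = _ := by
        rw [htr, htr, htr, Matrix.trace_one, Fintype.card_fin]
        ring

end IsLocalHypersurface

end SphereHypersurface

end

noncomputable section

open Finset Polynomial

namespace SphereHypersurface

variable {n : ℕ}

/-! ### Smooth principal frames -/

/-- The shape operator of a parametrized hypersurface. -/
def shape (F N : Dom n → Amb n) (x : Dom n) : Module.End ℝ (Dom n) :=
  -((fderiv ℝ F x).toLinearMap.leftInverse ∘ₗ (fderiv ℝ N x).toLinearMap)

/-- Inverse function theorem for P at a noncritical point. V keeps only values whose local preimage
is noncritical, so that L is smooth on all of V. This makes the principal curvatures smooth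
functions of the level c. -/
lemma exists_local_root (P : ℝ[X]) {a : ℝ} (ha : P.derivative.eval a ≠ 0) :
    ∃ (V : Set ℝ) (L : ℝ → ℝ), IsOpen V ∧ P.eval a ∈ V ∧ ContDiffOn ℝ ∞ L V ∧
      (∀ t ∈ V, P.eval (L t) = t) ∧ L (P.eval a) = a := by
  have hP : ContDiff ℝ ∞ fun t => P.eval t := by
    have := P.contDiff_aeval (𝕜 := ℝ) (R := ℝ) ∞
    simp only [coe_aeval_eq_eval] at this
    exact this
  have hd : ∀ t, HasDerivAt (fun t => P.eval t) (P.derivative.eval t) t := P.hasDerivAt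
  let Φ := hP.contDiffAt.toOpenPartialHomeomorph (fun t => P.eval t)
    ((hd a).hasFDerivAt_equiv ha) (by simp)
  have hΦ : ∀ t, Φ t = P.eval t := fun t => rfl
  have hsrc : a ∈ Φ.source :=
    ContDiffAt.mem_toOpenPartialHomeomorph_source hP.contDiffAt ((hd a).hasFDerivAt_equiv ha) (by simp)
  have htgt : P.eval a ∈ Φ.target := Φ.map_source hsrc
  have hopen : IsOpen (Φ.target ∩ Φ.symm ⁻¹' {t | P.derivative.eval t ≠ 0}) :=
    Φ.continuousOn_symm.isOpen_inter_preimage Φ.open_target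
      (isOpen_ne.preimage P.derivative.continuous)
  have hleft : Φ.symm (P.eval a) = a := Φ.left_inv hsrc
  refine ⟨_, Φ.symm, hopen, ⟨htgt, ?_⟩, ?_, fun t ht => Φ.right_inv ht.1, hleft⟩
  · change P.derivative.eval (Φ.symm (P.eval a)) ≠ 0
    rwa [hleft]
  · intro t ht
    exact (Φ.contDiffAt_symm_deriv ht.2 ht.1 (hd _) hP.contDiffAt).contDiffWithinAt

/-- Two monic polynomials of degree n that agree at n distinct points are equal. -/
lemma charpoly_eq_nodal {A : Module.End ℝ (Dom n)} {v : Fin n → ℝ} (hv : Function.Injective v)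
    (hroot : ∀ i, A.charpoly.eval (v i) = 0) : A.charpoly = Lagrange.nodal univ v := by
  have hdeg : A.charpoly.natDegree = n := by rw [LinearMap.charpoly_natDegree]; simp
  have hd1 : A.charpoly.degree = n := by
    rw [Polynomial.degree_eq_natDegree A.charpoly_monic.ne_zero, hdeg]
  have hd2 : (Lagrange.nodal univ v).degree = n := by simp [Lagrange.degree_nodal]
  refine Polynomial.eq_of_degree_sub_lt_of_eval_index_eq univ hv.injOn ?_ ?_
  · have := Polynomial.degree_sub_lt_left (hd1.trans hd2.symm) A.charpoly_monic.ne_zero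
      (by rw [A.charpoly_monic.leadingCoeff, Lagrange.nodal_monic.leadingCoeff])
    simpa [hd1] using this
  · intro i hi
    rw [hroot, Lagrange.eval_nodal_at_node hi]

/-- The vector `(∏_{k ∈ l} (A - μ_k)) v`. -/
def applyFactors (A : Module.End ℝ (Dom n)) (μ : Fin n → ℝ) : List (Fin n) → Dom n → Dom n
  | [], v => v
  | k :: l, v => A (applyFactors A μ l v) - μ k • applyFactors A μ l v

lemma applyFactors_eq_aeval (A : Module.End ℝ (Dom n)) (μ : Fin n → ℝ) (l : List (Fin n))
    (v : Dom n) :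
    applyFactors A μ l v = aeval A ((l.map fun k => X - C (μ k)).prod) v := by
  induction l with
  | nil => simp [applyFactors]
  | cons k l ih => simp [applyFactors, ih, Module.algebraMap_end_apply]

lemma applyFactors_eigenvector (A : Module.End ℝ (Dom n)) (μ : Fin n → ℝ) (l : List (Fin n))
    {v : Dom n} {a : ℝ} (hv : A v = a • v) :
    applyFactors A μ l v = (l.map fun k => a - μ k).prod • v := by
  induction l with
  | nil => simp [applyFactors]
  | cons k l ih =>
    simp only [applyFactors, ih, map_smul, hv, List.map_cons, List.prod_cons, ← sub_smul, smul_smul]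
    congr 1; ring

namespace IsLocalHypersurface

variable {U : Set (Dom n)} {F N : Dom n → Amb n} (h : IsLocalHypersurface U F N)
include h

lemma mono {V : Set (Dom n)} (hV : IsOpen V) (hVU : V ⊆ U) : IsLocalHypersurface V F N where
  isOpen := hV
  contDiffOn := h.contDiffOn.mono hVU
  contDiffOn_normal := h.contDiffOn_normal.mono hVU
  norm_eq_one x hx := h.norm_eq_one x (hVU hx)
  norm_normal x hx := h.norm_normal x (hVU hx)
  inner_normal x hx := h.inner_normal x (hVU hx)
  inner_normal_fderiv x hx := h.inner_normal_fderiv x (hVU hx)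
  injective_fderiv x hx := h.injective_fderiv x (hVU hx)

lemma fderiv_shape {x : Dom n} (hx : x ∈ U) (v : Dom n) :
    fderiv ℝ F x (shape F N x v) = -fderiv ℝ N x v := by
  obtain ⟨w, hw⟩ := h.exists_shape hx v
  have hker : LinearMap.ker (fderiv ℝ F x).toLinearMap = ⊥ :=
    LinearMap.ker_eq_bot.2 (h.injective_fderiv x hx)
  have : shape F N x v = w := by
    have h1 := LinearMap.leftInverse_apply_of_inj hker w
    rw [ContinuousLinearMap.coe_coe, hw, map_neg] at h1
    simpa [shape] using h1
  rw [this, hw]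

lemma shape_single_apply {x : Dom n} (hx : x ∈ U) (i k : Fin n) :
    shape F N x (EuclideanSpace.single i 1) k
      = ∑ l, (gramCoord F x)⁻¹ k l
        * -⟪coordVec F l x, fderiv ℝ N x (EuclideanSpace.single i 1)⟫_ℝ := by
  have h1 : (fun l => -⟪coordVec F l x, fderiv ℝ N x (EuclideanSpace.single i 1)⟫_ℝ)
      = (gramCoord F x).mulVec fun m => shape F N x (EuclideanSpace.single i 1) m := by
    ext l
    rw [← inner_neg_right, ← h.fderiv_shape hx, map_eq_sum_coordVec F x (shape _ _ _ _), inner_sum]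
    simp only [inner_smul_right, Matrix.mulVec, dotProduct, gramCoord, Matrix.of_apply]
    exact sum_congr rfl fun m _ => mul_comm _ _
  have h2 := congrArg (fun u => (gramCoord F x)⁻¹.mulVec u k) h1
  simp only [Matrix.mulVec_mulVec, Matrix.nonsing_inv_mul _ (h.isUnit_det_gramCoord hx),
    Matrix.one_mulVec] at h2
  exact h2.symm

lemma contDiffOn_shape_single (i k : Fin n) :
    ContDiffOn ℝ ∞ (fun x => shape F N x (EuclideanSpace.single i 1) k) U := by
  refine ContDiffOn.congr ?_ fun x hx => h.shape_single_apply hx i k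
  refine ContDiffOn.sum fun l _ => (h.contDiffOn_inv_gramCoord k l).mul ?_
  exact ((h.contDiffOn_coordVec l).inner ℝ
    (contDiffOn_fderiv_apply h.isOpen h.contDiffOn_normal contDiffOn_const)).neg

lemma contDiffOn_shape_apply {V : Set (Dom n)} (hVU : V ⊆ U) {v : Dom n → Dom n}
    (hv : ContDiffOn ℝ ∞ v V) : ContDiffOn ℝ ∞ (fun x => shape F N x (v x)) V := by
  rw [contDiffOn_euclidean]
  intro k
  have : (fun x => shape F N x (v x) k)
      = fun x => ∑ i, v x i * shape F N x (EuclideanSpace.single i 1) k := by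
    ext x
    have hv : v x = ∑ i, v x i • EuclideanSpace.single i (1 : ℝ) := by
      have := (EuclideanSpace.basisFun (Fin n) ℝ).sum_repr (v x)
      simpa using this.symm
    conv_lhs => rw [hv]
    simp
  rw [this]
  refine ContDiffOn.sum fun i _ => ContDiffOn.mul ?_ ((h.contDiffOn_shape_single i k).mono hVU)
  exact (contDiffOn_euclidean.1 hv) i

lemma contDiffOn_applyFactors {V : Set (Dom n)} (hVU : V ⊆ U) {μ : Fin n → Dom n → ℝ}
    (hμ : ∀ i, ContDiffOn ℝ ∞ (μ i) V) (l : List (Fin n)) (v : Dom n) :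
    ContDiffOn ℝ ∞ (fun x => applyFactors (shape F N x) (fun k => μ k x) l v) V := by
  induction l with
  | nil => exact contDiffOn_const
  | cons k l ih => exact (h.contDiffOn_shape_apply hVU ih).sub ((hμ k).smul ih)

lemma contDiffOn_det_shape : ContDiffOn ℝ ∞ (fun x => LinearMap.det (shape F N x)) U := by
  have : ∀ x, LinearMap.det (shape F N x)
      = (Matrix.of fun k i => shape F N x (EuclideanSpace.single i 1) k).det := by
    intro x
    rw [← LinearMap.det_toMatrix (EuclideanSpace.basisFun (Fin n) ℝ).toBasis]
    congr 1
  simp only [this, Matrix.det_apply, Matrix.of_apply]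
  exact ContDiffOn.sum fun σ _ => ContDiffOn.const_smul _
    (contDiffOn_prod fun i _ => h.contDiffOn_shape_single _ _)

/-- Near a point with `n` distinct principal curvatures there is a smooth principal frame. -/
theorem exists_principalFrame {P : ℝ[X]} {c : Dom n → ℝ} (hc : ContDiffOn ℝ ∞ c U)
    (hP : ∀ x ∈ U, (shape F N x).charpoly = P - C (c x)) {x₀ : Dom n} (hx₀ : x₀ ∈ U)
    {μ : Fin n → ℝ} (hμ : Function.Injective μ)
    (hroot : (shape F N x₀).charpoly = Lagrange.nodal univ μ) :
    ∃ (V : Set (Dom n)) (e : Fin n → Dom n → Dom n) (lam : Fin n → Dom n → ℝ),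
      V ⊆ U ∧ x₀ ∈ V ∧ IsPrincipalFrame V F N e lam ∧
      (∀ x ∈ V, Function.Injective fun i => lam i x) ∧
      (∀ x ∈ V, P - C (c x) = Lagrange.nodal univ fun i => lam i x) ∧
      (∀ x ∈ V, ∀ i, shape F N x (e i x) = lam i x • e i x) := by
  have hPμ : P - C (c x₀) = Lagrange.nodal univ μ := by rw [← hP x₀ hx₀, hroot]
  have hev : ∀ i, P.eval (μ i) = c x₀ := by
    intro i
    have := congrArg (eval (μ i)) hPμ
    rw [Lagrange.eval_nodal_at_node (mem_univ i)] at this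
    simp at this
    linarith
  have hder : ∀ i, P.derivative.eval (μ i) ≠ 0 := by
    intro i
    have := congrArg derivative hPμ
    simp at this
    rw [this]
    exact eval_derivative_nodal_ne_zero hμ i
  choose V L hVo hVc hL hLP hL0 using fun i => exists_local_root P (hder i)
  simp only [hev] at hVc hL0
  -- eigenvectors at the base point
  have heig : ∀ i, ∃ v : Dom n, v ≠ 0 ∧ shape F N x₀ v = μ i • v := by
    intro i
    have : (shape F N x₀).HasEigenvalue (μ i) := by
      rw [Module.End.hasEigenvalue_iff_isRoot_charpoly, hroot]
      exact Lagrange.eval_nodal_at_node (mem_univ i)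
    obtain ⟨v, hv⟩ := this.exists_hasEigenvector
    exact ⟨v, hv.2, hv.apply_eq_smul⟩
  choose v₀ hv₀ hAv₀ using heig
  let U₁ : Set (Dom n) := U ∩ c ⁻¹' (⋂ i, V i)
  have hU₁o : IsOpen U₁ := hc.continuousOn.isOpen_inter_preimage h.isOpen (isOpen_iInter_of_finite hVo)
  have hU₁ : U₁ ⊆ U := Set.inter_subset_left
  have hU₁V : ∀ x ∈ U₁, ∀ i, c x ∈ V i := fun x hx i => Set.mem_iInter.1 hx.2 i
  let lam : Fin n → Dom n → ℝ := fun i x => L i (c x)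
  have hlam : ∀ i, ContDiffOn ℝ ∞ (lam i) U₁ := fun i =>
    (hL i).comp (hc.mono hU₁) fun x hx => hU₁V x hx i
  -- By Cayley–Hamilton the product of the A - lam k over k ≠ i maps every vector into the
  -- eigenspace of lam i. Applied to a fixed vector it is smooth in x, and at x₀ it multiplies the
  -- eigenvector `v₀ i` by a nonzero scalar.
  let u : Fin n → Dom n → Dom n := fun i x =>
    applyFactors (shape F N x) (fun k => lam k x) (univ.erase i).toList (v₀ i)
  have hu : ∀ i, ContDiffOn ℝ ∞ (u i) U₁ := fun i =>
    h.contDiffOn_applyFactors hU₁ hlam _ _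
  have hlam₀ : ∀ i, lam i x₀ = μ i := hL0
  have hx₀₁ : x₀ ∈ U₁ := ⟨hx₀, Set.mem_iInter.2 hVc⟩
  have hu₀ : ∀ i, u i x₀ ≠ 0 := by
    intro i
    simp only [u, hlam₀]
    rw [applyFactors_eigenvector _ _ _ (hAv₀ i)]
    refine smul_ne_zero ?_ (hv₀ i)
    rw [Finset.prod_map_toList, prod_ne_zero_iff]
    intro k hk h0
    exact ne_of_mem_erase hk (hμ (sub_eq_zero.1 h0)).symm
  have hevt : ∀ᶠ x in nhds x₀, x ∈ U₁ ∧ (∀ i j, i ≠ j → lam i x ≠ lam j x) ∧ ∀ i, u i x ≠ 0 := by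
    refine Filter.Eventually.and (hU₁o.mem_nhds hx₀₁) (Filter.Eventually.and ?_ ?_)
    · rw [Filter.eventually_all]; intro i
      rw [Filter.eventually_all]; intro j
      rw [Filter.eventually_imp_distrib_left]; intro hij
      have hd := ((hlam i).sub (hlam j)).continuousOn.continuousAt (hU₁o.mem_nhds hx₀₁)
      refine (hd.eventually_ne (y := 0) ?_).mono fun x hx => sub_ne_zero.1 hx
      rw [hlam₀, hlam₀]
      exact sub_ne_zero.2 fun hh => hij (hμ hh)
    · rw [Filter.eventually_all]; intro i
      exact ((hu i).continuousOn.continuousAt (hU₁o.mem_nhds hx₀₁)).eventually_ne (hu₀ i)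
  obtain ⟨W, hW, hWo, hxW⟩ := mem_nhds_iff.1 hevt
  have hWU : W ⊆ U := fun x hx => hU₁ (hW hx).1
  have hWU₁ : W ⊆ U₁ := fun x hx => (hW hx).1
  have hinj : ∀ x ∈ W, Function.Injective fun i => lam i x := by
    intro x hx i j hij
    by_contra hne
    exact (hW hx).2.1 i j hne hij
  have hchar : ∀ x ∈ W, (shape F N x).charpoly = Lagrange.nodal univ fun i => lam i x := by
    intro x hx
    refine charpoly_eq_nodal (hinj x hx) fun i => ?_
    rw [hP x (hWU hx)]
    simp [lam, hLP i _ (hU₁V x (hWU₁ hx) i)]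
  have hAu : ∀ x ∈ W, ∀ i, shape F N x (u i x) = lam i x • u i x := by
    intro x hx i
    have hCH := LinearMap.aeval_self_charpoly (shape F N x)
    rw [hchar x hx, nodal_univ_eq _ i] at hCH
    have := LinearMap.congr_fun hCH (v₀ i)
    have hprod : (((univ.erase i).toList.map fun k => X - C (lam k x)).prod)
        = Lagrange.nodal (univ.erase i) fun i => lam i x := by
      rw [Finset.prod_map_toList]; rfl
    rw [map_mul, Module.End.mul_apply, ← hprod, ← applyFactors_eq_aeval] at this
    simpa [sub_eq_zero, Module.algebraMap_end_apply] using this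
  have hFu : ∀ x ∈ W, ∀ i, ‖fderiv ℝ F x (u i x)‖ ≠ 0 := by
    intro x hx i h0
    exact (hW hx).2.2 i (h.injective_fderiv x (hWU hx) (by rw [norm_eq_zero.1 h0, map_zero]))
  let e : Fin n → Dom n → Dom n := fun i x => ‖fderiv ℝ F x (u i x)‖⁻¹ • u i x
  have hAe : ∀ x ∈ W, ∀ i, shape F N x (e i x) = lam i x • e i x := by
    intro x hx i
    simp only [e, map_smul, hAu x hx i]
    rw [smul_comm]
  have hNe : ∀ x ∈ W, ∀ i, fderiv ℝ N x (e i x) = -(lam i x • fderiv ℝ F x (e i x)) := by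
    intro x hx i
    have := h.fderiv_shape (hWU hx) (e i x)
    rw [hAe x hx, map_smul] at this
    rw [this, neg_neg]
  refine ⟨W, e, lam, hWU, hxW, ⟨h.mono hWo hWU, fun i => ?_, fun i => (hlam i).mono hWU₁, ?_, hNe⟩,
    hinj, fun x hx => by rw [← hchar x hx, hP x (hWU hx)], hAe⟩
  · refine ContDiffOn.smul ((ContDiffOn.norm ℝ ?_ fun x hx => norm_ne_zero_iff.1 (hFu x hx i)).inv
      fun x hx => hFu x hx i) ((hu i).mono hWU₁)
    exact contDiffOn_fderiv_apply hWo (h.contDiffOn.mono hWU) ((hu i).mono hWU₁)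
  · intro x hx i j
    by_cases hij : i = j
    · subst hij
      have := hFu x hx i
      have : ‖fderiv ℝ F x (e i x)‖ = 1 := by
        simp only [e, map_smul, norm_smul, norm_inv, norm_norm]
        exact inv_mul_cancel₀ this
      rw [real_inner_self_eq_norm_sq, this]
      simp
    · rw [if_neg hij]
      have hs := h.shape_symm (hWU hx) (e i x) (e j x)
      rw [hNe x hx, hNe x hx, inner_neg_right, inner_neg_right, inner_smul_right, inner_smul_right,
        real_inner_comm] at hs
      have hd : lam i x - lam j x ≠ 0 := sub_ne_zero.2 fun hh => hij (hinj x hx hh)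
      have : (lam i x - lam j x) * ⟪fderiv ℝ F x (e i x), fderiv ℝ F x (e j x)⟫_ℝ = 0 := by linarith
      exact (mul_eq_zero.1 this).resolve_left hd

end IsLocalHypersurface

end SphereHypersurface

end

noncomputable section

open Finset Polynomial

namespace SphereHypersurface

variable {n : ℕ}

/-! ### Frames with one free principal curvature function -/

/-- The coefficient `P'' / (2 P'^2)`. -/
def accelCoeff (P : ℝ[X]) (t : ℝ) : ℝ :=
  P.derivative.derivative.eval t / (2 * P.derivative.eval t ^ 2)

/-- The coefficient of `(dc(e))^2` in the scalar curvature, for an eigenvector `e` with eigenvalue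
`t` of an operator with eigenvalues `μ`. -/
def quadCoeff (P : ℝ[X]) (μ : Fin n → ℝ) (t : ℝ) : ℝ :=
  accelCoeff P t ^ 2
    - ∑ i, if μ i = t then 0 else ((P.derivative.eval (μ i) * (μ i - t))⁻¹) ^ 2

/-- The scalar curvature of a hypersurface of the unit sphere with principal curvatures `μ`. -/
def gaussScalar (μ : Fin n → ℝ) : ℝ := ∑ i, ∑ j, if i = j then 0 else 1 + μ i * μ j

lemma gaussScalar_eq (μ : Fin n → ℝ) :
    gaussScalar μ = n * (n - 1) + (∑ i, μ i) ^ 2 - ∑ i, μ i ^ 2 := by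
  have : ∀ i j, (if i = j then 0 else 1 + μ i * μ j)
      = (1 + μ i * μ j) - if i = j then 1 + μ i * μ j else 0 := by
    intro i j; split_ifs <;> ring
  simp only [gaussScalar, this, sum_sub_distrib, sum_add_distrib, sum_ite_eq, mem_univ, if_true,
    sum_const, card_univ, Fintype.card_fin, nsmul_eq_mul, sq, sum_mul_sum]
  ring

lemma derivative_eq_of_sub_C {P Q : ℝ[X]} {c : ℝ} (h : P - C c = Q) :
    P.derivative = Q.derivative := by
  rw [← h]; simp

lemma quadCoeff_neg {P : ℝ[X]} {c : ℝ} {μ : Fin n → ℝ} (hμ : Function.Injective μ) (hn : 3 ≤ n)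
    (hP : P - C c = Lagrange.nodal univ μ) (j : Fin n) : quadCoeff P μ (μ j) < 0 := by
  have := sq_lt_sum_inv_derivative hμ hn j
  rw [quadCoeff, accelCoeff, derivative_eq_of_sub_C hP, sub_neg]
  refine this.trans_eq ?_
  rw [← add_sum_erase univ _ (mem_univ j)]
  simp only [if_true, zero_add]
  refine sum_congr rfl fun i hi => ?_
  rw [if_neg fun h => ne_of_mem_erase hi (hμ h)]

/-- A principal frame of a hypersurface whose shape operator has characteristic polynomial
`P - c`, with simple roots. -/
structure IsLevelFrame (U : Set (Dom n)) (F N : Dom n → Amb n) (e : Fin n → Dom n → Dom n)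
    (lam : Fin n → Dom n → ℝ) (P : ℝ[X]) (c : Dom n → ℝ) : Prop
    extends IsPrincipalFrame U F N e lam where
  contDiffOn_level : ContDiffOn ℝ ∞ c U
  injective : ∀ x ∈ U, Function.Injective fun i => lam i x
  eq_nodal : ∀ x ∈ U, P - C (c x) = Lagrange.nodal univ fun i => lam i x

namespace IsLevelFrame

variable {U : Set (Dom n)} {F N : Dom n → Amb n} {e : Fin n → Dom n → Dom n}
  {lam : Fin n → Dom n → ℝ} {P : ℝ[X]} {c : Dom n → ℝ} (h : IsLevelFrame U F N e lam P c)
include h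

lemma eval_curvature {x : Dom n} (hx : x ∈ U) (i : Fin n) : P.eval (lam i x) = c x := by
  have := congrArg (eval (lam i x)) (h.eq_nodal x hx)
  rw [Lagrange.eval_nodal_at_node (v := fun i => lam i x) (mem_univ i)] at this
  simp at this
  linarith

lemma eval_derivative_ne_zero {x : Dom n} (hx : x ∈ U) (i : Fin n) :
    P.derivative.eval (lam i x) ≠ 0 := by
  rw [derivative_eq_of_sub_C (h.eq_nodal x hx)]
  exact eval_derivative_nodal_ne_zero (h.injective x hx) i

/-- Differentiate P(lam i) = c: all derivatives of the curvatures come from the single function c.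
-/
lemma fderiv_curvature_eq {x : Dom n} (hx : x ∈ U) (i : Fin n) (v : Dom n) :
    fderiv ℝ (lam i) x v = fderiv ℝ c x v / P.derivative.eval (lam i x) := by
  have hd := (differentiableAt_of_contDiffOn h.isOpen (h.contDiffOn_curvature i) hx).hasFDerivAt
  have h1 := (P.hasDerivAt (lam i x)).comp_hasFDerivAt x hd
  have h2 : (fun y => P.eval (lam i y)) =ᶠ[nhds x] c :=
    Filter.eventually_of_mem (h.isOpen.mem_nhds hx) fun y hy => h.eval_curvature hy i
  have h3 : fderiv ℝ c x = P.derivative.eval (lam i x) • fderiv ℝ (lam i) x := by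
    rw [← h2.fderiv_eq]; exact h1.fderiv
  rw [h3, _root_.smul_apply, smul_eq_mul, mul_div_cancel_left₀ _ (h.eval_derivative_ne_zero hx i)]

/-- Codazzi relates e_j(lam i) to this coefficient, while e_j(lam i) = e_j(c)/P'(lam i). -/
lemma conn_eq {x : Dom n} (hx : x ∈ U) {i j : Fin n} (hij : i ≠ j) :
    conn F e i i j x
      = (P.derivative.eval (lam i x) * (lam i x - lam j x))⁻¹ * fderiv ℝ c x (e j x) := by
  have h1 := h.fderiv_curvature hx hij
  rw [h.fderiv_curvature_eq hx] at h1
  have hd : lam i x - lam j x ≠ 0 := sub_ne_zero.2 fun hh => hij (h.injective x hx hh)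
  have hp := h.eval_derivative_ne_zero hx i
  field_simp at h1 ⊢
  linarith

lemma conn_self {x : Dom n} (hx : x ∈ U) (i j : Fin n) : conn F e i j j x = 0 := by
  linarith [h.conn_antisymm hx i j j]

lemma accel_eq {x : Dom n} (hx : x ∈ U) (hn : 2 ≤ n) (j : Fin n) :
    accel F e j x = accelCoeff P (lam j x) * fderiv ℝ c x (e j x) := by
  rw [accel, ← add_sum_erase univ _ (mem_univ j), h.conn_self hx, zero_add,
    sum_congr rfl fun i hi => h.conn_eq hx (ne_of_mem_erase hi), ← sum_mul, accelCoeff,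
    derivative_eq_of_sub_C (h.eq_nodal x hx)]
  rw [sum_inv_derivative_mul_sub (h.injective x hx) hn j]

lemma sum_conn_sq {x : Dom n} (hx : x ∈ U) (j : Fin n) :
    ∑ i, conn F e i i j x ^ 2
      = (∑ i, if lam i x = lam j x then 0
          else ((P.derivative.eval (lam i x) * (lam i x - lam j x))⁻¹) ^ 2)
        * fderiv ℝ c x (e j x) ^ 2 := by
  rw [sum_mul]
  refine sum_congr rfl fun i _ => ?_
  by_cases hij : i = j
  · subst hij; simp [h.conn_self hx]
  · rw [if_neg fun hh => hij (h.injective x hx hh), h.conn_eq hx hij, mul_pow]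

/-- The scalar curvature in terms of the derivatives of the level function `c`. -/
lemma gaussScalar_curvature_eq {x : Dom n} (hx : x ∈ U) (hn : 2 ≤ n) :
    gaussScalar (fun i => lam i x)
      = 2 * (∑ i, fderiv ℝ (accel F e i) x (e i x) - ∑ k, accel F e k x ^ 2)
        + ∑ j, quadCoeff P (fun i => lam i x) (lam j x) * fderiv ℝ c x (e j x) ^ 2 := by
  have h1 := h.two_mul_sum_fderiv_accel hx
  -- Writing -|X|² as -2|X|² + |X|² completes twice the divergence of X; the spare square and the
  -- sum of squared coefficients form `quadCoeff`.
  rw [h.sum_conn_mul_conn hx (h.injective x hx), sum_comm] at h1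
  rw [gaussScalar, ← h1]
  simp only [h.sum_conn_sq hx, quadCoeff, sub_mul, sum_sub_distrib]
  have h2 : ∑ k, accel F e k x ^ 2
      = ∑ k, accelCoeff P (lam k x) ^ 2 * fderiv ℝ c x (e k x) ^ 2 :=
    sum_congr rfl fun k _ => by rw [h.accel_eq hx hn, mul_pow]
  rw [← h2]
  ring

/-- The vector field `φ ∑_i ∇_{e_i} e_i` in terms of the level function. -/
def field (e : Fin n → Dom n → Dom n) (lam : Fin n → Dom n → ℝ) (P : ℝ[X]) (c φ : Dom n → ℝ)
    (y : Dom n) : Dom n :=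
  ∑ j, (φ y * (accelCoeff P (lam j y) * fderiv ℝ c y (e j y))) • e j y

omit h in
lemma contDiffOn_accelCoeff {lam : Dom n → ℝ} (hlam : ContDiffOn ℝ ∞ lam U)
    (h0 : ∀ x ∈ U, P.derivative.eval (lam x) ≠ 0) :
    ContDiffOn ℝ ∞ (fun y => accelCoeff P (lam y)) U := by
  have hP : ∀ Q : ℝ[X], ContDiffOn ℝ ∞ (fun y => Q.eval (lam y)) U := by
    intro Q
    have hQ : ContDiff ℝ ∞ fun t => Q.eval t := by
      have := Q.contDiff_aeval (𝕜 := ℝ) (R := ℝ) ∞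
      simp only [coe_aeval_eq_eval] at this
      exact this
    exact hQ.comp_contDiffOn hlam
  unfold accelCoeff
  refine (hP _).div (contDiffOn_const.mul ((hP _).pow 2)) fun x hx => ?_
  exact mul_ne_zero two_ne_zero (pow_ne_zero 2 (h0 x hx))

lemma contDiffOn_density_smul_field {k : ℕ∞} {φ : Dom n → ℝ} (hφ : ContDiffOn ℝ k φ U) :
    ContDiffOn ℝ k (fun y => density (fderiv ℝ F y) • field e lam P c φ y) U := by
  have hk : ((k : ℕ∞) : WithTop ℕ∞) ≤ ∞ := WithTop.coe_le_coe.2 le_top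
  refine (h.contDiffOn_density.of_le hk).smul (ContDiffOn.sum fun j _ => ?_)
  have hj : ContDiffOn ℝ k (fun y => φ y * (accelCoeff P (lam j y) * fderiv ℝ c y (e j y))) U :=
    hφ.mul (ContDiffOn.of_le ((contDiffOn_accelCoeff (h.contDiffOn_curvature j)
      fun x hx => h.eval_derivative_ne_zero hx j).mul
      (contDiffOn_fderiv_apply h.isOpen h.contDiffOn_level (h.contDiffOn_frame j))) hk)
  exact hj.smul ((h.contDiffOn_frame j).of_le hk)

/-- The rule div(φX) = dφ(X) + φ div X, with div X eliminated through the scalar curvature formula,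
so that only first derivatives of c remain. -/
lemma divergence_field {x : Dom n} (hx : x ∈ U) (hn : 2 ≤ n) {φ : Dom n → ℝ}
    (hφ : DifferentiableAt ℝ φ x) :
    divergence (fun y => density (fderiv ℝ F y) • field e lam P c φ y) x
      = density (fderiv ℝ F x)
        * (∑ j, fderiv ℝ φ x (e j x) * (accelCoeff P (lam j x) * fderiv ℝ c x (e j x))
          + φ x / 2 * (gaussScalar (fun i => lam i x)
            - ∑ j, quadCoeff P (fun i => lam i x) (lam j x) * fderiv ℝ c x (e j x) ^ 2)) := by
  have hev : (fun y => density (fderiv ℝ F y) • field e lam P c φ y) =ᶠ[nhds x]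
      fun y => density (fderiv ℝ F y) • ∑ j, (φ y * accel F e j y) • e j y :=
    Filter.eventually_of_mem (h.isOpen.mem_nhds hx) fun y hy => by
      simp only [field, h.accel_eq hy hn]
  have ha := fun i => differentiableAt_of_contDiffOn h.isOpen (h.contDiffOn_accel i) hx
  rw [divergence, hev.fderiv_eq, ← divergence, h.divergence_density_smul hx
    (v := fun j y => φ y * accel F e j y) (fun i => hφ.mul (ha i))]
  rw [h.gaussScalar_curvature_eq hx hn]
  simp only [fun i => fderiv_fun_mul hφ (ha i), _root_.add_apply, _root_.smul_apply, smul_eq_mul,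
    ← h.accel_eq hx hn, sum_add_distrib, mul_assoc, ← mul_sum, ← sq]
  congr 1
  have : ∑ i, accel F e i x * fderiv ℝ φ x (e i x) = ∑ i, fderiv ℝ φ x (e i x) * accel F e i x :=
    sum_congr rfl fun i _ => mul_comm _ _
  rw [this]
  ring

/-- If the principal curvatures are distinct and constant, the scalar curvature vanishes. -/
lemma gaussScalar_eq_zero {x : Dom n} (hx : x ∈ U) (hn : 2 ≤ n) (hc : ∀ y ∈ U, fderiv ℝ c y = 0) :
    gaussScalar (fun i => lam i x) = 0 := by
  rw [h.gaussScalar_curvature_eq hx hn]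
  have h0 : ∀ k, ∀ y ∈ U, accel F e k y = 0 := fun k y hy => by
    rw [h.accel_eq hy hn, hc y hy]; simp
  have h1 : ∀ k, fderiv ℝ (accel F e k) x = 0 := fun k => by
    have : accel F e k =ᶠ[nhds x] fun _ => 0 :=
      Filter.eventually_of_mem (h.isOpen.mem_nhds hx) (h0 k)
    rw [this.fderiv_eq]; simp
  simp [h0 _ x hx, h1, hc x hx]

end IsLevelFrame

end SphereHypersurface

end

noncomputable section

open Finset Polynomial

namespace SphereHypersurface

variable {n : ℕ}

/-! ### Charts -/

section Charts

variable {M : Type*} [TopologicalSpace M] [ChartedSpace (EuclideanSpace ℝ (Fin n)) M]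
variable {V : Type*} [NormedAddCommGroup V] [NormedSpace ℝ V]

/-- The differential at `q` of the preferred chart at `p`. -/
def chartDeriv (p q : M) : Dom n →L[ℝ] Dom n :=
  mfderiv (𝓡 n) 𝓘(ℝ, Dom n) (extChartAt (𝓡 n) p) q

/-- The differential of a map into a vector space. -/
def diffAt (u : M → V) (q : M) : Dom n →L[ℝ] V := mfderiv (𝓡 n) 𝓘(ℝ, V) u q

variable [IsManifold (𝓡 n) ∞ M]

lemma contDiffOn_comp_chart_symm {u : M → V} (hu : ContMDiff (𝓡 n) 𝓘(ℝ, V) ∞ u) (p : M) :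
    ContDiffOn ℝ ∞ (u ∘ (extChartAt (𝓡 n) p).symm) (extChartAt (𝓡 n) p).target :=
  contMDiffOn_iff_contDiffOn.1 (hu.comp_contMDiffOn (contMDiffOn_extChartAt_symm p))

lemma isManifold_one (M : Type*) [TopologicalSpace M] [ChartedSpace (EuclideanSpace ℝ (Fin n)) M]
    [IsManifold (𝓡 n) ∞ M] : IsManifold (𝓡 n) 1 M :=
  IsManifold.of_le (n := ∞) (by simp)

/-- Chain rule for u, written near q as its chart expression composed with the chart. -/
lemma diffAt_eq {u : M → V} {p q : M} (hq : q ∈ (extChartAt (𝓡 n) p).source)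
    (hu : MDifferentiableAt (𝓡 n) 𝓘(ℝ, V) u q) :
    diffAt u q = (fderiv ℝ (u ∘ (extChartAt (𝓡 n) p).symm) (extChartAt (𝓡 n) p q)).comp
      (chartDeriv p q) := by
  have := isManifold_one (n := n) M
  have hq' : q ∈ (chartAt (EuclideanSpace ℝ (Fin n)) p).source := by
    rwa [← extChartAt_source (I := 𝓡 n)]
  have ht := (extChartAt (𝓡 n) p).map_source hq
  have hleft := (extChartAt (𝓡 n) p).left_inv hq
  have hsymm : MDifferentiableAt 𝓘(ℝ, Dom n) (𝓡 n) (extChartAt (𝓡 n) p).symm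
      (extChartAt (𝓡 n) p q) := by
    have := mdifferentiableWithinAt_extChartAt_symm (I := 𝓡 n) ht
    rwa [ModelWithCorners.range_eq_univ, mdifferentiableWithinAt_univ] at this
  have hcomp : MDifferentiableAt 𝓘(ℝ, Dom n) 𝓘(ℝ, V) (u ∘ (extChartAt (𝓡 n) p).symm)
      (extChartAt (𝓡 n) p q) := MDifferentiableAt.comp _ (by rwa [hleft]) hsymm
  have h1 := mfderiv_comp (I := 𝓡 n) (I' := 𝓘(ℝ, Dom n)) (I'' := 𝓘(ℝ, V)) q hcomp
    (mdifferentiableAt_extChartAt hq')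
  have h2 : (u ∘ (extChartAt (𝓡 n) p).symm) ∘ extChartAt (𝓡 n) p =ᶠ[nhds q] u := by
    filter_upwards [extChartAt_source_mem_nhds' hq] with z hz
    change u ((extChartAt (𝓡 n) p).symm (extChartAt (𝓡 n) p z)) = u z
    rw [(extChartAt (𝓡 n) p).left_inv hz]
  rw [h2.mfderiv_eq, mfderiv_eq_fderiv] at h1
  exact h1

lemma chartDeriv_eq {p p' q : M} (hq : q ∈ (extChartAt (𝓡 n) p).source)
    (hq' : q ∈ (extChartAt (𝓡 n) p').source) :
    chartDeriv p' q
      = (fderiv ℝ (extChartAt (𝓡 n) p' ∘ (extChartAt (𝓡 n) p).symm) (extChartAt (𝓡 n) p q)).comp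
        (chartDeriv p q) := by
  have := isManifold_one (n := n) M
  exact diffAt_eq (u := extChartAt (𝓡 n) p') hq
    (mdifferentiableAt_extChartAt (by rwa [← extChartAt_source (I := 𝓡 n)]))

lemma bijective_chartDeriv {p q : M} (hq : q ∈ (extChartAt (𝓡 n) p).source) :
    Function.Bijective (chartDeriv (n := n) p q) := by
  have := isManifold_one (n := n) M
  obtain ⟨e, he⟩ := isInvertible_mfderiv_extChartAt (I := 𝓡 n) hq
  have : (chartDeriv (n := n) p q : Dom n → Dom n) = e :=
    congrArg (fun A : TangentSpace (𝓡 n) q →L[ℝ] TangentSpace 𝓘(ℝ, Dom n) (extChartAt (𝓡 n) p q) =>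
      (A : Dom n → Dom n)) he.symm
  rw [this]
  exact e.bijective

lemma chartDeriv_self (p : M) : chartDeriv (n := n) p p = ContinuousLinearMap.id ℝ (Dom n) := by
  have := isManifold_one (n := n) M
  exact mfderiv_extChartAt_self

end Charts

section Hypersurface

variable {M : Type*} [TopologicalSpace M] [ChartedSpace (EuclideanSpace ℝ (Fin n)) M]
  [IsManifold (𝓡 n) ∞ M] {f : M → UnitSphere n}
  {ν : M → EuclideanSpace ℝ (Fin (n + 1 + 1))}

/-- The position vector in the preferred chart at `p`. -/
def chartPos (f : M → UnitSphere n) (p : M) : Dom n → Amb n :=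
  position f ∘ (extChartAt (𝓡 n) p).symm

/-- The unit normal field in the preferred chart at `p`. -/
def chartNormal (ν : M → EuclideanSpace ℝ (Fin (n + 1 + 1))) (p : M) : Dom n → Amb n :=
  ν ∘ (extChartAt (𝓡 n) p).symm

open scoped EuclideanSpace in
omit [IsManifold (𝓡 n) ∞ M] in
lemma IsHypersurface.contMDiff_position (hf : IsHypersurface f) :
    ContMDiff (𝓡 n) 𝓘(ℝ, Amb n) ∞ (position f) :=
  (contMDiff_coe_sphere (E := Amb n) (n := n + 1)).comp hf.contMDiff

open scoped EuclideanSpace in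
omit [IsManifold (𝓡 n) ∞ M] in
lemma IsHypersurface.injective_diffAt (hf : IsHypersurface f) (q : M) :
    Function.Injective (diffAt (n := n) (position f) q) := by
  have h : diffAt (n := n) (position f) q
      = (mfderiv (𝓡 (n + 1)) 𝓘(ℝ, Amb n) ((↑) : UnitSphere n → Amb n) (f q)).comp
        (mfderiv (𝓡 n) (𝓡 (n + 1)) f q) :=
    mfderiv_comp (I := 𝓡 n) (I' := 𝓡 (n + 1)) (I'' := 𝓘(ℝ, Amb n)) q
      ((contMDiff_coe_sphere (E := Amb n) (n := n + 1) (m := 1)).mdifferentiableAt (by simp))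
      (hf.contMDiff.mdifferentiableAt (by simp))
  rw [h]
  exact (injective_mvfderiv_subtypeVal_sphere (E := Amb n) (n := n + 1) (f q)).comp (hf.injective_mfderiv q)

lemma diffAt_chart {V : Type*} [NormedAddCommGroup V] [NormedSpace ℝ V] {u : M → V}
    (hu : ContMDiff (𝓡 n) 𝓘(ℝ, V) ∞ u) {p q : M}
    (hq : q ∈ (extChartAt (𝓡 n) p).source) (v : Dom n) :
    fderiv ℝ (u ∘ (extChartAt (𝓡 n) p).symm) (extChartAt (𝓡 n) p q) (chartDeriv p q v)
      = diffAt u q v := by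
  rw [diffAt_eq hq (hu.mdifferentiableAt (by simp))]
  rfl

/-- A hypersurface in a chart is a local hypersurface. -/
lemma IsHypersurface.isLocalHypersurface (hf : IsHypersurface f) (hν : IsUnitNormal f ν) (p : M) :
    IsLocalHypersurface (extChartAt (𝓡 n) p).target (chartPos f p) (chartNormal ν p) where
  isOpen := isOpen_extChartAt_target p
  contDiffOn := contDiffOn_comp_chart_symm hf.contMDiff_position p
  contDiffOn_normal := contDiffOn_comp_chart_symm hν.contMDiff p
  norm_eq_one x hx := by simp [chartPos, position]
  norm_normal x hx := hν.norm_eq_one _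
  inner_normal x hx := hν.inner_position _
  inner_normal_fderiv x hx v := by
    set q := (extChartAt (𝓡 n) p).symm x with hq
    have hqs : q ∈ (extChartAt (𝓡 n) p).source := (extChartAt (𝓡 n) p).map_target hx
    have hxq : extChartAt (𝓡 n) p q = x := (extChartAt (𝓡 n) p).right_inv hx
    obtain ⟨w, rfl⟩ := (bijective_chartDeriv hqs).2 v
    have := diffAt_chart hf.contMDiff_position hqs w
    rw [hxq] at this
    rw [chartPos, this]
    exact hν.inner_differential q w
  injective_fderiv x hx := by
    set q := (extChartAt (𝓡 n) p).symm x with hq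
    have hqs : q ∈ (extChartAt (𝓡 n) p).source := (extChartAt (𝓡 n) p).map_target hx
    have hxq : extChartAt (𝓡 n) p q = x := (extChartAt (𝓡 n) p).right_inv hx
    have h1 := diffAt_eq hqs (hf.contMDiff_position.mdifferentiableAt (by simp))
    rw [hxq] at h1
    have h2 := hf.injective_diffAt q
    rw [h1, ContinuousLinearMap.coe_comp] at h2
    exact (Function.Injective.of_comp_iff' _ (bijective_chartDeriv hqs)).1 h2

/-- The volume density in the preferred chart at `p`. -/
def chartDensity (f : M → UnitSphere n) (p : M) (x : Dom n) : ℝ :=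
  density (fderiv ℝ (chartPos f p) x)

/-- Densities transform by the absolute Jacobian of the transition map, as change of variables
requires. -/
lemma chartDensity_eq (hf : IsHypersurface f) {p p' q : M} (hq : q ∈ (extChartAt (𝓡 n) p).source)
    (hq' : q ∈ (extChartAt (𝓡 n) p').source) :
    chartDensity f p (extChartAt (𝓡 n) p q)
      = |(fderiv ℝ (extChartAt (𝓡 n) p' ∘ (extChartAt (𝓡 n) p).symm) (extChartAt (𝓡 n) p q)).det|
        * chartDensity f p' (extChartAt (𝓡 n) p' q) := by
  rw [chartDensity, chartDensity, ← density_comp]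
  congr 1
  have hd := hf.contMDiff_position.mdifferentiableAt (x := q) (by simp)
  have h1 := diffAt_eq hq hd
  rw [diffAt_eq hq' hd, chartDeriv_eq hq hq', ← ContinuousLinearMap.comp_assoc] at h1
  ext1 v
  obtain ⟨w, rfl⟩ := (bijective_chartDeriv hq).2 v
  exact (congrArg (fun A : Dom n →L[ℝ] Amb n => A w) h1).symm

lemma density_pos {A : Dom n →L[ℝ] Amb n} (hA : Function.Injective A) : 0 < density A := by
  have : ((stdMatrix A).transpose * stdMatrix A).PosDef := by
    rw [← Matrix.conjTranspose_eq_transpose_of_trivial]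
    refine Matrix.PosDef.conjTranspose_mul_self _ ?_
    intro v w hvw
    have h : ∀ v : Fin n → ℝ, ((stdMatrix A).mulVec v) = (A (WithLp.toLp 2 v)).ofLp := by
      intro v
      have hv : (WithLp.toLp 2 v : Dom n) = ∑ i, v i • EuclideanSpace.single i (1 : ℝ) := by
        have := (EuclideanSpace.basisFun (Fin n) ℝ).sum_repr (WithLp.toLp 2 v)
        simpa using this.symm
      ext k
      rw [hv]
      simp [Matrix.mulVec, dotProduct, stdMatrix_apply, mul_comm]
    change (stdMatrix A).mulVec v = (stdMatrix A).mulVec w at hvw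
    rw [h, h] at hvw
    have := hA (WithLp.ofLp_injective 2 hvw)
    exact (WithLp.toLp_injective 2) this
  exact Real.sqrt_pos.2 this.det_pos

lemma continuousOn_chartDensity (hf : IsHypersurface f) (p : M) :
    ContinuousOn (chartDensity f p) (extChartAt (𝓡 n) p).target :=
  continuous_density.comp_continuousOn
    ((contDiffOn_comp_chart_symm hf.contMDiff_position p).continuousOn_fderiv_of_isOpen
      (isOpen_extChartAt_target p) (by simp))

lemma chartDensity_pos (hf : IsHypersurface f) {p : M} {x : Dom n}
    (hx : x ∈ (extChartAt (𝓡 n) p).target) : 0 < chartDensity f p x := by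
  refine density_pos ?_
  set q := (extChartAt (𝓡 n) p).symm x with hq
  have hqs : q ∈ (extChartAt (𝓡 n) p).source := (extChartAt (𝓡 n) p).map_target hx
  have hxq : extChartAt (𝓡 n) p q = x := (extChartAt (𝓡 n) p).right_inv hx
  have h1 := diffAt_eq hqs (hf.contMDiff_position.mdifferentiableAt (by simp))
  rw [hxq] at h1
  have h2 := hf.injective_diffAt q
  rw [h1, ContinuousLinearMap.coe_comp] at h2
  exact (Function.Injective.of_comp_iff' _ (bijective_chartDeriv hqs)).1 h2

end Hypersurface

end SphereHypersurface

end

noncomputable section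

open Finset Polynomial

namespace SphereHypersurface

variable {n : ℕ}

/-! ### The divergence theorem -/

section Divergence

open MeasureTheory

lemma divergence_smul {u : Dom n → ℝ} {Y : Dom n → Dom n} {x : Dom n}
    (hu : DifferentiableAt ℝ u x) (hY : DifferentiableAt ℝ Y x) :
    divergence (fun y => u y • Y y) x = fderiv ℝ u x (Y x) + u x * divergence Y x := by
  have h : (fderiv ℝ (fun y => u y • Y y) x).toLinearMap
      = u x • (fderiv ℝ Y x).toLinearMap + ((fderiv ℝ u x).toLinearMap).smulRight (Y x) := by
    rw [fderiv_fun_smul hu hY]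
    rfl
  rw [divergence, h, map_add, map_smul, LinearMap.trace_smulRight, add_comm]
  rfl

lemma continuousOn_divergence {Y : Dom n → Dom n} {U : Set (Dom n)} (hU : IsOpen U)
    (hY : ContDiffOn ℝ 1 Y U) : ContinuousOn (divergence Y) U := by
  have h : Continuous fun A : Dom n →L[ℝ] Dom n => LinearMap.trace ℝ (Dom n) A.toLinearMap :=
    ((LinearMap.trace ℝ (Dom n)).comp
      (ContinuousLinearMap.coeLM ℝ)).continuous_of_finiteDimensional
  exact h.comp_continuousOn (hY.continuousOn_fderiv_of_isOpen hU le_rfl)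

lemma divergence_eq_sum (Y : Dom n → Dom n) (x : Dom n) :
    divergence Y x = ∑ i, (fderiv ℝ Y x (EuclideanSpace.single i 1)) i := by
  rw [divergence, LinearMap.trace_eq_matrix_trace ℝ (EuclideanSpace.basisFun (Fin n) ℝ).toBasis,
    Matrix.trace]
  refine Finset.sum_congr rfl fun i _ => ?_
  simp [LinearMap.toMatrix_apply]

/-- Integrate each ∂_i Z_i by parts against the constant function 1. -/
lemma integral_divergence_eq_zero {Z : Dom n → Dom n} (hZ : ContDiff ℝ 1 Z)
    (hc : HasCompactSupport Z) : ∫ x, divergence Z x = 0 := by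
  have hd := hZ.continuous_fderiv one_ne_zero
  have hcomp : ∀ i : Fin n, Continuous fun x => (fderiv ℝ Z x (EuclideanSpace.single i 1)) i :=
    fun i => (EuclideanSpace.proj i : Dom n →L[ℝ] ℝ).continuous.comp
      (hd.clm_apply continuous_const)
  have hint : ∀ i : Fin n,
      Integrable fun x => (fderiv ℝ Z x (EuclideanSpace.single i 1)) i := fun i =>
    (hcomp i).integrable_of_hasCompactSupport
      (hc.fderiv (𝕜 := ℝ) |>.comp_left
        (g := fun A : Dom n →L[ℝ] Dom n => (A (EuclideanSpace.single i 1)) i) (by simp))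
  have hi : ∀ i : Fin n, ∫ x, (fderiv ℝ Z x (EuclideanSpace.single i 1)) i = 0 := by
    intro i
    have hZi : ContDiff ℝ 1 fun x => Z x i := by fun_prop
    have hZc : HasCompactSupport fun x => Z x i :=
      hc.comp_left (g := fun v : Dom n => v i) (by simp)
    have hder : ∀ x, fderiv ℝ (fun x => Z x i) x (EuclideanSpace.single i 1)
        = (fderiv ℝ Z x (EuclideanSpace.single i 1)) i := by
      intro x
      have := ((EuclideanSpace.proj i : Dom n →L[ℝ] ℝ).hasFDerivAt (x := Z x)).comp x
        (hZ.differentiable (by simp) x).hasFDerivAt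
      exact congrArg (fun A : Dom n →L[ℝ] ℝ => A (EuclideanSpace.single i 1)) this.fderiv
    have h := integral_mul_fderiv_eq_neg_fderiv_mul_of_integrable (μ := (volume : Measure (Dom n)))
      (f := fun _ => (1 : ℝ)) (g := fun x => Z x i) (v := EuclideanSpace.single i 1)
      (by simp) (by simpa [hder] using hint i)
      (by simpa using hZi.continuous.integrable_of_hasCompactSupport hZc)
      (fun _ _ => differentiableAt_const _) (fun x _ => hZi.differentiable (by simp) x)
    simpa [hder] using h
  simp_rw [divergence_eq_sum]
  rw [integral_finsetSum _ fun i _ => hint i]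
  exact Finset.sum_eq_zero fun i _ => hi i

variable {M : Type*} [TopologicalSpace M] [ChartedSpace (EuclideanSpace ℝ (Fin n)) M]
  {f : M → UnitSphere n}

/-- The expression of a vector field in the preferred chart at `p`. -/
def chartField (X : M → Dom n) (p : M) (x : Dom n) : Dom n :=
  chartDeriv p ((extChartAt (𝓡 n) p).symm x) (X ((extChartAt (𝓡 n) p).symm x))

/-- The vector field `X` is continuously differentiable with divergence `N`. -/
structure HasDivergence (f : M → UnitSphere n) (X : M → Dom n) (N : M → ℝ) : Prop where
  contDiffOn : ∀ p, ContDiffOn ℝ 1 (fun x => chartDensity f p x • chartField X p x)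
    (extChartAt (𝓡 n) p).target
  divergence_eq : ∀ p, ∀ x ∈ (extChartAt (𝓡 n) p).target,
    divergence (fun x => chartDensity f p x • chartField X p x) x
      = chartDensity f p x * N ((extChartAt (𝓡 n) p).symm x)

/-- The integral over the domain of the preferred chart at `p`. -/
def chartInt (f : M → UnitSphere n) (p : M) (h : M → ℝ) : ℝ :=
  ∫ x in (extChartAt (𝓡 n) p).target, chartDensity f p x * h ((extChartAt (𝓡 n) p).symm x)

variable [IsManifold (𝓡 n) ∞ M]

omit [IsManifold (𝓡 n) ∞ M] in
lemma continuousAt_of_chart {u : M → ℝ} {q : M} {F : Dom n → ℝ}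
    (hF : ContinuousOn F (extChartAt (𝓡 n) q).target)
    (h : ∀ z ∈ (extChartAt (𝓡 n) q).source, u z = F (extChartAt (𝓡 n) q z)) :
    ContinuousAt u q := by
  have h1 : ContinuousAt (F ∘ extChartAt (𝓡 n) q) q := by
    refine ContinuousAt.comp ?_ (continuousAt_extChartAt q)
    exact hF.continuousAt ((isOpen_extChartAt_target q).mem_nhds (mem_extChartAt_target q))
  refine h1.congr ?_
  filter_upwards [extChartAt_source_mem_nhds (I := 𝓡 n) q] with z hz
  exact (h z hz).symm

/-- `HasDivergence` controls only the density times the field; dividing by the positive continuous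
density recovers the field. -/
lemma HasDivergence.continuousOn_chartField (hf : IsHypersurface f) {X : M → Dom n} {N : M → ℝ}
    (hX : HasDivergence f X N) (p : M) :
    ContinuousOn (chartField X p) (extChartAt (𝓡 n) p).target := by
  refine (((continuousOn_chartDensity hf p).inv₀ fun x hx => (chartDensity_pos hf hx).ne').smul
    (hX.contDiffOn p).continuousOn).congr fun x hx => ?_
  change _ = (chartDensity f p x)⁻¹ • chartDensity f p x • chartField X p x
  rw [smul_smul, inv_mul_cancel₀ (chartDensity_pos hf hx).ne', one_smul]

lemma HasDivergence.continuous (hf : IsHypersurface f) {X : M → Dom n} {N : M → ℝ}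
    (hX : HasDivergence f X N) : Continuous N := by
  refine continuous_iff_continuousAt.2 fun q => continuousAt_of_chart
    (((continuousOn_chartDensity hf q).inv₀ fun x hx => (chartDensity_pos hf hx).ne').mul
      (continuousOn_divergence (isOpen_extChartAt_target q) (hX.contDiffOn q))) fun z hz => ?_
  have ht := (extChartAt (𝓡 n) q).map_source hz
  change _ = (chartDensity f q _)⁻¹ * divergence (fun x => chartDensity f q x • chartField X q x) _
  rw [hX.divergence_eq q _ ht, ← mul_assoc, inv_mul_cancel₀ (chartDensity_pos hf ht).ne', one_mul,
    (extChartAt (𝓡 n) q).left_inv hz]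

lemma fderiv_chart_chartField {u : M → ℝ} (hu : ContMDiff (𝓡 n) 𝓘(ℝ, ℝ) ∞ u) (X : M → Dom n)
    {p : M} {x : Dom n} (hx : x ∈ (extChartAt (𝓡 n) p).target) :
    fderiv ℝ (u ∘ (extChartAt (𝓡 n) p).symm) x (chartField X p x)
      = diffAt u ((extChartAt (𝓡 n) p).symm x) (X ((extChartAt (𝓡 n) p).symm x)) := by
  have := diffAt_chart hu ((extChartAt (𝓡 n) p).map_target hx) (X ((extChartAt (𝓡 n) p).symm x))
  rwa [(extChartAt (𝓡 n) p).right_inv hx] at this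

lemma HasDivergence.continuous_diffAt (hf : IsHypersurface f) {X : M → Dom n} {N : M → ℝ}
    (hX : HasDivergence f X N) {u : M → ℝ} (hu : ContMDiff (𝓡 n) 𝓘(ℝ, ℝ) ∞ u) :
    Continuous fun q => diffAt u q (X q) := by
  refine continuous_iff_continuousAt.2 fun q => continuousAt_of_chart
    (((contDiffOn_comp_chart_symm hu q).continuousOn_fderiv_of_isOpen
      (isOpen_extChartAt_target q) (by simp)).clm_apply (hX.continuousOn_chartField hf q))
      fun z hz => ?_
  rw [fderiv_chart_chartField hu X ((extChartAt (𝓡 n) q).map_source hz),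
    (extChartAt (𝓡 n) q).left_inv hz]

omit [IsManifold (𝓡 n) ∞ M] in
lemma diffAt_eq_zero_of_notMem_tsupport {u : M → ℝ} {q : M} (hq : q ∉ tsupport u) :
    diffAt (n := n) u q = 0 := by
  have h : u =ᶠ[nhds q] fun _ => 0 := notMem_tsupport_iff_eventuallyEq.1 hq
  rw [diffAt, h.mfderiv_eq]
  exact mfderiv_const

lemma integrableOn_chartInt [CompactSpace M] (hf : IsHypersurface f) {p : M} {h : M → ℝ}
    (hh : Continuous h) (hs : tsupport h ⊆ (extChartAt (𝓡 n) p).source) :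
    IntegrableOn (fun x => chartDensity f p x * h ((extChartAt (𝓡 n) p).symm x))
      (extChartAt (𝓡 n) p).target := by
  have hcont : ContinuousOn (fun x => chartDensity f p x * h ((extChartAt (𝓡 n) p).symm x))
      (extChartAt (𝓡 n) p).target :=
    (continuousOn_chartDensity hf p).mul (hh.comp_continuousOn (continuousOn_extChartAt_symm p))
  have hK : IsCompact (extChartAt (𝓡 n) p '' tsupport h) :=
    (isClosed_tsupport h).isCompact.image_of_continuousOn
      ((continuousOn_extChartAt p).mono hs)
  have hsub : extChartAt (𝓡 n) p '' tsupport h ⊆ (extChartAt (𝓡 n) p).target := by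
    rintro _ ⟨z, hz, rfl⟩
    exact (extChartAt (𝓡 n) p).map_source (hs hz)
  refine ((hcont.mono hsub).integrableOn_compact hK).of_forall_sdiff_eq_zero
    (isOpen_extChartAt_target p).measurableSet fun x hx => ?_
  have : (extChartAt (𝓡 n) p).symm x ∉ tsupport h := fun hm =>
    hx.2 ⟨_, hm, (extChartAt (𝓡 n) p).right_inv hx.1⟩
  rw [image_eq_zero_of_notMem_tsupport this, mul_zero]

/-- Since h vanishes off both chart domains, both integrals live on the overlap, where the Jacobian
of the transition map is absorbed by `chartDensity_eq`. -/
lemma chartInt_congr_chart (hf : IsHypersurface f) {p p' : M} {h : M → ℝ}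
    (hp : ∀ q, q ∉ (extChartAt (𝓡 n) p).source → h q = 0)
    (hp' : ∀ q, q ∉ (extChartAt (𝓡 n) p').source → h q = 0) :
    chartInt f p h = chartInt f p' h := by
  have := isManifold_one (n := n) M
  have hmeas : ∀ p p' : M, MeasurableSet ((extChartAt (𝓡 n) p).target
      ∩ (extChartAt (𝓡 n) p).symm ⁻¹' (extChartAt (𝓡 n) p').source) := fun p p' =>
    ((continuousOn_extChartAt_symm p).isOpen_inter_preimage (isOpen_extChartAt_target p)
      (isOpen_extChartAt_source p')).measurableSet
  have hrestrict : ∀ p p' : M, (∀ q, q ∉ (extChartAt (𝓡 n) p').source → h q = 0) →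
      chartInt f p h = ∫ x in (extChartAt (𝓡 n) p).target
        ∩ (extChartAt (𝓡 n) p).symm ⁻¹' (extChartAt (𝓡 n) p').source,
        chartDensity f p x * h ((extChartAt (𝓡 n) p).symm x) := by
    intro p p' hp'
    refine setIntegral_eq_of_subset_of_forall_sdiff_eq_zero
      (isOpen_extChartAt_target p).measurableSet Set.inter_subset_left fun x hx => ?_
    rw [hp' _ fun hm => hx.2 ⟨hx.1, hm⟩, mul_zero]
  rw [hrestrict p p' hp', hrestrict p' p hp]
  set S := (extChartAt (𝓡 n) p).target
    ∩ (extChartAt (𝓡 n) p).symm ⁻¹' (extChartAt (𝓡 n) p').source with hS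
  set ψ := extChartAt (𝓡 n) p' ∘ (extChartAt (𝓡 n) p).symm with hψ
  have himage : (extChartAt (𝓡 n) p').target
      ∩ (extChartAt (𝓡 n) p').symm ⁻¹' (extChartAt (𝓡 n) p).source = ψ '' S := by
    ext y
    constructor
    · rintro ⟨hy, hy'⟩
      refine ⟨extChartAt (𝓡 n) p ((extChartAt (𝓡 n) p').symm y),
        ⟨(extChartAt (𝓡 n) p).map_source hy', ?_⟩, ?_⟩
      · rw [Set.mem_preimage, (extChartAt (𝓡 n) p).left_inv hy']
        exact (extChartAt (𝓡 n) p').map_target hy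
      · rw [hψ, Function.comp_apply, (extChartAt (𝓡 n) p).left_inv hy',
          (extChartAt (𝓡 n) p').right_inv hy]
    · rintro ⟨x, ⟨hx, hx'⟩, rfl⟩
      refine ⟨(extChartAt (𝓡 n) p').map_source hx', ?_⟩
      rw [Set.mem_preimage, hψ, Function.comp_apply, (extChartAt (𝓡 n) p').left_inv hx']
      exact (extChartAt (𝓡 n) p).map_target hx
  have hinj : Set.InjOn ψ S := by
    rintro x ⟨hx, hx'⟩ y ⟨hy, hy'⟩ hxy
    have h1 := (extChartAt (𝓡 n) p').injOn hx' hy' hxy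
    exact (extChartAt (𝓡 n) p).symm.injOn hx hy h1
  have hder : ∀ x ∈ S, HasFDerivWithinAt ψ (fderiv ℝ ψ x) S x := by
    rintro x ⟨hx, hx'⟩
    refine DifferentiableAt.hasFDerivAt ?_ |>.hasFDerivWithinAt
    have hsymm : MDifferentiableAt 𝓘(ℝ, Dom n) (𝓡 n) (extChartAt (𝓡 n) p).symm x := by
      have := mdifferentiableWithinAt_extChartAt_symm (I := 𝓡 n) hx
      rwa [ModelWithCorners.range_eq_univ, mdifferentiableWithinAt_univ] at this
    refine mdifferentiableAt_iff_differentiableAt.1 (MDifferentiableAt.comp x ?_ hsymm)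
    exact mdifferentiableAt_extChartAt (by rw [← extChartAt_source (I := 𝓡 n)]; exact hx')
  rw [himage, integral_image_eq_integral_abs_det_fderiv_smul volume (hmeas p p') hder hinj]
  refine setIntegral_congr_fun (hmeas p p') fun x hx => ?_
  have h1 := chartDensity_eq hf ((extChartAt (𝓡 n) p).map_target hx.1) hx.2
  rw [(extChartAt (𝓡 n) p).right_inv hx.1] at h1
  have h2 : (extChartAt (𝓡 n) p').symm (ψ x) = (extChartAt (𝓡 n) p).symm x :=
    (extChartAt (𝓡 n) p').left_inv hx.2
  beta_reduce
  rw [h1, h2, smul_eq_mul, mul_assoc]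
  rfl

lemma chartInt_add [CompactSpace M] (hf : IsHypersurface f) {p : M} {g h : M → ℝ}
    (hg : Continuous g) (hgs : tsupport g ⊆ (extChartAt (𝓡 n) p).source)
    (hh : Continuous h) (hs : tsupport h ⊆ (extChartAt (𝓡 n) p).source) :
    chartInt f p (fun q => g q + h q) = chartInt f p g + chartInt f p h := by
  simp only [chartInt, mul_add]
  exact integral_add (integrableOn_chartInt hf hg hgs) (integrableOn_chartInt hf hh hs)

lemma chartInt_sum [CompactSpace M] (hf : IsHypersurface f) {p : M} {ι : Type*} (s : Finset ι)
    {g : ι → M → ℝ} (hg : ∀ i, Continuous (g i))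
    (hgs : ∀ i, tsupport (g i) ⊆ (extChartAt (𝓡 n) p).source) :
    chartInt f p (fun q => ∑ i ∈ s, g i q) = ∑ i ∈ s, chartInt f p (g i) := by
  simp only [chartInt, Finset.mul_sum]
  exact integral_finsetSum _ fun i _ => integrableOn_chartInt hf (hg i) (hgs i)

omit [IsManifold (𝓡 n) ∞ M] in
lemma chartInt_const_mul (p : M) (a : ℝ) (g : M → ℝ) :
    chartInt f p (fun q => a * g q) = a * chartInt f p g := by
  simp only [chartInt, ← integral_const_mul]
  congr 1
  ext x
  ring

lemma chartInt_nonneg (hf : IsHypersurface f) (p : M) {g : M → ℝ} (hg : ∀ q, 0 ≤ g q) :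
    0 ≤ chartInt f p g :=
  setIntegral_nonneg (isOpen_extChartAt_target p).measurableSet fun _ hx =>
    mul_nonneg (chartDensity_pos hf hx).le (hg _)

lemma chartInt_pos [CompactSpace M] (hf : IsHypersurface f) {p : M} {g : M → ℝ}
    (hg : Continuous g) (hgs : tsupport g ⊆ (extChartAt (𝓡 n) p).source) (hg0 : ∀ q, 0 ≤ g q)
    {q : M} (hq : 0 < g q) : 0 < chartInt f p g := by
  have hmeas := (isOpen_extChartAt_target (I := 𝓡 n) p).measurableSet
  refine (setIntegral_pos_iff_support_of_nonneg_ae ?_ (integrableOn_chartInt hf hg hgs)).2 ?_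
  · refine (ae_restrict_iff' hmeas).2 (Filter.Eventually.of_forall fun x hx => ?_)
    exact mul_nonneg (chartDensity_pos hf hx).le (hg0 _)
  · set W := (extChartAt (𝓡 n) p).target ∩ (extChartAt (𝓡 n) p).symm ⁻¹' {q | 0 < g q} with hW
    have hWo : IsOpen W := (continuousOn_extChartAt_symm p).isOpen_inter_preimage
      (isOpen_extChartAt_target p) (isOpen_lt continuous_const hg)
    have hqs : q ∈ (extChartAt (𝓡 n) p).source := hgs (subset_tsupport g hq.ne')
    have hWn : W.Nonempty := by
      refine ⟨extChartAt (𝓡 n) p q, (extChartAt (𝓡 n) p).map_source hqs, ?_⟩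
      rw [Set.mem_preimage, (extChartAt (𝓡 n) p).left_inv hqs]
      exact hq
    refine (hWo.measure_pos volume hWn).trans_le (measure_mono fun x hx => ⟨?_, hx.1⟩)
    exact (mul_pos (chartDensity_pos hf hx.1) hx.2).ne'

/-- The divergence theorem for a vector field multiplied by a function supported in a chart. -/
lemma HasDivergence.chartInt_eq_zero [CompactSpace M] {X : M → Dom n}
    {N : M → ℝ} (hX : HasDivergence f X N) {u : M → ℝ} (hu : ContMDiff (𝓡 n) 𝓘(ℝ, ℝ) ∞ u)
    {p : M} (hs : tsupport u ⊆ (extChartAt (𝓡 n) p).source) [T2Space M] :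
    chartInt f p (fun q => diffAt u q (X q) + u q * N q) = 0 := by
  classical
  set Y : Dom n → Dom n := fun x => chartDensity f p x • chartField X p x with hY
  set w : Dom n → ℝ := u ∘ (extChartAt (𝓡 n) p).symm with hw
  set T := (extChartAt (𝓡 n) p).target with hT
  have hTo : IsOpen T := isOpen_extChartAt_target p
  set K := extChartAt (𝓡 n) p '' tsupport u with hK
  have hKc : IsCompact K := (isClosed_tsupport u).isCompact.image_of_continuousOn
    ((continuousOn_extChartAt p).mono hs)
  have hKT : K ⊆ T := by
    rintro _ ⟨z, hz, rfl⟩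
    exact (extChartAt (𝓡 n) p).map_source (hs hz)
  have hw0 : ∀ x ∈ T, x ∉ K → w x = 0 := fun x hx hxK =>
    image_eq_zero_of_notMem_tsupport (f := u) fun hm =>
      hxK ⟨_, hm, (extChartAt (𝓡 n) p).right_inv hx⟩
  have hwC : ContDiffOn ℝ ∞ w T := contDiffOn_comp_chart_symm hu p
  -- The support of u is compact inside the chart, so extension by zero gives a global C¹ field of
  -- compact support.
  set Z : Dom n → Dom n := T.indicator fun x => w x • Y x with hZ
  have hZT : ∀ x ∈ T, Z =ᶠ[nhds x] fun x => w x • Y x := fun x hx => by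
    filter_upwards [hTo.mem_nhds hx] with y hy
    exact Set.indicator_of_mem hy _
  have hZK : ∀ x, x ∉ K → Z x = 0 := by
    intro x hx
    by_cases hxT : x ∈ T
    · rw [hZ, Set.indicator_of_mem hxT, hw0 x hxT hx, zero_smul]
    · exact Set.indicator_of_notMem hxT _
  have hZC : ContDiff ℝ 1 Z := by
    refine contDiff_iff_contDiffAt.2 fun x => ?_
    by_cases hxT : x ∈ T
    · refine ContDiffAt.congr_of_eventuallyEq ?_ (hZT x hxT)
      exact (((hwC.of_le (by simp)).contDiffAt (hTo.mem_nhds hxT)).smul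
        ((hX.contDiffOn p).contDiffAt (hTo.mem_nhds hxT)))
    · have : Z =ᶠ[nhds x] fun _ => 0 := by
        filter_upwards [hKc.isClosed.isOpen_compl.mem_nhds fun hm => hxT (hKT hm)] with y hy
        exact hZK y hy
      exact (contDiffAt_const (𝕜 := ℝ) (c := (0 : Dom n))).congr_of_eventuallyEq this
  have hint := integral_divergence_eq_zero hZC (HasCompactSupport.intro hKc hZK)
  have hoff : ∀ x, x ∉ T → divergence Z x = 0 := by
    intro x hx
    have : Z =ᶠ[nhds x] fun _ => 0 := by
      filter_upwards [hKc.isClosed.isOpen_compl.mem_nhds fun hm => hx (hKT hm)] with y hy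
      exact hZK y hy
    simp only [divergence, this.fderiv_eq]
    simp
  rw [← setIntegral_eq_integral_of_forall_compl_eq_zero hoff] at hint
  rw [← hint, chartInt]
  refine setIntegral_congr_fun hTo.measurableSet fun x hx => ?_
  have h1 : divergence Z x = divergence (fun x => w x • Y x) x := by
    simp only [divergence, (hZT x hx).fderiv_eq]
  have h2 : fderiv ℝ w x (chartField X p x) = diffAt u ((extChartAt (𝓡 n) p).symm x)
      (X ((extChartAt (𝓡 n) p).symm x)) := fderiv_chart_chartField hu X hx
  have h3 : divergence Y x = _ := hX.divergence_eq p x hx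
  have h4 : DifferentiableAt ℝ w x :=
    (hwC.contDiffAt (hTo.mem_nhds hx)).differentiableAt (by simp)
  have h5 : DifferentiableAt ℝ Y x :=
    ((hX.contDiffOn p).contDiffAt (hTo.mem_nhds hx)).differentiableAt (by simp)
  beta_reduce
  rw [h1, divergence_smul h4 h5, h3, hY, map_smul, h2, hw, Function.comp_apply, smul_eq_mul]
  ring

/-- A positive functional that vanishes on divergences. -/
theorem exists_integral [CompactSpace M] [T2Space M] (hf : IsHypersurface f) :
    ∃ I : (M → ℝ) → ℝ,
      (∀ g h, Continuous g → Continuous h → I (fun q => g q + h q) = I g + I h) ∧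
      (∀ (a : ℝ) g, I (fun q => a * g q) = a * I g) ∧
      (∀ g, (∀ q, 0 ≤ g q) → 0 ≤ I g) ∧
      (∀ g, Continuous g → (∀ q, 0 ≤ g q) → ∀ q, 0 < g q → 0 < I g) ∧
      (∀ X N, HasDivergence f X N → I N = 0) := by
  classical
  obtain ⟨t, ht⟩ := isCompact_univ.elim_nhds_subcover
    (fun p : M => (extChartAt (𝓡 n) p).source)
    fun p _ => extChartAt_source_mem_nhds (I := 𝓡 n) p
  obtain ⟨ρ, hρ⟩ := SmoothPartitionOfUnity.exists_isSubordinate (𝓡 n)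
    (isClosed_univ (X := M)) (fun i : {p // p ∈ t} => (extChartAt (𝓡 n) (i : M)).source)
    (fun i => isOpen_extChartAt_source (i : M)) (by
      intro z hz
      obtain ⟨p, hp, hzp⟩ := Set.mem_iUnion₂.1 (ht.2 hz)
      exact Set.mem_iUnion.2 ⟨⟨p, hp⟩, hzp⟩)
  have hsum : ∀ q, ∑ i, ρ i q = 1 := fun q => by
    have := ρ.sum_eq_one (Set.mem_univ q)
    rwa [finsum_eq_sum_of_fintype] at this
  have hρc : ∀ i, ContMDiff (𝓡 n) 𝓘(ℝ, ℝ) ∞ (ρ i) := fun i => (ρ i).contMDiff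
  have hρcont : ∀ i, Continuous (ρ i) := fun i => (hρc i).continuous
  have hsub : ∀ i (h : M → ℝ), tsupport (fun q => ρ i q * h q)
      ⊆ (extChartAt (𝓡 n) (i : M)).source := fun i h =>
    (tsupport_mul_subset_left (f := ρ i) (g := h)).trans (hρ i)
  -- Integration through the partition of unity; that the value is independent of the partition is
  -- never needed.
  refine ⟨fun h => ∑ i : {p // p ∈ t}, chartInt f (i : M) fun q => ρ i q * h q, ?_, ?_, ?_, ?_, ?_⟩
  · intro g h hg hh
    rw [← Finset.sum_add_distrib]
    refine Finset.sum_congr rfl fun i _ => ?_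
    have := chartInt_add hf ((hρcont i).mul hg) (hsub i g) ((hρcont i).mul hh) (hsub i h)
    simp only [mul_add]
    exact this
  · intro a g
    rw [Finset.mul_sum]
    refine Finset.sum_congr rfl fun i _ => ?_
    rw [← chartInt_const_mul]
    congr 1
    ext q
    ring
  · exact fun g hg => Finset.sum_nonneg fun i _ =>
      chartInt_nonneg hf _ fun q => mul_nonneg (ρ.nonneg i q) (hg q)
  · intro g hg hg0 q hq
    obtain ⟨i, -, hi⟩ : ∃ i ∈ Finset.univ, 0 < ρ i q :=
      Finset.exists_lt_of_sum_lt (s := Finset.univ) (f := fun _ => (0 : ℝ)) (g := fun i => ρ i q)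
        (by rw [hsum q]; simp)
    exact Finset.sum_pos' (fun i _ => chartInt_nonneg hf _ fun q => mul_nonneg (ρ.nonneg i q) (hg0 q))
      ⟨i, Finset.mem_univ _, chartInt_pos hf ((hρcont i).mul hg) (hsub i g)
        (fun q => mul_nonneg (ρ.nonneg i q) (hg0 q)) (mul_pos hi hq)⟩
  · intro X N hX
    set d : {p // p ∈ t} → M → ℝ := fun i q => diffAt (ρ i) q (X q) with hd
    have hdc : ∀ i, Continuous (d i) := fun i => hX.continuous_diffAt hf (hρc i)
    have hd0 : ∀ i q, q ∉ tsupport (ρ i) → d i q = 0 := fun i q hq => by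
      rw [hd]
      simp only [diffAt_eq_zero_of_notMem_tsupport hq]
      rfl
    have hds : ∀ i, tsupport (d i) ⊆ (extChartAt (𝓡 n) (i : M)).source := fun i =>
      (closure_minimal (fun q (hq : d i q ≠ 0) => by_contra fun hm => hq (hd0 i q hm))
        (isClosed_tsupport (ρ i))).trans (hρ i)
    have hdsum : ∀ q, ∑ i, d i q = 0 := by
      intro q
      have h1 : ∀ i, diffAt (n := n) (ρ i) q
          = (fderiv ℝ (ρ i ∘ (extChartAt (𝓡 n) q).symm) (extChartAt (𝓡 n) q q)).comp
            (chartDeriv q q) := fun i =>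
        diffAt_eq (mem_extChartAt_source q) ((hρc i).mdifferentiableAt (by simp))
      have h2 : ∀ i, DifferentiableAt ℝ (ρ i ∘ (extChartAt (𝓡 n) q).symm)
          (extChartAt (𝓡 n) q q) := fun i =>
        ((contDiffOn_comp_chart_symm (hρc i) q).contDiffAt
          ((isOpen_extChartAt_target q).mem_nhds (mem_extChartAt_target q))).differentiableAt
          (by simp)
      have h3 : (∑ i, fderiv ℝ (ρ i ∘ (extChartAt (𝓡 n) q).symm) (extChartAt (𝓡 n) q q)) = 0 := by
        rw [← fderiv_fun_sum fun i _ => h2 i]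
        have : (fun y => ∑ i, (ρ i ∘ (extChartAt (𝓡 n) q).symm) y) = fun _ => 1 := by
          ext y
          exact hsum _
        rw [this]
        simp
      simp only [hd, h1, ContinuousLinearMap.comp_apply]
      rw [← _root_.sum_apply, h3]
      rfl
    -- The divergence theorem in one chart trades ρ_i N for -dρ_i(X).
    have hstep : ∀ i : {p // p ∈ t}, chartInt f (i : M) (fun q => ρ i q * N q) = -chartInt f (i : M) (d i) := by
      intro i
      have h1 := hX.chartInt_eq_zero (hρc i) (hρ i)
      have h2 := chartInt_add hf (hdc i) (hds i) ((hρcont i).mul (hX.continuous hf)) (hsub i N)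
      have h3 := h2.symm.trans h1
      change _ + chartInt f (i : M) (fun q => ρ i q * N q) = 0 at h3
      linarith
    -- Insert 1 = ∑ ρ_j and move each piece from chart i to chart j. The sum over i can then be
    -- taken inside a single chart, where ∑ dρ_i = 0.
    have hexp : ∀ i : {p // p ∈ t}, chartInt f (i : M) (d i)
        = ∑ j : {p // p ∈ t}, chartInt f (j : M) fun q => ρ j q * d i q := by
      intro i
      have h1 : d i = fun q => ∑ j, ρ j q * d i q := by
        ext q
        rw [← Finset.sum_mul, hsum, one_mul]
      have hs' : ∀ j, tsupport (fun q => ρ j q * d i q) ⊆ (extChartAt (𝓡 n) (i : M)).source :=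
        fun j => (tsupport_mul_subset_right (f := ρ j) (g := d i)).trans (hds i)
      conv_lhs => rw [h1]
      refine (chartInt_sum hf Finset.univ (fun j => (hρcont j).mul (hdc i)) hs').trans ?_
      refine Finset.sum_congr rfl fun j _ => chartInt_congr_chart hf ?_ ?_
      · exact fun q hq => image_eq_zero_of_notMem_tsupport
          (f := fun q => ρ j q * d i q) fun hm => hq (hs' j hm)
      · exact fun q hq => image_eq_zero_of_notMem_tsupport
          (f := fun q => ρ j q * d i q) fun hm => hq (hsub j (d i) hm)
    simp only [hstep, hexp, Finset.sum_neg_distrib, neg_eq_zero]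
    rw [Finset.sum_comm]
    refine Finset.sum_eq_zero fun j _ => ?_
    refine (chartInt_sum hf Finset.univ (fun i => (hρcont j).mul (hdc i))
      fun i => hsub j (d i)).symm.trans ?_
    simp only [Pi.mul_apply, ← Finset.mul_sum, hdsum, mul_zero]
    simp [chartInt]

end Divergence

end SphereHypersurface

end

noncomputable section

open Finset Polynomial

namespace SphereHypersurface

variable {n : ℕ}

/-! ### Orthonormal eigenframes -/

/-- `ε` is a basis of eigenvectors of `A` that is orthonormal for the inner product pulled back
by `L`. -/
structure IsEigenframe (L : Dom n →L[ℝ] Amb n) (A : Module.End ℝ (Dom n)) (ε : Fin n → Dom n)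
    (μ : Fin n → ℝ) : Prop where
  inner_eq : ∀ i j, ⟪L (ε i), L (ε j)⟫_ℝ = if i = j then 1 else 0
  apply_eq : ∀ i, A (ε i) = μ i • ε i

namespace IsEigenframe

variable {L : Dom n →L[ℝ] Amb n} {A : Module.End ℝ (Dom n)} {ε ε' : Fin n → Dom n}
  {μ μ' : Fin n → ℝ}

lemma inner_sum (h : IsEigenframe L A ε μ) (a : Fin n → ℝ) (j : Fin n) :
    ⟪L (∑ i, a i • ε i), L (ε j)⟫_ℝ = a j := by
  simp [sum_inner, inner_smul_left, h.inner_eq]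

lemma linearIndependent (h : IsEigenframe L A ε μ) : LinearIndependent ℝ ε := by
  refine Fintype.linearIndependent_iff.2 fun a ha i => ?_
  rw [← h.inner_sum a i, ha]
  simp

/-- The eigenframe as a basis. -/
def basis (h : IsEigenframe L A ε μ) : Module.Basis (Fin n) ℝ (Dom n) :=
  basisOfLinearIndependentOfCardEqFinrank' ε h.linearIndependent (by simp)

lemma coe_basis (h : IsEigenframe L A ε μ) : ⇑h.basis = ε :=
  coe_basisOfLinearIndependentOfCardEqFinrank' _ _ _

lemma eq_sum (h : IsEigenframe L A ε μ) (v : Dom n) :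
    v = ∑ i, ⟪L v, L (ε i)⟫_ℝ • ε i := by
  have h1 := h.basis.sum_repr v
  rw [h.coe_basis] at h1
  conv_lhs => rw [← h1]
  refine Finset.sum_congr rfl fun i _ => ?_
  conv_rhs => rw [← h1]
  rw [h.inner_sum]

lemma toMatrix_eq (h : IsEigenframe L A ε μ) :
    LinearMap.toMatrix h.basis h.basis A = Matrix.diagonal μ := by
  ext i j
  rw [LinearMap.toMatrix_apply, h.coe_basis, h.apply_eq, map_smul, ← congrFun h.coe_basis j,
    Module.Basis.repr_self]
  by_cases hij : i = j
  · subst hij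
    simp
  · simp [Matrix.diagonal_apply_ne _ hij, Finsupp.single_eq_of_ne hij]

lemma charpoly_eq (h : IsEigenframe L A ε μ) : A.charpoly = Lagrange.nodal univ μ := by
  rw [← LinearMap.charpoly_toMatrix A h.basis, h.toMatrix_eq, Matrix.charpoly_diagonal,
    Lagrange.nodal]

lemma trace_eq (h : IsEigenframe L A ε μ) : LinearMap.trace ℝ _ A = ∑ i, μ i := by
  rw [LinearMap.trace_eq_matrix_trace ℝ h.basis, h.toMatrix_eq, Matrix.trace_diagonal]

lemma trace_sq_eq (h : IsEigenframe L A ε μ) : LinearMap.trace ℝ _ (A * A) = ∑ i, μ i ^ 2 := by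
  rw [LinearMap.trace_eq_matrix_trace ℝ h.basis, LinearMap.toMatrix_mul, h.toMatrix_eq,
    Matrix.diagonal_mul_diagonal, Matrix.trace_diagonal]
  simp only [sq]

/-- A function of an operator, contracted with a linear form, does not depend on the choice of
the eigenframe. -/
lemma sum_smul_eq (h : IsEigenframe L A ε μ) (h' : IsEigenframe L A ε' μ') (w : ℝ → ℝ)
    (ξ : Dom n →ₗ[ℝ] ℝ) :
    ∑ j, (w (μ j) * ξ (ε j)) • ε j = ∑ j, (w (μ' j) * ξ (ε' j)) • ε' j := by
  -- Both sums represent w(A) applied to the vector dual to ξ. Eigenvectors for different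
  -- eigenvalues are orthogonal, so the change of frame only mixes indices with equal eigenvalues.
  have key : ∀ j k, ⟪L (ε' k), L (ε j)⟫_ℝ * w (μ j) = ⟪L (ε' k), L (ε j)⟫_ℝ * w (μ' k) := by
    intro j k
    by_cases hjk : μ j = μ' k
    · rw [hjk]
    · have h1 : ⟪L (A (ε' k)), L (ε j)⟫_ℝ = μ j * ⟪L (ε' k), L (ε j)⟫_ℝ := by
        have h2 : A (ε' k) = ∑ i, (⟪L (ε' k), L (ε i)⟫_ℝ * μ i) • ε i := by
          conv_lhs => rw [h.eq_sum (ε' k)]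
          simp [map_sum, h.apply_eq, smul_smul]
        rw [h2, h.inner_sum, mul_comm]
      rw [h'.apply_eq, map_smul, inner_smul_left] at h1
      have h3 : ⟪L (ε' k), L (ε j)⟫_ℝ = 0 := by
        have : (μ j - μ' k) * ⟪L (ε' k), L (ε j)⟫_ℝ = 0 := by
          simp only [conj_trivial] at h1
          linarith
        exact (mul_eq_zero.1 this).resolve_left (sub_ne_zero.2 hjk)
      simp [h3]
  have hξ : ∀ k, ξ (ε' k) = ∑ j, ⟪L (ε' k), L (ε j)⟫_ℝ * ξ (ε j) := by
    intro k
    conv_lhs => rw [h.eq_sum (ε' k)]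
    simp
  calc ∑ j, (w (μ j) * ξ (ε j)) • ε j
      = ∑ j, ∑ k, (w (μ j) * ξ (ε j) * ⟪L (ε' k), L (ε j)⟫_ℝ) • ε' k := by
        refine Finset.sum_congr rfl fun j _ => ?_
        conv_lhs => rw [h'.eq_sum (ε j)]
        rw [Finset.smul_sum]
        refine Finset.sum_congr rfl fun k _ => ?_
        rw [smul_smul, real_inner_comm (L (ε' k))]
        congr 2
        conv_rhs => rw [h'.eq_sum (ε j)]
    _ = ∑ k, (w (μ' k) * ξ (ε' k)) • ε' k := by
        rw [Finset.sum_comm]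
        refine Finset.sum_congr rfl fun k _ => ?_
        rw [hξ, Finset.mul_sum, Finset.sum_smul]
        refine Finset.sum_congr rfl fun j _ => ?_
        congr 1
        linear_combination ξ (ε j) * key j k

lemma comp (h : IsEigenframe L A ε μ) {L' : Dom n →L[ℝ] Amb n} {A' : Module.End ℝ (Dom n)}
    {T : Dom n →L[ℝ] Dom n} (hL : ∀ v, L' (T v) = L v) (hA : ∀ v, A' (T v) = T (A v)) :
    IsEigenframe L' A' (fun i => T (ε i)) μ where
  inner_eq i j := by rw [hL, hL, h.inner_eq]
  apply_eq i := by rw [hA, h.apply_eq, map_smul]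

end IsEigenframe

/-- The spectral theorem for an operator that is symmetric for a pulled back inner product. -/
lemma exists_isEigenframe {L : Dom n →L[ℝ] Amb n} (hL : Function.Injective L)
    {A : Module.End ℝ (Dom n)} (hA : ∀ v w, ⟪L (A v), L w⟫_ℝ = ⟪L v, L (A w)⟫_ℝ) :
    ∃ ε μ, IsEigenframe L A ε μ := by
  set T : Dom n ≃ₗ[ℝ] L.toLinearMap.range := LinearEquiv.ofInjective L.toLinearMap hL with hT
  have hTv : ∀ v, ((T v : L.toLinearMap.range) : Amb n) = L v := fun v => rfl
  have hTs : ∀ y, L (T.symm y) = (y : Amb n) := fun y => by rw [← hTv, T.apply_symm_apply]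
  -- Transported to the range of L, the operator is symmetric for a genuine inner product, and the
  -- spectral theorem applies.
  set B : L.toLinearMap.range →ₗ[ℝ] L.toLinearMap.range := T.conj A with hB
  have hBs : B.IsSymmetric := by
    intro y z
    have h1 : ∀ y, ((B y : L.toLinearMap.range) : Amb n) = L (A (T.symm y)) := fun y => rfl
    rw [Submodule.coe_inner, Submodule.coe_inner, h1, h1, ← hTs z, hA, hTs y]
  have hdim : Module.finrank ℝ L.toLinearMap.range = n := by
    rw [← T.finrank_eq]
    simp
  refine ⟨fun i => T.symm (hBs.eigenvectorBasis hdim i), hBs.eigenvalues hdim, ?_, ?_⟩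
  · intro i j
    rw [hTs, hTs, ← Submodule.coe_inner]
    exact orthonormal_iff_ite.1 (hBs.eigenvectorBasis hdim).orthonormal i j
  · intro i
    have := hBs.apply_eigenvectorBasis hdim i
    have h2 : T.symm (B (hBs.eigenvectorBasis hdim i)) = A (T.symm (hBs.eigenvectorBasis hdim i)) :=
      T.symm_apply_apply _
    rw [← h2, this]
    simp

lemma roots_nodal (μ : Fin n → ℝ) : (Lagrange.nodal univ μ).roots = univ.val.map μ := by
  rw [Lagrange.nodal]
  exact roots_multiset_prod_X_sub_C (univ.val.map μ) ▸ by
    rw [Multiset.map_map]; rfl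

lemma map_eq_of_nodal_eq {μ μ' : Fin n → ℝ} (h : Lagrange.nodal univ μ = Lagrange.nodal univ μ') :
    univ.val.map μ = univ.val.map μ' := by
  rw [← roots_nodal, h, roots_nodal]

lemma sum_eq_of_nodal_eq {μ μ' : Fin n → ℝ} (h : Lagrange.nodal univ μ = Lagrange.nodal univ μ')
    (g : ℝ → ℝ) : ∑ i, g (μ i) = ∑ i, g (μ' i) := by
  have := congrArg (fun s : Multiset ℝ => (s.map g).sum) (map_eq_of_nodal_eq h)
  simp only [Multiset.map_map] at this
  exact this

lemma quadCoeff_congr {μ μ' : Fin n → ℝ} (h : Lagrange.nodal univ μ = Lagrange.nodal univ μ')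
    (P : ℝ[X]) (t : ℝ) : quadCoeff P μ t = quadCoeff P μ' t := by
  have := sum_eq_of_nodal_eq h fun s => if s = t then 0
    else ((P.derivative.eval s * (s - t))⁻¹) ^ 2
  simp only [quadCoeff, this]

lemma gaussScalar_congr {μ μ' : Fin n → ℝ}
    (h : Lagrange.nodal univ μ = Lagrange.nodal univ μ') : gaussScalar μ = gaussScalar μ' := by
  rw [gaussScalar_eq, gaussScalar_eq, sum_eq_of_nodal_eq h fun t => t ^ 2,
    sum_eq_of_nodal_eq h fun t => t]

/-! ### The shape operator in charts -/

section Hypersurface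

variable {M : Type*} [TopologicalSpace M] [ChartedSpace (EuclideanSpace ℝ (Fin n)) M]
  [IsManifold (𝓡 n) ∞ M] {f : M → UnitSphere n}
  {ν : M → EuclideanSpace ℝ (Fin (n + 1 + 1))}

lemma diffAt_self {V : Type*} [NormedAddCommGroup V] [NormedSpace ℝ V] {u : M → V}
    (hu : ContMDiff (𝓡 n) 𝓘(ℝ, V) ∞ u) (q : M) :
    diffAt u q = fderiv ℝ (u ∘ (extChartAt (𝓡 n) q).symm) (extChartAt (𝓡 n) q q) := by
  rw [diffAt_eq (mem_extChartAt_source q) (hu.mdifferentiableAt (by simp)), chartDeriv_self,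
    ContinuousLinearMap.comp_id]

/-- The preferred chart at q has identity differential at q, so the two definitions use the same
linear maps. -/
lemma shapeOperator_eq_shape (hf : IsHypersurface f) (hν : IsUnitNormal f ν) (q : M) :
    shapeOperator f ν q = shape (chartPos f q) (chartNormal ν q) (extChartAt (𝓡 n) q q) := by
  have h1 : differential (position f) q
      = (fderiv ℝ (chartPos f q) (extChartAt (𝓡 n) q q)).toLinearMap :=
    congrArg ContinuousLinearMap.toLinearMap (diffAt_self hf.contMDiff_position q)
  have h2 : differential ν q
      = (fderiv ℝ (chartNormal ν q) (extChartAt (𝓡 n) q q)).toLinearMap :=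
    congrArg ContinuousLinearMap.toLinearMap (diffAt_self hν.contMDiff q)
  rw [shapeOperator, h1, h2, shape]

lemma diffAt_shapeOperator (hf : IsHypersurface f) (hν : IsUnitNormal f ν) (q : M) (v : Dom n) :
    diffAt (position f) q (shapeOperator f ν q v) = -diffAt ν q v := by
  rw [diffAt_self hf.contMDiff_position, diffAt_self hν.contMDiff, shapeOperator_eq_shape hf hν]
  exact (hf.isLocalHypersurface hν q).fderiv_shape (mem_extChartAt_target q) v

lemma chartDeriv_shapeOperator (hf : IsHypersurface f) (hν : IsUnitNormal f ν) {p q : M}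
    (hq : q ∈ (extChartAt (𝓡 n) p).source) (v : Dom n) :
    shape (chartPos f p) (chartNormal ν p) (extChartAt (𝓡 n) p q) (chartDeriv p q v)
      = chartDeriv p q (shapeOperator f ν q v) := by
  have hx := (extChartAt (𝓡 n) p).map_source hq
  have hl := hf.isLocalHypersurface hν p
  refine hl.injective_fderiv _ hx ?_
  have h1 := diffAt_chart hf.contMDiff_position hq (shapeOperator f ν q v)
  have h2 := diffAt_chart hν.contMDiff hq v
  rw [hl.fderiv_shape hx]
  exact (congrArg Neg.neg h2).trans ((diffAt_shapeOperator hf hν q v).symm.trans h1.symm)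

lemma exists_isEigenframe_shapeOperator (hf : IsHypersurface f) (hν : IsUnitNormal f ν) (q : M) :
    ∃ ε μ, IsEigenframe (diffAt (position f) q) (shapeOperator f ν q) ε μ := by
  refine exists_isEigenframe (hf.injective_diffAt q) fun v w => ?_
  have h := (hf.isLocalHypersurface hν q).shape_symm (mem_extChartAt_target q) v w
  rw [diffAt_shapeOperator hf hν, diffAt_shapeOperator hf hν, diffAt_self hf.contMDiff_position,
    diffAt_self hν.contMDiff, inner_neg_left, inner_neg_right, real_inner_comm]
  exact congrArg Neg.neg h

lemma scalarCurvature_eq (hf : IsHypersurface f) (hν : IsUnitNormal f ν) {q : M}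
    {ε : Fin n → Dom n} {μ : Fin n → ℝ}
    (h : IsEigenframe (diffAt (position f) q) (shapeOperator f ν q) ε μ) :
    scalarCurvature f q = gaussScalar μ := by
  have h1 := (hf.isLocalHypersurface hν q).scalarCurvatureCoord_gramCoord
    (mem_extChartAt_target q) (shapeOperator f ν q) fun v => by
      rw [shapeOperator_eq_shape hf hν]
      exact (hf.isLocalHypersurface hν q).fderiv_shape (mem_extChartAt_target q) v
  rw [h.trace_eq, h.trace_sq_eq, ← gaussScalar_eq] at h1
  exact h1

end Hypersurface

end SphereHypersurface

end

noncomputable section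

open Finset Polynomial

namespace SphereHypersurface

variable {n : ℕ}

/-! ### Glaeser's inequality -/

section Glaeser

/-- The derivative of a nonnegative `C²` function is bounded by its square root. -/
lemma exists_sq_fderiv_le {E : Type*} [NormedAddCommGroup E] [NormedSpace ℝ E] {u : E → ℝ}
    {x₀ : E} (hu : ContDiffAt ℝ 2 u x₀) (h0 : ∀ᶠ y in nhds x₀, 0 ≤ u y) :
    ∃ C, 0 ≤ C ∧ ∀ᶠ y in nhds x₀, ∀ v, (fderiv ℝ u y v) ^ 2 ≤ C * u y * ‖v‖ ^ 2 := by
  have hd1 : ContDiffAt ℝ 1 (fderiv ℝ u) x₀ := hu.fderiv_right (by norm_num)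
  obtain ⟨K, t, ht, hK⟩ := hd1.exists_lipschitzOnWith
  set D : ℝ := ‖fderiv ℝ u x₀‖ + 1 with hD
  have hDev : ∀ᶠ y in nhds x₀, ‖fderiv ℝ u y‖ < D :=
    hd1.continuousAt.norm.eventually_lt_const (lt_add_one _)
  have hdiff : ∀ᶠ y in nhds x₀, DifferentiableAt ℝ u y := by
    filter_upwards [hu.eventually (by simp)] with y hy
    exact hy.differentiableAt (by simp)
  obtain ⟨r, hr, hball⟩ := Metric.eventually_nhds_iff_ball.1
    (((h0.and hdiff).and hDev).and (Filter.eventually_mem_set.2 ht))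
  have hDpos : 0 < D := by positivity
  have hK0 : (0 : ℝ) ≤ K := K.2
  -- The first bound keeps y + w in the ball of radius r; the second makes the Taylor remainder at
  -- most half of the linear decrease.
  set s : ℝ := min (r / (4 * D)) (1 / (2 * (K + 1))) with hs
  have hspos : 0 < s := lt_min (by positivity) (by positivity)
  refine ⟨2 / s, by positivity, ?_⟩
  filter_upwards [Metric.ball_mem_nhds x₀ (half_pos hr)] with y hy v
  have hyr : y ∈ Metric.ball x₀ r := Metric.ball_subset_ball (by linarith) hy
  rcases eq_or_ne v 0 with rfl | hv
  · simp
  have hvn : 0 < ‖v‖ := norm_pos_iff.2 hv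
  set m : ℝ := fderiv ℝ u y v with hm
  -- A step in the descent direction: 0 ≤ u(y + w) then bounds the slope m by u(y).
  set w : E := -(s * m / ‖v‖ ^ 2) • v with hw
  have hmD : |m| ≤ D * ‖v‖ :=
    ((fderiv ℝ u y).le_opNorm v).trans
      (mul_le_mul_of_nonneg_right (hball y hyr).1.2.le hvn.le)
  have hwn : ‖w‖ = s * |m| / ‖v‖ := by
    rw [hw, norm_smul, Real.norm_eq_abs, abs_neg, abs_div, abs_mul, abs_of_pos hspos,
      abs_of_pos (by positivity : 0 < ‖v‖ ^ 2)]
    field_simp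
  have hwr : ‖w‖ ≤ r / 4 := by
    rw [hwn, div_le_iff₀ hvn]
    calc s * |m| ≤ r / (4 * D) * (D * ‖v‖) :=
          mul_le_mul (min_le_left _ _) hmD (abs_nonneg _) (by positivity)
      _ = r / 4 * ‖v‖ := by field_simp
  have hsub : Metric.closedBall y ‖w‖ ⊆ Metric.ball x₀ r := by
    intro z hz
    rw [Metric.mem_closedBall] at hz
    rw [Metric.mem_ball] at hy ⊢
    linarith [dist_triangle z y x₀]
  have hyw : y + w ∈ Metric.closedBall y ‖w‖ := by simp
  have hmain := Convex.norm_image_sub_le_of_norm_hasFDerivWithin_le' (𝕜 := ℝ) (f := u)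
    (f' := fderiv ℝ u) (φ := fderiv ℝ u y) (C := K * ‖w‖) (s := Metric.closedBall y ‖w‖)
    (fun z hz => (hball z (hsub hz)).1.1.2.hasFDerivAt.hasFDerivWithinAt)
    (fun z hz => by
      have := hK.dist_le_mul z (hball z (hsub hz)).2 y (hball y hyr).2
      rw [dist_eq_norm] at this
      exact this.trans (mul_le_mul_of_nonneg_left hz hK0))
    (convex_closedBall y ‖w‖) (Metric.mem_closedBall_self (norm_nonneg w)) hyw
  rw [add_sub_cancel_left, Real.norm_eq_abs] at hmain
  have h1 := (abs_le.1 hmain).2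
  have h2 : 0 ≤ u (y + w) := (hball _ (hsub hyw)).1.1.1
  have h3 : fderiv ℝ u y w = -(s * m / ‖v‖ ^ 2) * m := by
    rw [hw, map_smul, smul_eq_mul]
  rw [h3, hwn] at h1
  have h4 : K * s ≤ 1 / 2 := by
    calc K * s ≤ K * (1 / (2 * (K + 1))) := mul_le_mul_of_nonneg_left (min_le_right _ _) hK0
      _ ≤ 1 / 2 := by
        rw [mul_one_div, div_le_div_iff₀ (by positivity) (by positivity)]
        linarith
  have h5 : 0 ≤ u y - s * (m ^ 2 / ‖v‖ ^ 2) + K * s * s * (m ^ 2 / ‖v‖ ^ 2) := by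
    have h6 : -(s * m / ‖v‖ ^ 2) * m = -(s * (m ^ 2 / ‖v‖ ^ 2)) := by ring
    have h7 : K * (s * |m| / ‖v‖) * (s * |m| / ‖v‖) = K * s * s * (m ^ 2 / ‖v‖ ^ 2) := by
      rw [← sq_abs m]
      ring
    rw [h6, h7] at h1
    linarith
  have hq : 0 ≤ m ^ 2 / ‖v‖ ^ 2 := by positivity
  have h8 : K * s * s * (m ^ 2 / ‖v‖ ^ 2) ≤ 1 / 2 * s * (m ^ 2 / ‖v‖ ^ 2) := by gcongr
  have h9 : s / 2 * (m ^ 2 / ‖v‖ ^ 2) ≤ u y := by linarith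
  have h10 : m ^ 2 / ‖v‖ ^ 2 ≤ 2 / s * u y := by
    calc m ^ 2 / ‖v‖ ^ 2 = 2 / s * (s / 2 * (m ^ 2 / ‖v‖ ^ 2)) := by field_simp
      _ ≤ _ := by gcongr
  rwa [div_le_iff₀ (by positivity)] at h10

/-- An injective linear map in finite dimension is bounded below with some constant 1/K; a
perturbation smaller than 1/(2K) loses at most half of the bound. -/
lemma exists_le_norm_of_injective {A : Dom n → Dom n →L[ℝ] Amb n} {x₀ : Dom n}
    (hA : ContinuousAt A x₀) (hinj : Function.Injective (A x₀)) :
    ∃ κ : ℝ, 0 < κ ∧ ∀ᶠ y in nhds x₀, ∀ w, ‖w‖ ≤ κ * ‖A y w‖ := by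
  obtain ⟨K, hK, hKA⟩ := (A x₀).toLinearMap.exists_antilipschitzWith
    (LinearMap.ker_eq_bot.2 hinj)
  have hK' : (0 : ℝ) < K := hK
  have hev : ∀ᶠ y in nhds x₀, ‖A y - A x₀‖ < 1 / (2 * K) := by
    have := Metric.continuousAt_iff'.1 hA (1 / (2 * K)) (by positivity)
    filter_upwards [this] with y hy
    rwa [← dist_eq_norm]
  refine ⟨2 * K, by positivity, ?_⟩
  filter_upwards [hev] with y hy w
  have h1 : ‖w‖ ≤ K * ‖A x₀ w‖ := by
    have := hKA.le_mul_dist w 0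
    simpa using this
  have h2 : ‖A x₀ w‖ ≤ ‖A y w‖ + 1 / (2 * K) * ‖w‖ := by
    have h3 : A x₀ w = A y w - (A y - A x₀) w := by simp
    rw [h3]
    refine (norm_sub_le _ _).trans (add_le_add_right ?_ _)
    exact ((A y - A x₀).le_opNorm w).trans (mul_le_mul_of_nonneg_right hy.le (norm_nonneg w))
  have h4 : K * ‖A x₀ w‖ ≤ K * (‖A y w‖ + 1 / (2 * K) * ‖w‖) :=
    mul_le_mul_of_nonneg_left h2 hK'.le
  have h5 : K * (‖A y w‖ + 1 / (2 * K) * ‖w‖) = K * ‖A y w‖ + ‖w‖ / 2 := by field_simp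
  linarith

variable {M : Type*} [TopologicalSpace M] [ChartedSpace (EuclideanSpace ℝ (Fin n)) M]
  [IsManifold (𝓡 n) ∞ M] {f : M → UnitSphere n}

/-- Glaeser's inequality is local: `exists_le_norm_of_injective` compares the coordinate norm with
the induced metric, and compactness yields one constant. -/
lemma exists_sq_diffAt_le [CompactSpace M] (hf : IsHypersurface f) {g : M → ℝ}
    (hg : ContMDiff (𝓡 n) 𝓘(ℝ, ℝ) ∞ g) (hg0 : ∀ q, 0 ≤ g q) :
    ∃ C, 0 ≤ C ∧ ∀ q v, ‖diffAt (n := n) (position f) q v‖ = 1 → (diffAt g q v) ^ 2 ≤ C * g q := by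
  have key : ∃ C, 0 ≤ C ∧ ∀ q ∈ (Set.univ : Set M), ∀ v,
      ‖diffAt (n := n) (position f) q v‖ = 1 → (diffAt g q v) ^ 2 ≤ C * g q := by
    refine isCompact_univ.induction_on
      (p := fun s => ∃ C, 0 ≤ C ∧ ∀ q ∈ s, ∀ v,
        ‖diffAt (n := n) (position f) q v‖ = 1 → (diffAt g q v) ^ 2 ≤ C * g q)
      ⟨0, le_rfl, by simp⟩ ?_ ?_ ?_
    · rintro s t hst ⟨C, hC, h⟩
      exact ⟨C, hC, fun q hq => h q (hst hq)⟩
    · rintro s t ⟨C, hC, h⟩ ⟨C', hC', h'⟩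
      refine ⟨max C C', le_max_of_le_left hC, ?_⟩
      rintro q (hq | hq) v hv
      · exact (h q hq v hv).trans (mul_le_mul_of_nonneg_right (le_max_left _ _) (hg0 q))
      · exact (h' q hq v hv).trans (mul_le_mul_of_nonneg_right (le_max_right _ _) (hg0 q))
    · intro p _
      have hT := (isOpen_extChartAt_target (I := 𝓡 n) p).mem_nhds (mem_extChartAt_target p)
      have hF := contDiffOn_comp_chart_symm hf.contMDiff_position p
      obtain ⟨C, hC, h1⟩ := exists_sq_fderiv_le
        (((contDiffOn_comp_chart_symm hg p).contDiffAt hT).of_le ENat.LEInfty.out)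
        (Filter.Eventually.of_forall fun y => hg0 _)
      obtain ⟨κ, hκ, h2⟩ := exists_le_norm_of_injective
        (A := fderiv ℝ (position f ∘ (extChartAt (𝓡 n) p).symm))
        ((hF.continuousOn_fderiv_of_isOpen (isOpen_extChartAt_target p) (by simp)).continuousAt hT)
        (by
          rw [← diffAt_self hf.contMDiff_position]
          exact hf.injective_diffAt p)
      have h3 := (continuousAt_extChartAt (I := 𝓡 n) p).eventually (h1.and h2)
      refine ⟨_, mem_nhdsWithin_of_mem_nhds
        (h3.and (extChartAt_source_mem_nhds (I := 𝓡 n) p)), C * κ ^ 2, by positivity, ?_⟩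
      rintro q ⟨⟨hq1, hq2⟩, hq⟩ v hv
      have h4 := hq1 (chartDeriv p q v)
      have h5 := hq2 (chartDeriv p q v)
      rw [diffAt_chart hf.contMDiff_position hq, hv, mul_one] at h5
      rw [diffAt_chart hg hq, Function.comp_apply, (extChartAt (𝓡 n) p).left_inv hq] at h4
      calc (diffAt g q v) ^ 2 ≤ C * g q * ‖chartDeriv p q v‖ ^ 2 := h4
        _ ≤ C * g q * κ ^ 2 := by
          have := hg0 q
          gcongr
        _ = C * κ ^ 2 * g q := by ring
  obtain ⟨C, hC, h⟩ := key
  exact ⟨C, hC, fun q => h q (Set.mem_univ q)⟩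

end Glaeser

/-! ### Hypersurfaces whose characteristic polynomials differ by constants -/

section Level

variable {M : Type*} [TopologicalSpace M] [ChartedSpace (EuclideanSpace ℝ (Fin n)) M]
  [IsManifold (𝓡 n) ∞ M]

/-- The characteristic polynomial of the shape operator is `P - c` for a function `c`, the scalar
curvature is `R`, and `ε`, `μ` are principal directions and curvatures. -/
structure IsLevelHypersurface (f : M → UnitSphere n) (ν : M → EuclideanSpace ℝ (Fin (n + 1 + 1)))
    (P : ℝ[X]) (c : M → ℝ) (ε : M → Fin n → Dom n) (μ : M → Fin n → ℝ) (R : ℝ) : Prop where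
  isHypersurface : IsHypersurface f
  isUnitNormal : IsUnitNormal f ν
  isEigenframe : ∀ q, IsEigenframe (diffAt (position f) q) (shapeOperator f ν q) (ε q) (μ q)
  contMDiff : ContMDiff (𝓡 n) 𝓘(ℝ, ℝ) ∞ c
  eq_nodal : ∀ q, P - C (c q) = Lagrange.nodal univ (μ q)
  gaussScalar_eq : ∀ q, gaussScalar (μ q) = R

/-- The vector field `ψ(c) ∑ ∇_{e_i} e_i` in terms of principal directions and curvatures. -/
def levelField (P : ℝ[X]) (c : M → ℝ) (ε : M → Fin n → Dom n) (μ : M → Fin n → ℝ) (ψ : ℝ → ℝ)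
    (q : M) : Dom n :=
  ∑ j, (ψ (c q) * (accelCoeff P (μ q j) * diffAt c q (ε q j))) • ε q j

/-- The derivative of `c` in the direction of `∑ ∇_{e_i} e_i`. -/
def levelSlope (P : ℝ[X]) (c : M → ℝ) (ε : M → Fin n → Dom n) (μ : M → Fin n → ℝ) (q : M) : ℝ :=
  ∑ j, accelCoeff P (μ q j) * diffAt c q (ε q j) ^ 2

/-- The divergence of `∑ ∇_{e_i} e_i`. -/
def levelDiv (P : ℝ[X]) (c : M → ℝ) (ε : M → Fin n → Dom n) (μ : M → Fin n → ℝ) (R : ℝ)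
    (q : M) : ℝ :=
  (R - ∑ j, quadCoeff P (μ q) (μ q j) * diffAt c q (ε q j) ^ 2) / 2

variable {f : M → UnitSphere n} {ν : M → EuclideanSpace ℝ (Fin (n + 1 + 1))}

lemma isEigenframe_chart (hf : IsHypersurface f) (hν : IsUnitNormal f ν) {p q : M}
    (hq : q ∈ (extChartAt (𝓡 n) p).source) {ε : Fin n → Dom n} {μ : Fin n → ℝ}
    (h : IsEigenframe (diffAt (position f) q) (shapeOperator f ν q) ε μ) :
    IsEigenframe (fderiv ℝ (chartPos f p) (extChartAt (𝓡 n) p q))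
      (shape (chartPos f p) (chartNormal ν p) (extChartAt (𝓡 n) p q))
      (fun i => chartDeriv p q (ε i)) μ :=
  h.comp (fun v => diffAt_chart hf.contMDiff_position hq v)
    fun v => chartDeriv_shapeOperator hf hν hq v

namespace IsLevelHypersurface

variable {P : ℝ[X]} {c : M → ℝ} {ε : M → Fin n → Dom n} {μ : M → Fin n → ℝ} {R : ℝ}

lemma charpoly_shape (h : IsLevelHypersurface f ν P c ε μ R) {p : M} {x : Dom n}
    (hx : x ∈ (extChartAt (𝓡 n) p).target) :
    (shape (chartPos f p) (chartNormal ν p) x).charpoly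
      = P - C ((c ∘ (extChartAt (𝓡 n) p).symm) x) := by
  have h1 := (isEigenframe_chart h.isHypersurface h.isUnitNormal
    ((extChartAt (𝓡 n) p).map_target hx) (h.isEigenframe _)).charpoly_eq
  rw [(extChartAt (𝓡 n) p).right_inv hx] at h1
  rw [h1, ← h.eq_nodal]
  rfl

lemma exists_levelFrame (h : IsLevelHypersurface f ν P c ε μ R) {p : M} {x : Dom n}
    (hx : x ∈ (extChartAt (𝓡 n) p).target)
    (hμ : Function.Injective (μ ((extChartAt (𝓡 n) p).symm x))) :
    ∃ V e lam, V ⊆ (extChartAt (𝓡 n) p).target ∧ x ∈ V ∧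
      IsLevelFrame V (chartPos f p) (chartNormal ν p) e lam P (c ∘ (extChartAt (𝓡 n) p).symm) ∧
      ∀ y ∈ V, IsEigenframe (fderiv ℝ (chartPos f p) y)
        (shape (chartPos f p) (chartNormal ν p) y) (fun i => e i y) fun i => lam i y := by
  have hc := contDiffOn_comp_chart_symm h.contMDiff p
  obtain ⟨V, e, lam, hVU, hxV, hfr, hinj, hnod, heig⟩ :=
    (h.isHypersurface.isLocalHypersurface h.isUnitNormal p).exists_principalFrame hc
      (fun y hy => h.charpoly_shape hy) hx hμ ((h.charpoly_shape hx).trans (h.eq_nodal _))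
  exact ⟨V, e, lam, hVU, hxV,
    { toIsPrincipalFrame := hfr
      contDiffOn_level := hc.mono hVU
      injective := hinj
      eq_nodal := hnod },
    fun y hy => ⟨hfr.inner_frame y hy, heig y hy⟩⟩

end IsLevelHypersurface

end Level

end SphereHypersurface

end

noncomputable section

open Finset Polynomial

namespace SphereHypersurface

variable {n : ℕ}

/-! ### The divergence of the cut-off field, and comparison of levels by Laguerre's inequality -/

section Level

variable {M : Type*} [TopologicalSpace M] [ChartedSpace (EuclideanSpace ℝ (Fin n)) M]
  [IsManifold (𝓡 n) ∞ M]

variable {f : M → UnitSphere n} {ν : M → EuclideanSpace ℝ (Fin (n + 1 + 1))}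

namespace IsLevelHypersurface

variable {P : ℝ[X]} {c : M → ℝ} {ε : M → Fin n → Dom n} {μ : M → Fin n → ℝ} {R : ℝ}

/-- The eigenframes ε are chosen point by point and need not be continuous. All three expressions
are functions of the shape operator contracted with dc, so by `IsEigenframe.sum_smul_eq` they can be
computed in the smooth local frame. -/
lemma chartField_levelField (h : IsLevelHypersurface f ν P c ε μ R) (ψ : ℝ → ℝ) {p : M}
    {V : Set (Dom n)} {e : Fin n → Dom n → Dom n} {lam : Fin n → Dom n → ℝ}
    (hV : V ⊆ (extChartAt (𝓡 n) p).target)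
    (heig : ∀ y ∈ V, IsEigenframe (fderiv ℝ (chartPos f p) y)
        (shape (chartPos f p) (chartNormal ν p) y) (fun i => e i y) fun i => lam i y)
    {y : Dom n} (hy : y ∈ V) :
    chartField (levelField P c ε μ ψ) p y
      = IsLevelFrame.field e lam P (c ∘ (extChartAt (𝓡 n) p).symm)
        (ψ ∘ c ∘ (extChartAt (𝓡 n) p).symm) y ∧
    levelSlope P c ε μ ((extChartAt (𝓡 n) p).symm y)
      = ∑ j, accelCoeff P (lam j y)
        * fderiv ℝ (c ∘ (extChartAt (𝓡 n) p).symm) y (e j y) ^ 2 ∧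
    ∀ P, ∑ j, quadCoeff P (μ ((extChartAt (𝓡 n) p).symm y)) (μ ((extChartAt (𝓡 n) p).symm y) j)
        * diffAt c ((extChartAt (𝓡 n) p).symm y) (ε ((extChartAt (𝓡 n) p).symm y) j) ^ 2
      = ∑ j, quadCoeff P (fun i => lam i y) (lam j y)
        * fderiv ℝ (c ∘ (extChartAt (𝓡 n) p).symm) y (e j y) ^ 2 := by
  set q := (extChartAt (𝓡 n) p).symm y with hqdef
  set u := c ∘ (extChartAt (𝓡 n) p).symm with hu
  have hq : q ∈ (extChartAt (𝓡 n) p).source := (extChartAt (𝓡 n) p).map_target (hV hy)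
  have hqy : extChartAt (𝓡 n) p q = y := (extChartAt (𝓡 n) p).right_inv (hV hy)
  have h1 := isEigenframe_chart h.isHypersurface h.isUnitNormal hq (h.isEigenframe q)
  rw [hqy] at h1
  have hd : ∀ v, fderiv ℝ u y (chartDeriv p q v) = diffAt c q v := fun v => by
    have := diffAt_chart h.contMDiff hq v
    rwa [hqy] at this
  have hnod := h1.charpoly_eq.symm.trans (heig y hy).charpoly_eq
  have hsum : ∀ w : ℝ → ℝ, ∑ j, w (μ q j) * diffAt c q (ε q j) ^ 2
      = ∑ j, w (lam j y) * fderiv ℝ u y (e j y) ^ 2 := by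
    intro w
    have := congrArg (fderiv ℝ u y) (h1.sum_smul_eq (heig y hy) w (fderiv ℝ u y).toLinearMap)
    simp only [map_sum, map_smul, smul_eq_mul, ContinuousLinearMap.coe_coe, hd] at this
    simpa only [sq, mul_assoc] using this
  refine ⟨?_, hsum (accelCoeff P), fun P => ?_⟩
  · have hsm := h1.sum_smul_eq (heig y hy) (accelCoeff P) (fderiv ℝ u y).toLinearMap
    simp only [ContinuousLinearMap.coe_coe, hd] at hsm
    have hl : chartField (levelField P c ε μ ψ) p y
        = ψ (c q) • ∑ j, (accelCoeff P (μ q j) * diffAt c q (ε q j)) • chartDeriv p q (ε q j) := by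
      change chartDeriv p q (levelField P c ε μ ψ q) = _
      simp only [levelField, map_sum, map_smul, Finset.smul_sum, smul_smul]
    rw [hl, hsm, IsLevelFrame.field, Finset.smul_sum]
    refine Finset.sum_congr rfl fun j _ => ?_
    rw [smul_smul]
    rfl
  · rw [hsum fun t => quadCoeff P (μ q) t]
    refine Finset.sum_congr rfl fun j _ => ?_
    rw [quadCoeff_congr hnod]

/-- The divergence of the field `ψ(c) ∑ ∇_{e_i} e_i`. -/
theorem hasDivergence_levelField (h : IsLevelHypersurface f ν P c ε μ R) (hn : 2 ≤ n) {ψ : ℝ → ℝ}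
    (hψ : ContDiff ℝ ∞ ψ) (hψμ : ∀ q, c q ∈ tsupport ψ → Function.Injective (μ q)) :
    HasDivergence f (levelField P c ε μ ψ)
      fun q => deriv ψ (c q) * levelSlope P c ε μ q + ψ (c q) * levelDiv P c ε μ R q := by
  have key : ∀ p, ∀ x ∈ (extChartAt (𝓡 n) p).target,
      ContDiffAt ℝ 1 (fun x => chartDensity f p x • chartField (levelField P c ε μ ψ) p x) x ∧
      divergence (fun x => chartDensity f p x • chartField (levelField P c ε μ ψ) p x) x
        = chartDensity f p x * (deriv ψ (c ((extChartAt (𝓡 n) p).symm x))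
          * levelSlope P c ε μ ((extChartAt (𝓡 n) p).symm x)
          + ψ (c ((extChartAt (𝓡 n) p).symm x))
          * levelDiv P c ε μ R ((extChartAt (𝓡 n) p).symm x)) := by
    intro p x hx
    have hTo := isOpen_extChartAt_target (I := 𝓡 n) p
    set u := c ∘ (extChartAt (𝓡 n) p).symm with hu
    have huC : ContDiffOn ℝ ∞ u (extChartAt (𝓡 n) p).target :=
      contDiffOn_comp_chart_symm h.contMDiff p
    -- On the support of ψ the roots are simple and a smooth frame exists; off the support the field
    -- vanishes near x, however the eigenframes behave there.
    by_cases hs : u x ∈ tsupport ψ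
    · obtain ⟨V, e, lam, hVT, hxV, hfr, heig⟩ := h.exists_levelFrame hx (hψμ _ hs)
      have hev : (fun x => chartDensity f p x • chartField (levelField P c ε μ ψ) p x)
          =ᶠ[nhds x] fun y => density (fderiv ℝ (chartPos f p) y)
            • IsLevelFrame.field e lam P u (ψ ∘ u) y := by
        filter_upwards [hfr.isOpen.mem_nhds hxV] with y hy
        rw [(h.chartField_levelField ψ hVT heig hy).1]
        rfl
      have hφ : ContDiffOn ℝ ∞ (ψ ∘ u) V := hψ.comp_contDiffOn (huC.mono hVT)
      have hφd : DifferentiableAt ℝ (ψ ∘ u) x := differentiableAt_of_contDiffOn hfr.isOpen hφ hxV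
      constructor
      · exact (((hfr.contDiffOn_density_smul_field hφ).of_le (by simp)).contDiffAt
          (hfr.isOpen.mem_nhds hxV)).congr_of_eventuallyEq hev
      · have h1 : divergence (fun x => chartDensity f p x • chartField (levelField P c ε μ ψ) p x) x
            = divergence (fun y => density (fderiv ℝ (chartPos f p) y)
            • IsLevelFrame.field e lam P u (ψ ∘ u) y) x := by
          simp only [divergence, hev.fderiv_eq]
        obtain ⟨-, hsl, hqd⟩ := h.chartField_levelField ψ hVT heig hxV
        have hder : ∀ v, fderiv ℝ (ψ ∘ u) x v = deriv ψ (u x) * fderiv ℝ u x v := by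
          intro v
          have h2 := (hψ.differentiable (by simp) (u x)).hasDerivAt.comp_hasFDerivAt x
            (differentiableAt_of_contDiffOn hTo huC hx).hasFDerivAt
          rw [h2.fderiv]
          rfl
        have hnod : Lagrange.nodal univ (fun i => lam i x)
            = Lagrange.nodal univ (μ ((extChartAt (𝓡 n) p).symm x)) :=
          (hfr.eq_nodal x hxV).symm.trans (h.eq_nodal _)
        rw [h1, hfr.divergence_field hxV hn hφd, gaussScalar_congr hnod, h.gaussScalar_eq,
          levelDiv, hqd P, hsl]
        have h3 : ∑ j, fderiv ℝ (ψ ∘ u) x (e j x) * (accelCoeff P (lam j x) * fderiv ℝ u x (e j x))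
            = deriv ψ (u x) * ∑ j, accelCoeff P (lam j x) * fderiv ℝ u x (e j x) ^ 2 := by
          rw [Finset.mul_sum]
          refine Finset.sum_congr rfl fun j _ => ?_
          rw [hder]
          ring
        rw [h3]
        have h4 : c ((extChartAt (𝓡 n) p).symm x) = u x := rfl
        rw [h4, Function.comp_apply (f := ψ)]
        unfold chartDensity
        ring
    · have hev : ∀ᶠ y in nhds x, u y ∉ tsupport ψ :=
        (huC.continuousOn.continuousAt (hTo.mem_nhds hx)).eventually_mem
          ((isClosed_tsupport ψ).isOpen_compl.mem_nhds hs)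
      have hev2 : (fun x => chartDensity f p x • chartField (levelField P c ε μ ψ) p x)
          =ᶠ[nhds x] fun _ => 0 := by
        filter_upwards [hev] with y hy
        have h0 : ψ (c ((extChartAt (𝓡 n) p).symm y)) = 0 := image_eq_zero_of_notMem_tsupport hy
        simp [chartField, levelField, h0, -extChartAt]
      have h0 : ψ (c ((extChartAt (𝓡 n) p).symm x)) = 0 := image_eq_zero_of_notMem_tsupport hs
      have h1 : deriv ψ (c ((extChartAt (𝓡 n) p).symm x)) = 0 := by
        have : ψ =ᶠ[nhds (u x)] fun _ => 0 := notMem_tsupport_iff_eventuallyEq.1 hs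
        change deriv ψ (u x) = 0
        rw [this.deriv_eq]
        simp
      constructor
      · exact (contDiffAt_const (𝕜 := ℝ) (c := (0 : Dom n))).congr_of_eventuallyEq hev2
      · rw [h0, h1]
        simp only [divergence, hev2.fderiv_eq]
        simp
  exact ⟨fun p x hx => (key p x hx).1.contDiffWithinAt, fun p x hx => (key p x hx).2⟩

omit [IsManifold (𝓡 n) ∞ M] in
lemma eval_curvature (h : IsLevelHypersurface f ν P c ε μ R) (q : M) (j : Fin n) :
    P.eval (μ q j) = c q := by
  have := congrArg (eval (μ q j)) (h.eq_nodal q)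
  rw [Lagrange.eval_nodal_at_node (mem_univ j)] at this
  simp at this
  linarith

omit [IsManifold (𝓡 n) ∞ M] in
/-- Laguerre's inequality between two levels. -/
lemma mul_lt_sq (h : IsLevelHypersurface f ν P c ε μ R) (hn : n ≠ 0) {q q' : M}
    (hc : c q ≠ c q') (j : Fin n) :
    (c q - c q') * P.derivative.derivative.eval (μ q j) < P.derivative.eval (μ q j) ^ 2 := by
  set s : Multiset ℝ := univ.val.map (μ q') with hs
  -- Laguerre's inequality is applied to P - c(q'), which has the real roots μ q' and takes the
  -- value c(q) - c(q') at `μ q j`.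
  have hprod : (s.map fun a => X - C a).prod = P - C (c q') := by
    rw [h.eq_nodal, Lagrange.nodal, hs, Multiset.map_map]
    rfl
  have hev : (P - C (c q')).eval (μ q j) = c q - c q' := by simp [h.eval_curvature]
  have hs0 : s ≠ 0 := by
    rw [← Multiset.card_pos, hs]
    simp
    omega
  have := laguerre_pos s hs0 (μ q j) (by rw [hprod, hev]; exact sub_ne_zero.2 hc)
  rw [hprod, hev] at this
  simp only [derivative_sub, derivative_C, sub_zero] at this
  linarith

omit [IsManifold (𝓡 n) ∞ M] in
-- If P' vanished at this root, comparison with the lower level would force P'' < 0 there, and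
-- comparison with the higher level P'' > 0.
lemma eval_derivative_ne_zero (h : IsLevelHypersurface f ν P c ε μ R) (hn : n ≠ 0) {q q₁ q₂ : M}
    (h1 : c q₁ < c q) (h2 : c q < c q₂) (j : Fin n) : P.derivative.eval (μ q j) ≠ 0 := by
  intro h0
  have h3 := h.mul_lt_sq hn h1.ne' j
  have h4 := h.mul_lt_sq hn h2.ne j
  rw [h0] at h3 h4
  rcases le_total 0 (P.derivative.derivative.eval (μ q j)) with h5 | h5 <;> nlinarith

omit [IsManifold (𝓡 n) ∞ M] in
-- A repeated root of P - c(q) would be a zero of P'.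
lemma injective_curvature (h : IsLevelHypersurface f ν P c ε μ R) (hn : n ≠ 0) {q q₁ q₂ : M}
    (h1 : c q₁ < c q) (h2 : c q < c q₂) : Function.Injective (μ q) := by
  intro i j hij
  by_contra hne
  refine h.eval_derivative_ne_zero hn h1 h2 i ?_
  rw [derivative_eq_of_sub_C (h.eq_nodal q), Lagrange.eval_nodal_derivative_eval_node_eq
    (mem_univ i)]
  rw [Lagrange.eval_nodal]
  exact Finset.prod_eq_zero (Finset.mem_erase.2 ⟨fun h => hne h.symm, mem_univ j⟩) (by simp [hij])

omit [IsManifold (𝓡 n) ∞ M] in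
-- Laguerre's inequality divided by 2P'². The bounds are one-sided, but the sign of the cutoff's
-- derivative at each end makes that side the useful one.
lemma mul_accelCoeff_lt (h : IsLevelHypersurface f ν P c ε μ R) (hn : n ≠ 0) {q q₁ q₂ : M}
    (h1 : c q₁ < c q) (h2 : c q < c q₂) (j : Fin n) :
    (c q - c q₁) * accelCoeff P (μ q j) < 1 / 2 ∧
      (c q - c q₂) * accelCoeff P (μ q j) < 1 / 2 := by
  have h0 : 0 < P.derivative.eval (μ q j) ^ 2 := by
    have := h.eval_derivative_ne_zero hn h1 h2 j
    positivity
  have h3 := h.mul_lt_sq hn h1.ne' j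
  have h4 := h.mul_lt_sq hn h2.ne j
  constructor <;>
  · rw [accelCoeff, mul_div_assoc', div_lt_div_iff₀ (by positivity) two_pos]
    linarith

end IsLevelHypersurface

end Level

end SphereHypersurface

end

noncomputable section

open Finset Polynomial

namespace SphereHypersurface

variable {n : ℕ}

/-! ### Logarithmic cutoff functions -/

lemma deriv_smoothTransition_nonneg (x : ℝ) : 0 ≤ deriv Real.smoothTransition x :=
  Real.smoothTransition.monotone.deriv_nonneg

lemma exists_deriv_smoothTransition_le : ∃ D, ∀ x, deriv Real.smoothTransition x ≤ D := by
  have hc : Continuous (deriv Real.smoothTransition) :=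
    (Real.smoothTransition.contDiff (n := 1)).continuous_deriv le_rfl
  obtain ⟨D, hD⟩ := (isCompact_Icc (a := (0 : ℝ)) (b := 1)).bddAbove_image hc.continuousOn
  refine ⟨D, fun x => ?_⟩
  have h01 : 0 ≤ D := (deriv_smoothTransition_nonneg 0).trans (hD ⟨0, by simp, rfl⟩)
  by_cases hx : x ∈ Set.Icc (0 : ℝ) 1
  · exact hD ⟨x, hx, rfl⟩
  · rw [Set.mem_Icc, not_and_or, not_le, not_le] at hx
    rcases hx with hx | hx
    · have : Real.smoothTransition =ᶠ[nhds x] fun _ => 0 := by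
        filter_upwards [gt_mem_nhds hx] with y hy
        exact Real.smoothTransition.zero_of_nonpos hy.le
      simpa [this.deriv_eq] using h01
    · have : Real.smoothTransition =ᶠ[nhds x] fun _ => 1 := by
        filter_upwards [lt_mem_nhds hx] with y hy
        exact Real.smoothTransition.one_of_one_le hy.le
      simpa [this.deriv_eq] using h01

/-- A cutoff function that vanishes near the ends of `(a, b)`, on a logarithmic scale. -/
def logCutoff (a b K t : ℝ) : ℝ :=
  (Set.Ioo a b).indicator (fun t => Real.smoothTransition (2 + Real.log (b - t) / K)
    * Real.smoothTransition (2 + Real.log (t - a) / K)) t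

section LogCutoff

variable {a b K t : ℝ}

lemma logCutoff_of_mem (ht : t ∈ Set.Ioo a b) :
    logCutoff a b K t = Real.smoothTransition (2 + Real.log (b - t) / K)
      * Real.smoothTransition (2 + Real.log (t - a) / K) :=
  Set.indicator_of_mem ht _

lemma logCutoff_of_notMem (ht : t ∉ Set.Ioo a b) : logCutoff a b K t = 0 :=
  Set.indicator_of_notMem ht _

lemma smoothTransition_log_eq_zero (hK : 0 < K) {s : ℝ} (hs : 0 < s) (h : s ≤ Real.exp (-(2 * K))) :
    Real.smoothTransition (2 + Real.log s / K) = 0 := by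
  refine Real.smoothTransition.zero_of_nonpos ?_
  have h1 : Real.log s ≤ -(2 * K) := (Real.log_le_iff_le_exp hs).2 h
  have h2 : Real.log s / K ≤ -2 := by
    rw [div_le_iff₀ hK]
    linarith
  linarith

lemma smoothTransition_log_mono {K₀ : ℝ} (hK₀ : 0 < K₀) (hK : K₀ ≤ K) (s : ℝ) :
    Real.smoothTransition (2 + Real.log s / K₀) ≤ Real.smoothTransition (2 + Real.log s / K) := by
  have hKp := hK₀.trans_le hK
  rcases le_total 0 (Real.log s) with h | h
  · rw [Real.smoothTransition.one_of_one_le (x := 2 + Real.log s / K)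
      (by have := div_nonneg h hKp.le; linarith)]
    exact Real.smoothTransition.le_one _
  · refine Real.smoothTransition.monotone (add_le_add_right ?_ 2)
    rw [div_le_div_iff₀ hK₀ hKp]
    exact mul_le_mul_of_nonpos_left hK h

lemma logCutoff_nonneg : 0 ≤ logCutoff a b K t :=
  Set.indicator_nonneg (fun _ _ => mul_nonneg (Real.smoothTransition.nonneg _)
    (Real.smoothTransition.nonneg _)) t

/-- Monotonicity in K lets the main term for one fixed K₀ bound the main terms for all larger K from
below. -/
lemma logCutoff_mono {K₀ : ℝ} (hK₀ : 0 < K₀) (hK : K₀ ≤ K) :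
    logCutoff a b K₀ t ≤ logCutoff a b K t := by
  by_cases ht : t ∈ Set.Ioo a b
  · rw [logCutoff_of_mem ht, logCutoff_of_mem ht]
    exact mul_le_mul (smoothTransition_log_mono hK₀ hK _) (smoothTransition_log_mono hK₀ hK _)
      (Real.smoothTransition.nonneg _) (Real.smoothTransition.nonneg _)
  · rw [logCutoff_of_notMem ht, logCutoff_of_notMem ht]

lemma logCutoff_eq_zero (hK : 0 < K)
    (ht : t ∉ Set.Icc (a + Real.exp (-(2 * K))) (b - Real.exp (-(2 * K)))) :
    logCutoff a b K t = 0 := by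
  by_cases h : t ∈ Set.Ioo a b
  · rw [logCutoff_of_mem h]
    rw [Set.mem_Icc, not_and_or, not_le, not_le] at ht
    rcases ht with ht | ht
    · rw [smoothTransition_log_eq_zero hK (s := t - a) (sub_pos.2 h.1) (by linarith), mul_zero]
    · rw [smoothTransition_log_eq_zero hK (s := b - t) (sub_pos.2 h.2) (by linarith), zero_mul]
  · exact logCutoff_of_notMem h

lemma tsupport_logCutoff (hK : 0 < K) :
    tsupport (logCutoff a b K) ⊆ Set.Icc (a + Real.exp (-(2 * K))) (b - Real.exp (-(2 * K))) :=
  closure_minimal (fun _ ht => by_contra fun h => ht (logCutoff_eq_zero hK h)) isClosed_Icc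

lemma tsupport_logCutoff_subset (hK : 0 < K) : tsupport (logCutoff a b K) ⊆ Set.Ioo a b := by
  intro t ht
  have h := tsupport_logCutoff hK ht
  have h0 := Real.exp_pos (-(2 * K))
  exact ⟨by linarith [h.1], by linarith [h.2]⟩

lemma contDiff_logCutoff (hK : 0 < K) : ContDiff ℝ ∞ (logCutoff a b K) := by
  refine contDiff_iff_contDiffAt.2 fun t => ?_
  by_cases ht : t ∈ tsupport (logCutoff a b K)
  · have ht' := tsupport_logCutoff_subset hK ht
    have hev : logCutoff a b K =ᶠ[nhds t] fun t => Real.smoothTransition (2 + Real.log (b - t) / K)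
        * Real.smoothTransition (2 + Real.log (t - a) / K) := by
      filter_upwards [isOpen_Ioo.mem_nhds ht'] with s hs
      exact logCutoff_of_mem hs
    refine ContDiffAt.congr_of_eventuallyEq ?_ hev
    have h1 : b - t ≠ 0 := (sub_pos.2 ht'.2).ne'
    have h2 : t - a ≠ 0 := (sub_pos.2 ht'.1).ne'
    refine ContDiffAt.mul ?_ ?_
    · exact Real.smoothTransition.contDiffAt.comp t (contDiffAt_const.add
        (((contDiffAt_const.sub contDiffAt_id).log h1).div_const K))
    · exact Real.smoothTransition.contDiffAt.comp t (contDiffAt_const.add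
        (((contDiffAt_id.sub contDiffAt_const).log h2).div_const K))
  · exact (contDiffAt_const (c := (0 : ℝ))).congr_of_eventuallyEq
      (notMem_tsupport_iff_eventuallyEq.1 ht)

lemma deriv_logCutoff (ht : t ∈ Set.Ioo a b) :
    deriv (logCutoff a b K) t
      = deriv Real.smoothTransition (2 + Real.log (b - t) / K) * (-1 / (b - t) / K)
          * Real.smoothTransition (2 + Real.log (t - a) / K)
        + Real.smoothTransition (2 + Real.log (b - t) / K)
          * (deriv Real.smoothTransition (2 + Real.log (t - a) / K) * (1 / (t - a) / K)) := by
  have hev : logCutoff a b K =ᶠ[nhds t] fun t => Real.smoothTransition (2 + Real.log (b - t) / K)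
      * Real.smoothTransition (2 + Real.log (t - a) / K) := by
    filter_upwards [isOpen_Ioo.mem_nhds ht] with s hs
    exact logCutoff_of_mem hs
  have hd : ∀ x, HasDerivAt Real.smoothTransition (deriv Real.smoothTransition x) x := fun x =>
    ((Real.smoothTransition.contDiff (n := 1)).differentiable one_ne_zero x).hasDerivAt
  have h1 : b - t ≠ 0 := (sub_pos.2 ht.2).ne'
  have h2 : t - a ≠ 0 := (sub_pos.2 ht.1).ne'
  have h3 := (hd (2 + Real.log (b - t) / K)).comp t
    (((((hasDerivAt_id t).const_sub b).log h1).div_const K).const_add 2)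
  have h4 := (hd (2 + Real.log (t - a) / K)).comp t
    (((((hasDerivAt_id t).sub_const a).log h2).div_const K).const_add 2)
  rw [hev.deriv_eq]
  exact (h3.mul h4).deriv

lemma exists_logCutoff_eq_one (ht : t ∈ Set.Ioo a b) : ∃ K, 0 < K ∧ logCutoff a b K t = 1 := by
  -- K exceeds both logarithms in absolute value, so both arguments of the transition function are
  -- at least 2 - 1 = 1.
  set K := |Real.log (b - t)| + |Real.log (t - a)| + 1 with hK
  have hKp : 0 < K := by positivity
  refine ⟨K, hKp, ?_⟩
  have h : ∀ s, |s| ≤ K → Real.smoothTransition (2 + s / K) = 1 := by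
    intro s hs
    refine Real.smoothTransition.one_of_one_le ?_
    have : -1 ≤ s / K := by
      rw [le_div_iff₀ hKp]
      linarith [(abs_le.1 hs).1]
    linarith
  rw [logCutoff_of_mem ht, h _ (by rw [hK]; linarith [abs_nonneg (Real.log (t - a))]),
    h _ (by rw [hK]; linarith [abs_nonneg (Real.log (b - t))]), one_mul]

/-- The key estimate for the error term of the cutoff. -/
lemma neg_le_deriv_logCutoff_mul {D C S H : ℝ} (hK : 0 < K)
    (hD : ∀ x, deriv Real.smoothTransition x ≤ D) (ht : t ∈ Set.Ioo a b) (hS : 0 ≤ S)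
    (hSb : S ≤ C * (b - t)) (hSa : S ≤ C * (t - a)) (hHa : (t - a) * H ≤ S / 2)
    (hHb : (t - b) * H ≤ S / 2) : -(2 * D * C / (b - a) / K) ≤ deriv (logCutoff a b K) t * H := by
  have h1 : 0 < b - t := sub_pos.2 ht.2
  have h2 : 0 < t - a := sub_pos.2 ht.1
  have hba : 0 < b - a := by linarith
  have hD0 : 0 ≤ D := (deriv_smoothTransition_nonneg 0).trans (hD 0)
  -- S is at most C times the smaller distance to the ends, and the larger distance is at least (b -
  -- a)/2.
  have hSC : S / ((b - t) * (t - a)) ≤ 2 * C / (b - a) := by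
    rw [div_le_div_iff₀ (by positivity) hba]
    nlinarith
  -- One estimate for both ends: s is the distance to the end whose cutoff factor is differentiated,
  -- r the distance to the other end, and H' is H at b and -H at a.
  have key : ∀ x y s r H' : ℝ, 0 < s → 0 < r → r * H' ≤ S / 2 → (b - t) * (t - a) = s * r →
      deriv Real.smoothTransition x * (1 / s / K) * Real.smoothTransition y * H'
        ≤ D * C / (b - a) / K := by
    intro x y s r H' hs hr hH' hsr
    have h3 : H' ≤ S / (2 * r) := by
      rw [le_div_iff₀ (by positivity)]
      linarith
    have h4 : 0 ≤ deriv Real.smoothTransition x * (1 / s / K) * Real.smoothTransition y :=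
      mul_nonneg (mul_nonneg (deriv_smoothTransition_nonneg x) (by positivity))
        (Real.smoothTransition.nonneg y)
    calc deriv Real.smoothTransition x * (1 / s / K) * Real.smoothTransition y * H'
        ≤ deriv Real.smoothTransition x * (1 / s / K) * Real.smoothTransition y * (S / (2 * r)) :=
          mul_le_mul_of_nonneg_left h3 h4
      _ ≤ D * (1 / s / K) * 1 * (S / (2 * r)) := by
          have := Real.smoothTransition.le_one y
          have := Real.smoothTransition.nonneg y
          have := hD x
          gcongr
      _ = D * (S / ((b - t) * (t - a))) / (2 * K) := by
          rw [hsr]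
          field_simp
      _ ≤ D * (2 * C / (b - a)) / (2 * K) := by gcongr
      _ = D * C / (b - a) / K := by field_simp
  have hA := key (2 + Real.log (b - t) / K) (2 + Real.log (t - a) / K) (b - t) (t - a) H h1 h2 hHa rfl
  have hB := key (2 + Real.log (t - a) / K) (2 + Real.log (b - t) / K) (t - a) (b - t) (-H) h2 h1
    (by linarith) (mul_comm _ _)
  rw [deriv_logCutoff ht]
  have e1 : -1 / (b - t) / K = -(1 / (b - t) / K) := by ring
  have e2 : 2 * D * C / (b - a) / K = D * C / (b - a) / K + D * C / (b - a) / K := by ring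
  rw [e1, e2]
  linarith

end LogCutoff

end SphereHypersurface

end

noncomputable section

open Finset Polynomial

namespace SphereHypersurface

variable {n : ℕ}

/-! ### The level function has no regular points -/

section Global

variable {M : Type*} [TopologicalSpace M] [ChartedSpace (EuclideanSpace ℝ (Fin n)) M]
  [IsManifold (𝓡 n) ∞ M] {f : M → UnitSphere n} {ν : M → EuclideanSpace ℝ (Fin (n + 1 + 1))}

lemma IsEigenframe.norm_eq_one {L : Dom n →L[ℝ] Amb n} {A : Module.End ℝ (Dom n)}
    {ε : Fin n → Dom n} {μ : Fin n → ℝ} (h : IsEigenframe L A ε μ) (i : Fin n) :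
    ‖L (ε i)‖ = 1 := by
  have h1 := h.inner_eq i i
  rw [if_pos rfl, real_inner_self_eq_norm_sq] at h1
  have h2 := norm_nonneg (L (ε i))
  nlinarith

lemma diffAt_const_sub {c : M → ℝ} (hc : ContMDiff (𝓡 n) 𝓘(ℝ, ℝ) ∞ c) (b : ℝ) (q : M)
    (v : Dom n) : diffAt (fun q => b - c q) q v = -diffAt c q v := by
  have hc' : ContMDiff (𝓡 n) 𝓘(ℝ, ℝ) ∞ fun q => b - c q := contMDiff_const.sub hc
  rw [diffAt_self hc', diffAt_self hc]
  have : ((fun q => b - c q) ∘ (extChartAt (𝓡 n) q).symm)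
      = fun y => b - (c ∘ (extChartAt (𝓡 n) q).symm) y := rfl
  rw [this, fderiv_const_sub]
  rfl

lemma diffAt_sub_const {c : M → ℝ} (hc : ContMDiff (𝓡 n) 𝓘(ℝ, ℝ) ∞ c) (a : ℝ) (q : M)
    (v : Dom n) : diffAt (fun q => c q - a) q v = diffAt c q v := by
  have hc' : ContMDiff (𝓡 n) 𝓘(ℝ, ℝ) ∞ fun q => c q - a := hc.sub contMDiff_const
  rw [diffAt_self hc', diffAt_self hc]
  have : ((fun q => c q - a) ∘ (extChartAt (𝓡 n) q).symm)
      = fun y => (c ∘ (extChartAt (𝓡 n) q).symm) y - a := rfl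
  rw [this, fderiv_sub_const]

omit [IsManifold (𝓡 n) ∞ M] in
lemma diffAt_levelField {P : ℝ[X]} {c : M → ℝ} {ε : M → Fin n → Dom n} {μ : M → Fin n → ℝ}
    (ψ : ℝ → ℝ) (q : M) :
    diffAt c q (levelField P c ε μ ψ q) = ψ (c q) * levelSlope P c ε μ q := by
  simp only [levelField, levelSlope, map_sum, map_smul, smul_eq_mul, Finset.mul_sum]
  refine Finset.sum_congr rfl fun j _ => ?_
  ring

/-- The level function of a compact hypersurface with nonnegative scalar curvature is critical
everywhere. -/
theorem IsLevelHypersurface.diffAt_eq_zero [CompactSpace M] [T2Space M] {P : ℝ[X]} {c : M → ℝ}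
    {ε : M → Fin n → Dom n} {μ : M → Fin n → ℝ} {R : ℝ} (h : IsLevelHypersurface f ν P c ε μ R)
    (hn : 3 ≤ n) (hR : 0 ≤ R) (q₀ : M) : diffAt (n := n) c q₀ = 0 := by
  by_contra hne
  have hf := h.isHypersurface
  obtain ⟨j₀, hj₀⟩ : ∃ j, diffAt c q₀ (ε q₀ j) ≠ 0 := by
    by_contra! hall
    refine hne (ContinuousLinearMap.ext fun v => ?_)
    rw [(h.isEigenframe q₀).eq_sum v]
    simp only [map_sum, map_smul, hall, smul_zero, Finset.sum_const_zero,
      _root_.zero_apply]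
  obtain ⟨qa, -, hqa⟩ := isCompact_univ.exists_isMinOn ⟨q₀, Set.mem_univ _⟩
    h.contMDiff.continuous.continuousOn
  obtain ⟨qb, -, hqb⟩ := isCompact_univ.exists_isMaxOn ⟨q₀, Set.mem_univ _⟩
    h.contMDiff.continuous.continuousOn
  set a := c qa with ha
  set b := c qb with hb
  have hac : ∀ q, a ≤ c q := fun q => hqa (Set.mem_univ q)
  have hcb : ∀ q, c q ≤ b := fun q => hqb (Set.mem_univ q)
  obtain ⟨Cb, hCb0, hCb⟩ := exists_sq_diffAt_le hf (g := fun q => b - c q)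
    (contMDiff_const.sub h.contMDiff) fun q => sub_nonneg.2 (hcb q)
  obtain ⟨Ca, hCa0, hCa⟩ := exists_sq_diffAt_le hf (g := fun q => c q - a)
    (h.contMDiff.sub contMDiff_const) fun q => sub_nonneg.2 (hac q)
  have hCb' : ∀ q j, diffAt c q (ε q j) ^ 2 ≤ Cb * (b - c q) := fun q j => by
    have := hCb q (ε q j) ((h.isEigenframe q).norm_eq_one j)
    rwa [diffAt_const_sub h.contMDiff, neg_sq] at this
  have hCa' : ∀ q j, diffAt c q (ε q j) ^ 2 ≤ Ca * (c q - a) := fun q j => by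
    have := hCa q (ε q j) ((h.isEigenframe q).norm_eq_one j)
    rwa [diffAt_sub_const h.contMDiff] at this
  have hq₀ : c q₀ ∈ Set.Ioo a b := by
    have hpos : 0 < diffAt c q₀ (ε q₀ j₀) ^ 2 := by positivity
    constructor
    · exact sub_pos.1 (pos_of_mul_pos_right (hpos.trans_le (hCa' q₀ j₀)) hCa0)
    · exact sub_pos.1 (pos_of_mul_pos_right (hpos.trans_le (hCb' q₀ j₀)) hCb0)
  have hinj : ∀ q, c q ∈ Set.Ioo a b → Function.Injective (μ q) := fun q hq =>
    h.injective_curvature (by omega) hq.1 hq.2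
  set C := n * max Ca Cb with hC
  set S : M → ℝ := fun q => ∑ j, diffAt c q (ε q j) ^ 2 with hS
  have hSb : ∀ q, S q ≤ C * (b - c q) := fun q => by
    calc S q ≤ ∑ _j : Fin n, Cb * (b - c q) := Finset.sum_le_sum fun j _ => hCb' q j
      _ = n * Cb * (b - c q) := by simp [mul_assoc]
      _ ≤ C * (b - c q) := by
        have := sub_nonneg.2 (hcb q)
        have := le_max_right Ca Cb
        rw [hC]
        gcongr
  have hSa : ∀ q, S q ≤ C * (c q - a) := fun q => by
    calc S q ≤ ∑ _j : Fin n, Ca * (c q - a) := Finset.sum_le_sum fun j _ => hCa' q j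
      _ = n * Ca * (c q - a) := by simp [mul_assoc]
      _ ≤ C * (c q - a) := by
        have := sub_nonneg.2 (hac q)
        have := le_max_left Ca Cb
        rw [hC]
        gcongr
  have hslope : ∀ q, c q ∈ Set.Ioo a b → ∀ t, (∀ j, t * accelCoeff P (μ q j) < 1 / 2) →
      t * levelSlope P c ε μ q ≤ S q / 2 := by
    intro q hq t ht
    rw [levelSlope, Finset.mul_sum, hS, Finset.sum_div]
    refine Finset.sum_le_sum fun j _ => ?_
    have := mul_le_mul_of_nonneg_right (ht j).le (sq_nonneg (diffAt c q (ε q j)))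
    linarith
  obtain ⟨D, hD⟩ := exists_deriv_smoothTransition_le
  obtain ⟨K₀, hK₀, hK₀1⟩ := exists_logCutoff_eq_one hq₀
  set ψ : ℝ → ℝ → ℝ := fun K => logCutoff a b K with hψ
  set N : ℝ → M → ℝ := fun K q => deriv (ψ K) (c q) * levelSlope P c ε μ q
    + ψ K (c q) * levelDiv P c ε μ R q with hN
  have hdiv : ∀ K, 0 < K → HasDivergence f (levelField P c ε μ (ψ K)) (N K) := fun K hK =>
    h.hasDivergence_levelField (by omega) (contDiff_logCutoff hK) fun q hq =>
      hinj q (tsupport_logCutoff_subset hK hq)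
  set g : M → ℝ := fun q => ψ K₀ (c q) * levelDiv P c ε μ R q with hg
  -- Continuity is not visible in the pointwise chosen frames. The divergence of the cut-off field
  -- is continuous, and its other summand is dc applied to the field with cutoff ψ', also
  -- continuous; g is the difference.
  have hgcont : Continuous g := by
    have h1 : ContDiff ℝ ∞ (deriv (ψ K₀)) := (contDiff_infty_iff_deriv.1 (contDiff_logCutoff hK₀)).2
    have h2 := h.hasDivergence_levelField (by omega) h1 fun q hq =>
      hinj q (tsupport_logCutoff_subset hK₀ (tsupport_deriv_subset hq))
    have h3 := ((hdiv K₀ hK₀).continuous hf).sub (h2.continuous_diffAt hf h.contMDiff)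
    refine h3.congr fun q => ?_
    simp only [Pi.sub_apply, diffAt_levelField, hN, hg]
    ring
  have hdivpos : ∀ q, c q ∈ Set.Ioo a b → 0 ≤ levelDiv P c ε μ R q := fun q hq => by
    rw [levelDiv]
    have : ∑ j, quadCoeff P (μ q) (μ q j) * diffAt c q (ε q j) ^ 2 ≤ 0 :=
      Finset.sum_nonpos fun j _ => mul_nonpos_of_nonpos_of_nonneg
        (quadCoeff_neg (hinj q hq) hn (h.eq_nodal q) j).le (sq_nonneg _)
    linarith
  have hg0 : ∀ q, 0 ≤ g q := fun q => by
    by_cases hq : c q ∈ Set.Ioo a b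
    · exact mul_nonneg logCutoff_nonneg (hdivpos q hq)
    · simp [hg, hψ, logCutoff_of_notMem hq]
  have hgq₀ : 0 < g q₀ := by
    have : ∑ j, quadCoeff P (μ q₀) (μ q₀ j) * diffAt c q₀ (ε q₀ j) ^ 2 < 0 :=
      Finset.sum_neg' (fun j _ => mul_nonpos_of_nonpos_of_nonneg
        (quadCoeff_neg (hinj q₀ hq₀) hn (h.eq_nodal q₀) j).le (sq_nonneg _))
        ⟨j₀, Finset.mem_univ _, mul_neg_of_neg_of_pos
          (quadCoeff_neg (hinj q₀ hq₀) hn (h.eq_nodal q₀) j₀) (by positivity)⟩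
    simp only [hg, hψ, hK₀1, levelDiv]
    linarith
  set B := 2 * D * C / (b - a) with hB
  have hB0 : 0 ≤ B := by
    have h1 : 0 ≤ D := (deriv_smoothTransition_nonneg 0).trans (hD 0)
    have h2 : 0 < b - a := by linarith [hq₀.1, hq₀.2]
    have h3 : 0 ≤ max Ca Cb := le_max_of_le_left hCa0
    positivity
  -- Pointwise, the divergence at scale K is at least g - B/K: the main term grows with K and the
  -- cutoff error is at least -B/K.
  have hNg : ∀ K, K₀ ≤ K → ∀ q, 0 ≤ N K q + (-1 * g q + B / K * 1) := by
    intro K hK q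
    have hKp := hK₀.trans_le hK
    by_cases hq : c q ∈ Set.Ioo a b
    · have hacc := fun j => h.mul_accelCoeff_lt (by omega) hq.1 hq.2 j
      have h1 := neg_le_deriv_logCutoff_mul hKp hD hq (Finset.sum_nonneg fun j _ => sq_nonneg _)
        (hSb q) (hSa q) (hslope q hq _ fun j => (hacc j).1) (hslope q hq _ fun j => (hacc j).2)
      have h2 := mul_le_mul_of_nonneg_right (logCutoff_mono (a := a) (b := b) (t := c q) hK₀ hK)
        (hdivpos q hq)
      simp only [hN, hg, hψ]
      linarith
    · have hs : c q ∉ tsupport (ψ K) := fun hm => hq (tsupport_logCutoff_subset hKp hm)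
      have h1 : ψ K =ᶠ[nhds (c q)] fun _ => 0 := notMem_tsupport_iff_eventuallyEq.1 hs
      have h2 : deriv (ψ K) (c q) = 0 := by
        rw [h1.deriv_eq]
        simp
      simp only [hN, hg, h2]
      simp only [hψ, logCutoff_of_notMem hq]
      have : 0 ≤ B / K := by positivity
      linarith
  obtain ⟨I, hadd, hmul, hnonneg, hpos, hzero⟩ := exists_integral hf
  have hIg : 0 < I g := hpos g hgcont hg0 q₀ hgq₀
  have hI1 : 0 ≤ I fun _ => 1 := hnonneg _ fun _ => zero_le_one
  have hle : ∀ K, K₀ ≤ K → I g ≤ B / K * I fun _ => 1 := by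
    intro K hK
    have h1 := hnonneg _ (hNg K hK)
    rw [hadd (N K) (fun q => -1 * g q + B / K * 1) ((hdiv K (hK₀.trans_le hK)).continuous hf)
      ((continuous_const.mul hgcont).add continuous_const),
      hadd (fun q => -1 * g q) (fun _ => B / K * 1) (continuous_const.mul hgcont)
      continuous_const, hmul, hmul (B / K) fun _ => 1,
      hzero _ _ (hdiv K (hK₀.trans_le hK))] at h1
    linarith
  set T := B * I fun _ => 1 with hT
  have hT0 : 0 ≤ T := mul_nonneg hB0 hI1
  -- Since I(g) ≤ T/K for every K ≥ K₀, this choice of K gives K₀ I(g) ≤ 0, a contradiction.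
  have h1 := hle (K₀ + T / I g) (by have : 0 ≤ T / I g := by positivity
                                    linarith)
  have h2 : B / (K₀ + T / I g) * (I fun _ => 1) = T / (K₀ + T / I g) := by
    rw [hT]
    ring
  have h3 : 0 < K₀ + T / I g := by positivity
  rw [h2, le_div_iff₀ h3, mul_add, mul_div_cancel₀ _ hIg.ne'] at h1
  nlinarith

end Global

end SphereHypersurface

end

noncomputable section

open Finset Polynomial

namespace SphereHypersurface

variable {n : ℕ}

/-! ### Reduction to a level function, and its consequences -/

section Main

variable {M : Type*} [TopologicalSpace M] [ChartedSpace (EuclideanSpace ℝ (Fin n)) M]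
  {f : M → UnitSphere n} {ν : M → EuclideanSpace ℝ (Fin (n + 1 + 1))}

lemma principalCurvatures_eq {q : M} {ε : Fin n → Dom n} {μ : Fin n → ℝ}
    (h : IsEigenframe (diffAt (position f) q) (shapeOperator f ν q) ε μ) :
    principalCurvatures f ν q = univ.val.map μ := by
  rw [principalCurvatures, h.charpoly_eq, roots_nodal]

lemma powerSum_eq {q : M} {ε : Fin n → Dom n} {μ : Fin n → ℝ}
    (h : IsEigenframe (diffAt (position f) q) (shapeOperator f ν q) ε μ) (k : ℕ) :
    powerSum f ν k q = ∑ i, μ i ^ k := by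
  rw [powerSum, principalCurvatures_eq h, Multiset.map_map]
  rfl

variable [IsManifold (𝓡 n) ∞ M]

/-- If all but the last power sum of the principal curvatures are constant, the characteristic
polynomials of the shape operators differ by constants. -/
lemma exists_isLevelHypersurface [Nonempty M] (hn : 3 ≤ n) (hf : IsHypersurface f)
    (hν : IsUnitNormal f ν)
    (hsum : ∀ k : ℕ, 1 ≤ k → k ≤ n - 1 → ∃ c : ℝ, ∀ p, powerSum f ν k p = c) :
    ∃ P c ε μ R, IsLevelHypersurface f ν P c ε μ R := by
  choose ε μ heig using exists_isEigenframe_shapeOperator hf hν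
  obtain ⟨p₀⟩ := ‹Nonempty M›
  have hps : ∀ k : ℕ, 1 ≤ k → k ≤ n - 1 → ∀ q q', ∑ i, μ q i ^ k = ∑ i, μ q' i ^ k := by
    intro k hk1 hk2 q q'
    obtain ⟨s, hs⟩ := hsum k hk1 hk2
    rw [← powerSum_eq (heig q), ← powerSum_eq (heig q'), hs, hs]
  set P := Lagrange.nodal univ (μ p₀) with hP
  have hc : ∀ q, ∃ s : ℝ, P - C s = Lagrange.nodal univ (μ q) := by
    intro q
    have hprod : ∀ q, ((univ.val.map (μ q)).map fun a => X - C a).prod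
        = Lagrange.nodal univ (μ q) := fun q => by
      rw [Multiset.map_map]
      rfl
    obtain ⟨s, hs⟩ := exists_prod_eq_add_C (n := n) (univ.val.map (μ p₀)) (univ.val.map (μ q))
      (by simp) (by simp) fun k hk1 hk2 => by
        rw [Multiset.map_map, Multiset.map_map]
        exact hps k hk1 hk2 p₀ q
    rw [hprod, hprod] at hs
    exact ⟨s, by rw [hP, hs, add_sub_cancel_right]⟩
  choose c hc using hc
  refine ⟨P, c, ε, μ, gaussScalar (μ p₀), hf, hν, heig, fun p => ?_, hc, fun q => ?_⟩
  -- The constant coefficient of the characteristic polynomial is (-1)^n times the determinant of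
  -- the shape operator, which is smooth in a chart; this recovers c smoothly.
  · set F : Dom n → ℝ := fun x =>
      P.coeff 0 - (-1) ^ n * LinearMap.det (shape (chartPos f p) (chartNormal ν p) x) with hF
    have hFC : ContDiffOn ℝ ∞ F (extChartAt (𝓡 n) p).target :=
      contDiffOn_const.sub (contDiffOn_const.mul
        (hf.isLocalHypersurface hν p).contDiffOn_det_shape)
    have hFp : ContDiffAt ℝ ∞ F (extChartAt (𝓡 n) p p) :=
      hFC.contDiffAt ((isOpen_extChartAt_target p).mem_nhds (mem_extChartAt_target p))
    refine (hFp.contMDiffAt.comp p (contMDiffAt_extChartAt (n := ∞))).congr_of_eventuallyEq ?_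
    filter_upwards [extChartAt_source_mem_nhds (I := 𝓡 n) p] with q hq
    have h1 := (isEigenframe_chart hf hν hq (heig q)).charpoly_eq
    have h2 := congrArg (fun Q : ℝ[X] => Q.coeff 0) (hc q)
    simp only [coeff_sub, coeff_C_zero] at h2
    rw [Function.comp_apply, hF]
    simp only
    rw [LinearMap.det_eq_sign_charpoly_coeff, h1, ← h2, finrank_euclideanSpace_fin, ← mul_assoc,
      ← mul_pow]
    simp
  -- The scalar curvature depends only on the power sums of orders 1 and 2, and 2 ≤ n - 1.
  · have h1 := hps 1 le_rfl (by omega) q p₀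
    simp only [pow_one] at h1
    rw [gaussScalar_eq, gaussScalar_eq, h1, hps 2 (by omega) (by omega) q p₀]

/-- Read c in a chart on a ball around the base point; the ball is connected and the derivative
vanishes on it. -/
lemma isLocallyConstant_of_diffAt_eq_zero {c : M → ℝ} (hc : ContMDiff (𝓡 n) 𝓘(ℝ, ℝ) ∞ c)
    (h : ∀ q, diffAt (n := n) c q = 0) : IsLocallyConstant c := by
  refine (IsLocallyConstant.iff_eventually_eq c).2 fun p => ?_
  have hTo := isOpen_extChartAt_target (I := 𝓡 n) p
  obtain ⟨r, hr, hball⟩ := Metric.isOpen_iff.1 hTo _ (mem_extChartAt_target p)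
  have hu := contDiffOn_comp_chart_symm hc p
  filter_upwards [extChartAt_source_mem_nhds (I := 𝓡 n) p,
    (continuousAt_extChartAt (I := 𝓡 n) p).preimage_mem_nhds (Metric.ball_mem_nhds _ hr)]
    with q hq hqb
  have := Metric.isOpen_ball.is_const_of_fderiv_eq_zero
    (convex_ball (extChartAt (𝓡 n) p p) r).isPreconnected
    ((hu.mono hball).differentiableOn (by simp)) (fun y hy => by
      have hs := (extChartAt (𝓡 n) p).map_target (hball hy)
      refine ContinuousLinearMap.ext fun v => ?_
      obtain ⟨w, rfl⟩ := (bijective_chartDeriv hs).2 v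
      have h1 := diffAt_chart hc hs w
      rw [(extChartAt (𝓡 n) p).right_inv (hball hy), h] at h1
      exact h1) hqb (Metric.mem_ball_self hr)
  rwa [Function.comp_apply, Function.comp_apply, (extChartAt (𝓡 n) p).left_inv hq,
    (extChartAt (𝓡 n) p).left_inv (mem_extChartAt_source p)] at this

namespace IsLevelHypersurface

variable {P : ℝ[X]} {c : M → ℝ} {ε : M → Fin n → Dom n} {μ : M → Fin n → ℝ} {R : ℝ}

omit [IsManifold (𝓡 n) ∞ M] in
lemma principalCurvatures_eq_of_eq (h : IsLevelHypersurface f ν P c ε μ R) {p q : M}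
    (hpq : c q = c p) : principalCurvatures f ν q = principalCurvatures f ν p := by
  rw [principalCurvatures_eq (h.isEigenframe q), principalCurvatures_eq (h.isEigenframe p)]
  exact map_eq_of_nodal_eq (by rw [← h.eq_nodal, hpq, h.eq_nodal])

/-- If the level function is critical everywhere and the principal curvatures are distinct
somewhere, the scalar curvature vanishes. -/
lemma eq_zero_of_nodup (h : IsLevelHypersurface f ν P c ε μ R) (hn : 2 ≤ n)
    (hc : ∀ q, diffAt (n := n) c q = 0) {p : M} (hp : (principalCurvatures f ν p).Nodup) :
    R = 0 := by
  rw [principalCurvatures_eq (h.isEigenframe p)] at hp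
  have hinj : Function.Injective (μ p) := fun i j hij =>
    Multiset.inj_on_of_nodup_map hp i (by simp) j (by simp) hij
  have hleft := (extChartAt (𝓡 n) p).left_inv (mem_extChartAt_source p)
  obtain ⟨V, e, lam, hVT, hxV, hfr, -⟩ := h.exists_levelFrame (mem_extChartAt_target p)
    (by rw [hleft]; exact hinj)
  have h0 := hfr.gaussScalar_eq_zero hxV hn fun y hy => by
    have hs := (extChartAt (𝓡 n) p).map_target (hVT hy)
    refine ContinuousLinearMap.ext fun v => ?_
    obtain ⟨w, rfl⟩ := (bijective_chartDeriv hs).2 v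
    have h1 := diffAt_chart h.contMDiff hs w
    rw [(extChartAt (𝓡 n) p).right_inv (hVT hy), hc] at h1
    exact h1
  rw [← h.gaussScalar_eq p, ← h0]
  refine gaussScalar_congr ?_
  rw [← h.eq_nodal, ← hfr.eq_nodal _ hxV, Function.comp_apply, hleft]

end IsLevelHypersurface

end Main

end SphereHypersurface

end

open SphereHypersurface in
theorem corollary1p2 (n : ℕ) (hn : 3 < n)
    (M : Type*) [TopologicalSpace M] [T2Space M] [CompactSpace M]
    [ChartedSpace (EuclideanSpace ℝ (Fin n)) M] [IsManifold (𝓡 n) ∞ M]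
    (f : M → UnitSphere n) (hf : IsHypersurface f)
    (ν : M → EuclideanSpace ℝ (Fin (n + 1 + 1))) (hν : IsUnitNormal f ν)
    (hR : ∀ p, 0 ≤ scalarCurvature f p)
    (hsum : ∀ k : ℕ, 1 ≤ k → k ≤ n - 1 → ∃ c : ℝ, ∀ p, powerSum f ν k p = c) :
    IsIsoparametric f ν ∧
      ((∃ p, Multiset.card (principalCurvatures f ν p) = n ∧ (principalCurvatures f ν p).Nodup) →
        ∀ p, scalarCurvature f p = 0) := by
  -- A point is needed to choose the reference polynomial P and to see R ≥ 0.
  rcases isEmpty_or_nonempty M with hM | ⟨⟨p₀⟩⟩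
  · exact ⟨fun p => hM.elim p, fun _ p => hM.elim p⟩
  have : Nonempty M := ⟨p₀⟩
  obtain ⟨P, c, ε, μ, R, h⟩ := exists_isLevelHypersurface (by omega) hf hν hsum
  have hscal : ∀ p, scalarCurvature f p = R := fun p =>
    (scalarCurvature_eq hf hν (h.isEigenframe p)).trans (h.gaussScalar_eq p)
  have hc := h.diffAt_eq_zero (by omega) (hscal p₀ ▸ hR p₀)
  have hlc := isLocallyConstant_of_diffAt_eq_zero h.contMDiff hc
  refine ⟨fun p q hq => h.principalCurvatures_eq_of_eq ?_, ?_⟩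
  · exact hlc.apply_eq_of_isPreconnected isPreconnected_connectedComponent hq
      mem_connectedComponent
  · rintro ⟨p, -, hp⟩ q
    rw [hscal, h.eq_zero_of_nodup (by omega) hc hp]
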